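/- **Corollary ($k$-uniformly convex functions).** Let $\mathbb D$ be the open unit disk in $\mathbb C$. For $0\le k<\infty$ let $\Omega_k=\{w\in\mathbb C:\operatorname{Re}w>k|w-1|\}$, and let $k\text{-}\mathcal{UCV}$ be the class of analytic functions $f$ in $\mathbb D$ with $f(0)=f'(0)-1=0$ for which $f'$ has no zeros and $1+zf''(z)/f'(z)\in\Omega_k$ for all $z\in\mathbb D$. For such $f$ let $\log f'$ be the analytic branch in $\mathbb D$ with $\log f'(0)=0$, and let $a_2(f)=f''(0)/2$. For $0<x<1$ put $$K(x)=\int_0^1\frac{dt}{\sqrt{(1-t^2)(1-x^2t^2)}} .$$ If $k>1$, there is exactly one $x\in(0,1)$ with $k=\cosh\dfrac{\pi K(\sqrt{1-x^2})}{4K(x)}$; let $x$ be this number and $u(z)=(z-\sqrt x)/(1-\sqrt x\,z)$. Put $$ P_k(z)=\begin{cases} \dfrac{1}{1-k^2}\cosh\Bigl(A\log\dfrac{1+\sqrt z}{1-\sqrt z}\Bigr)-\dfrac{k^2}{1-k^2}, & 0\le k<1,\ A=\tfrac2\pi\arccos k,\\[3mm] 1+\dfrac{2}{\pi^2}\Bigl(\log\dfrac{1+\sqrt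 z}{1-\sqrt z}\Bigr)^2, & k=1,\\[3mm] \dfrac{1}{k^2-1}\sin\Bigl(\dfrac{\pi}{2K(x)}\displaystyle\int_0^{u(z)/\sqrt x}\dfrac{dt}{\sqrt{(1-t^2)(1-x^2t^2)}}\Bigr)+\dfrac{k^2}{k^2-1}, & k>1, \end{cases} \qquad \alpha_{k1}=\begin{cases} \dfrac{2A^2}{1-k^2}, & 0\le k<1,\\[2mm] \dfrac{8}{\pi^2}, & k=1,\\[2mm] \dfrac{\pi^2}{4(k^2-1)K(x)^2(1+x)\sqrt x}, & k>1 \end{cases} $$ (principal branches; the inner integral is taken along the segment). Then $P_k$ maps $\mathbb D$ conformally onto $\Omega_k$, with $P_k(0)=1$ and $P_k'(0)=\alpha_{k1}>0$. Let $z_0\in\mathbb D\setminus\{0\}$, let $\lambda\in\mathbb C$ with $|\lambda|\le\alpha_{k1}/2$, put $\gamma_1=2\lambda/\alpha_{k1}$ and $$V=\{\log f'(z_0): f\in k\text{-}\mathcal{UCV},\ a_2(f)=\lambda\}.$$ (i) If $|\gamma_1|=1$, then $V=\{w_0\}$ with $w_0=\int_0^{z_0}\zeta^{-1}\{P_k(\gamma_1\zeta)-1\}\,d\zeta$.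 (ii) If $|\gamma_1|<1$, then $V=Q_{\gamma_1}(z_0,\overline{\mathbb D})$, where $$Q_{\gamma_1}(z,\varepsilon)=\int_0^{z}\zeta^{-1}\Bigl\{P_k\Bigl(\zeta\,\frac{\varepsilon\zeta+\gamma_1}{1+\overline{\gamma_1}\,\varepsilon\zeta}\Bigr)-1\Bigr\}\,d\zeta .$$ The function $\varepsilon\mapsto Q_{\gamma_1}(z_0,\varepsilon)$ is analytic in a neighbourhood of $\overline{\mathbb D}$ and injective on $\overline{\mathbb D}$, and it maps both $\mathbb D$ and $\overline{\mathbb D}$ onto convex sets. Furthermore, for each $\varepsilon$ with $|\varepsilon|=1$, a function $f$ in $\mathbb D$ satisfies $f\in k\text{-}\mathcal{UCV}$, $a_2(f)=\lambda$ and $\log f'(z_0)=Q_{\gamma_1}(z_0,\varepsilon)$ if and only if $f(z)=\int_0^z e^{Q_{\gamma_1}(\zeta,\varepsilon)}\,d\zeta$ for all $z\in\mathbb D$. -/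

import Mathlib

open Complex Metric Set

noncomputable section

namespace KUCV

/-- The open unit disk. -/
abbrev disk : Set ℂ := ball (0 : ℂ) 1

/-- The closed unit disk. -/
abbrev closedDisk : Set ℂ := closedBall (0 : ℂ) 1

/-- The unit circle. -/
abbrev circle : Set ℂ := sphere (0 : ℂ) 1

/-- The integral `∫_0^z F(ζ) dζ` along the segment from `0` to `z`. -/
def segIntegral (F : ℂ → ℂ) (z : ℂ) : ℂ := ∫ t in (0 : ℝ)..1, F (t * z) * z

/-- The Taylor coefficient `a_n(f) = f^{(n)}(0) / n!`. -/
def coeff (n : ℕ) (f : ℂ → ℂ) : ℂ := iteratedDeriv n f 0 / (n.factorial : ℂ)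

/-- The class `𝒞𝒱(Ω)`: `f` analytic in the unit disk, `f(0) = f'(0) - 1 = 0`, and
`1 + z f''(z) / f'(z)` analytic (so that `f'` has no zeros) with values in `Ω`. -/
structure MemCV (Ω : Set ℂ) (f : ℂ → ℂ) : Prop where
  analytic : DifferentiableOn ℂ f disk
  map_zero : f 0 = 0
  deriv_zero : deriv f 0 = 1
  deriv_ne_zero : ∀ z ∈ disk, deriv f z ≠ 0
  mem : ∀ z ∈ disk, 1 + z * deriv (deriv f) z / deriv f z ∈ Ω

/-- `L` is the analytic branch of `log f'` in the unit disk with `L(0) = 0`. -/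
structure IsLogDeriv (f L : ℂ → ℂ) : Prop where
  analytic : DifferentiableOn ℂ L disk
  map_zero : L 0 = 0
  exp_eq : ∀ z ∈ disk, exp (L z) = deriv f z

/-- The domain `Ω_k`, bounded by a conic section. -/
def Omega (k : ℝ) : Set ℂ := {w | k * ‖w - 1‖ < w.re}

/-- The class of `k`-uniformly convex functions. -/
def UCV (k : ℝ) : Set (ℂ → ℂ) := {f | MemCV (Omega k) f}

/-- The region of variability of `log f'(z₀)` over the `k`-uniformly convex functions `f`
with `a₂(f) = l`. -/
def V (k : ℝ) (z₀ l : ℂ) : Set ℂ :=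
  {w | ∃ f ∈ UCV k, coeff 2 f = l ∧ ∃ L, IsLogDeriv f L ∧ w = L z₀}

/-- The complete elliptic integral `K(x) = ∫_0^1 dt / √((1 - t²)(1 - x² t²))`. -/
def ellK (x : ℝ) : ℝ := ∫ t in (0 : ℝ)..1, 1 / Real.sqrt ((1 - t ^ 2) * (1 - x ^ 2 * t ^ 2))

/-- The incomplete elliptic integral `∫_0^v dt / √((1 - t²)(1 - x² t²))` along the segment from
`0` to `v`, with the principal branch of the square root. -/
def ellF (x : ℝ) (v : ℂ) : ℂ :=
  segIntegral (fun t => 1 / ((1 - t ^ 2) * (1 - (x : ℂ) ^ 2 * t ^ 2)) ^ (1 / 2 : ℂ)) v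

/-- `x ∈ (0,1)` is the modulus that belongs to `k > 1`, that is,
`k = cosh (π K'(x) / (4 K(x)))` with `K'(x) = K(√(1 - x²))`. -/
def IsModulus (k x : ℝ) : Prop :=
  0 < x ∧ x < 1 ∧ k = Real.cosh (Real.pi * ellK (Real.sqrt (1 - x ^ 2)) / (4 * ellK x))

/-- `u(z) = (z - √x) / (1 - √x z)`. -/
def u (x : ℝ) (z : ℂ) : ℂ := (z - (Real.sqrt x : ℂ)) / (1 - (Real.sqrt x : ℂ) * z)

/-- `A = (2/π) arccos k`. -/
def A (k : ℝ) : ℝ := 2 / Real.pi * Real.arccos k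

/-- `log ((1 + √z) / (1 - √z))`, principal branches. -/
def logQuot (z : ℂ) : ℂ := log ((1 + z ^ (1 / 2 : ℂ)) / (1 - z ^ (1 / 2 : ℂ)))

/-- The map `P_k`; the parameter `x` matters only for `k > 1`. -/
def P (k x : ℝ) (z : ℂ) : ℂ :=
  if k < 1 then
    1 / (1 - (k : ℂ) ^ 2) * cosh ((A k : ℂ) * logQuot z) - (k : ℂ) ^ 2 / (1 - (k : ℂ) ^ 2)
  else if k = 1 then
    1 + 2 / (Real.pi : ℂ) ^ 2 * logQuot z ^ 2
  else
    1 / ((k : ℂ) ^ 2 - 1)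
        * sin ((Real.pi : ℂ) / (2 * (ellK x : ℂ)) * ellF x (u x z / (Real.sqrt x : ℂ)))
      + (k : ℂ) ^ 2 / ((k : ℂ) ^ 2 - 1)

/-- The number `α_{k1}`, the first Taylor coefficient of `P_k`. -/
def alpha (k x : ℝ) : ℝ :=
  if k < 1 then 2 * A k ^ 2 / (1 - k ^ 2)
  else if k = 1 then 8 / Real.pi ^ 2
  else Real.pi ^ 2 / (4 * (k ^ 2 - 1) * ellK x ^ 2 * (1 + x) * Real.sqrt x)

/-- `Q_γ(z, ε) = ∫_0^z ζ⁻¹ { P_k(ζ (ε ζ + γ) / (1 + γ̄ ε ζ)) - 1 } dζ`. -/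
def Q (k x : ℝ) (γ z ε : ℂ) : ℂ :=
  segIntegral
    (fun ζ => ζ⁻¹ * (P k x (ζ * ((ε * ζ + γ) / (1 + (starRingEnd ℂ) γ * ε * ζ))) - 1)) z

end KUCV

end

namespace KUCV

open Filter Topology MeasureTheory
open scoped Interval

/-! Let P map the disk conformally onto a convex Ω with P(0) = 1. For f in the class, 1 + z f''/f'
is subordinate to P, so it equals P(z b(z)) with b analytic and bounded by 1, and log f' is the
integral `logInt P b`. Conversely every such b gives a member of the class (`exists_of_memCV`,
`memCV_segIntegral`). Prescribing a₂ prescribes b(0) = γ. If |γ| = 1, then b is constant. If |γ| <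
1, one Schur step (`exists_schur`) writes b(ζ) = mob γ (ζ c(ζ)) with c an arbitrary analytic
function bounded by 1, and the constants c = ε produce Q(·, ε).

Everything then rests on the support inequality `re_logInt_sub_neg`: if |c| ≤ |ε| and c omits the
value ε, then (log f'(z₀) - Q(z₀, ε)) / (ε ∂Q/∂ε) has negative real part. For |ε| = 1 this confines
V to an intersection of half-planes. Applied to constants c it shows that Q(z₀, ·) is injective on
the closed disk and that its image is exactly this intersection, hence convex
(`convex_image_of_re_neg`). Equality for some |ε| = 1 forces c to take the value ε, so c is the
constant ε by the maximum principle.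

To prove the support inequality, note that for fixed ζ the map w ↦ P(ζ mob γ w) is again a convex
map, because P has convex images of subdisks. The inequality `re_div_neg` for convex maps then gives
the sign of the quotient ν/d of the ζ-derivatives of numerator and denominator. The sign survives
integration (`re_avg_div_avg_neg`, by Jack's lemma) provided z² avg d is starlike. Starlikeness
follows from convexity of the same function (`re_avg_div_pos`), that is, from Re `convT` > 0. This
is checked for |ε| = |z| = 1, where z ω'/ω is real and nonnegative and the claim reduces to Study's
inequality.

It remains to see that P_k is such a map. For k ≤ 1 it is an even function on a strip composed with
log((1 + √z)/(1 - √z)), and evenness cancels the square root. For k > 1 the substitution v = cos χ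
turns sin(π/(2K) · ellF v) into cos(π/(2K) · amp χ). The map `amp` is monotone in each coordinate on
a quarter of the region |cos χ|² ≤ 1/x and sends its top edge to the height K'/2; reflections and a
connectedness argument do the rest. The modulus exists and is unique because K'/K decreases from ∞
to 0. -/

/-! ### Primitives, removable singularities, maximum principles and Jack's lemma. -/

/-- Differentiation under the integral sign for jointly continuous derivatives. -/
theorem hasDerivAt_intervalIntegral_param {U : Set ℂ} (hU : IsOpen U) {F F' : ℝ → ℂ → ℂ}
    (hF : ∀ z ∈ U, ContinuousOn (fun t => F t z) (Icc 0 1))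
    (hF' : ContinuousOn (fun p : ℝ × ℂ => F' p.1 p.2) (Icc 0 1 ×ˢ U))
    (hd : ∀ t ∈ Icc (0 : ℝ) 1, ∀ z ∈ U, HasDerivAt (F t) (F' t z) z) {z₀ : ℂ} (hz₀ : z₀ ∈ U) :
    HasDerivAt (fun z => ∫ t in (0 : ℝ)..1, F t z) (∫ t in (0 : ℝ)..1, F' t z₀) z₀ := by
  obtain ⟨r, hr, hrU⟩ := Metric.nhds_basis_closedBall.mem_iff.1 (hU.mem_nhds hz₀)
  obtain ⟨C, hC⟩ := (isCompact_Icc.prod (isCompact_closedBall z₀ r)).exists_bound_of_continuousOn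
    (hF'.mono (prod_mono_right hrU))
  have hsub : Ι (0 : ℝ) 1 ⊆ Icc 0 1 := by
    rw [uIoc_of_le zero_le_one]; exact Ioc_subset_Icc_self
  have hm : ∀ G : ℝ → ℂ, ContinuousOn G (Icc 0 1) →
      AEStronglyMeasurable G (volume.restrict (Ι (0 : ℝ) 1)) := fun G hG =>
    (hG.mono hsub).aestronglyMeasurable measurableSet_uIoc
  refine (intervalIntegral.hasDerivAt_integral_of_dominated_loc_of_deriv_le (F := fun z t => F t z)
    (F' := fun z t => F' t z) (bound := fun _ => C) (ball_mem_nhds z₀ hr) ?_ ?_ ?_ ?_ ?_ ?_).2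
  · filter_upwards [hU.mem_nhds hz₀] with z hz using hm _ (hF z hz)
  · exact ContinuousOn.intervalIntegrable (by rw [uIcc_of_le zero_le_one]; exact hF z₀ hz₀)
  · exact hm _ (hF'.comp (f := fun t : ℝ => (t, z₀)) (by fun_prop) fun t ht => ⟨ht, hz₀⟩)
  · refine .of_forall fun t ht z hz => hC (t, z) ⟨hsub ht, ball_subset_closedBall hz⟩
  · simp
  · exact .of_forall fun t ht z hz => hd t (hsub ht) z (hrU (ball_subset_closedBall hz))

/-- On an open star-shaped set, the integral along segments is a primitive. -/
theorem hasDerivAt_segIntegral {U : Set ℂ} (hU : IsOpen U) (hs : StarConvex ℝ 0 U) {F : ℂ → ℂ}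
    (hF : DifferentiableOn ℂ F U) {z : ℂ} (hz : z ∈ U) :
    HasDerivAt (segIntegral F) (F z) z := by
  have hmem : ∀ t ∈ Icc (0 : ℝ) 1, ∀ z ∈ U, (t : ℂ) * z ∈ U := fun t ht z hz => by
    simpa using hs hz (sub_nonneg.2 ht.2) ht.1 (by ring)
  have hF' : DifferentiableOn ℂ (deriv F) U := hF.deriv hU
  have hc : ∀ z ∈ U, ContinuousOn (fun t : ℝ => F (t * z)) (Icc 0 1) := fun z hz =>
    hF.continuousOn.comp (by fun_prop) fun t ht => hmem t ht z hz
  have hc' : ∀ z ∈ U, ContinuousOn (fun t : ℝ => deriv F (t * z)) (Icc 0 1) := fun z hz =>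
    hF'.continuousOn.comp (by fun_prop) fun t ht => hmem t ht z hz
  have key := hasDerivAt_intervalIntegral_param hU (F := fun t z => F (t * z) * z)
    (F' := fun t z => deriv F (t * z) * t * z + F (t * z))
    (fun z hz => (hc z hz).mul continuousOn_const) ?_ ?_ hz
  · refine key.congr_deriv ?_
    -- The differentiated integrand is itself the t-derivative of t F(tz), so its integral is F(z).
    have : ∀ t ∈ uIcc (0 : ℝ) 1, HasDerivAt (fun t : ℝ => (t : ℂ) * F (t * z))
        (deriv F (t * z) * t * z + F (t * z)) t := by
      intro t ht
      rw [uIcc_of_le zero_le_one] at ht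
      have h1 : HasDerivAt F (deriv F (t * z)) (t * z) :=
        (hF.differentiableAt (hU.mem_nhds (hmem t ht z hz))).hasDerivAt
      have h2 : HasDerivAt (fun t : ℝ => (t : ℂ)) 1 t := (hasDerivAt_id t).ofReal_comp
      have h3 : HasDerivAt (fun t : ℝ => (t : ℂ) * z) (1 * z) t := h2.mul_const z
      have h4 := h2.mul (h1.comp t h3)
      exact h4.congr_deriv (by simp; ring)
    rw [intervalIntegral.integral_eq_sub_of_hasDerivAt this]
    · simp
    · refine ContinuousOn.intervalIntegrable ?_
      rw [uIcc_of_le zero_le_one]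
      exact (((hc' z hz).mul (by fun_prop)).mul continuousOn_const).add (hc z hz)
  · have hm : MapsTo (fun p : ℝ × ℂ => (p.1 : ℂ) * p.2) (Icc 0 1 ×ˢ U) U := fun p hp =>
      hmem p.1 hp.1 p.2 hp.2
    exact (((hF'.continuousOn.comp (by fun_prop) hm).mul (by fun_prop)).mul (by fun_prop)).add
      (hF.continuousOn.comp (by fun_prop) hm)
  · intro t ht w hw
    have h1 : HasDerivAt F (deriv F (t * w)) (t * w) :=
      (hF.differentiableAt (hU.mem_nhds (hmem t ht w hw))).hasDerivAt
    have h3 : HasDerivAt (fun w : ℂ => (t : ℂ) * w) (t * 1) w := (hasDerivAt_id w).const_mul _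
    exact ((h1.comp w h3).mul (hasDerivAt_id w)).congr_deriv (by simp)

theorem segIntegral_zero (F : ℂ → ℂ) : segIntegral F 0 = 0 := by simp [segIntegral]

/-- A function whose composition with a nonconstant analytic map is analytic is analytic. -/
theorem analyticAt_of_comp {p S : ℂ → ℂ} {c : ℂ} (hp : AnalyticAt ℂ p c)
    (hn : ¬ ∀ᶠ z in 𝓝 c, p z = p c) (hS : AnalyticAt ℂ (fun z => S (p z)) c) :
    AnalyticAt ℂ S (p c) := by
  -- The open mapping theorem makes S continuous at p(c). Near p(c), away from that point, p has
  -- local analytic inverses because the zeros of p' are isolated, so S is differentiable there and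
  -- the singularity is removable.
  have hmap : 𝓝 (p c) ≤ map p (𝓝 c) :=
    hp.eventually_constant_or_nhds_le_map_nhds.resolve_left hn
  have hcont : ContinuousAt S (p c) := by
    have : Tendsto S (map p (𝓝 c)) (𝓝 (S (p c))) := hS.continuousAt.tendsto
    exact this.mono_left hmap
  refine Complex.analyticAt_of_differentiable_on_punctured_nhds_of_continuousAt ?_ hcont
  have hd : ∀ᶠ z in 𝓝[≠] c, deriv p z ≠ 0 := by
    rcases hp.deriv.eventually_eq_zero_or_eventually_ne_zero with h | h
    · exfalso
      apply hn
      obtain ⟨r, hr, hb⟩ := Metric.eventually_nhds_iff_ball.1 (h.and hp.eventually_analyticAt)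
      filter_upwards [ball_mem_nhds c hr] with z hz
      exact (isOpen_ball (x := c) (ε := r)).is_const_of_deriv_eq_zero
        (convex_ball c r).isPreconnected
        (fun w hw => (hb w hw).2.differentiableAt.differentiableWithinAt)
        (fun w hw => (hb w hw).1) hz (mem_ball_self hr)
    · exact h
  have h1 : ∀ᶠ z in 𝓝 c, z ≠ c → DifferentiableAt ℂ S (p z) := by
    filter_upwards [eventually_nhdsWithin_iff.1 hd, hp.eventually_analyticAt,
      hS.eventually_analyticAt] with z hz hpz hSz hzc
    have hsd : HasStrictDerivAt p (deriv p z) z := hpz.hasStrictDerivAt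
    set g := hsd.localInverse p (deriv p z) z (hz hzc)
    have hg : HasStrictDerivAt g (deriv p z)⁻¹ (p z) := hsd.to_localInverse (hz hzc)
    have hgz : g (p z) = z := (hsd.eventually_left_inverse (hz hzc)).self_of_nhds
    have hpg : ∀ᶠ y in 𝓝 (p z), p (g y) = y := hsd.eventually_right_inverse (hz hzc)
    have : DifferentiableAt ℂ (fun y => S (p (g y))) (p z) := by
      have h2 : DifferentiableAt ℂ (fun z => S (p z)) (g (p z)) := by
        rw [hgz]; exact hSz.differentiableAt
      exact h2.comp (p z) hg.hasDerivAt.differentiableAt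
    exact this.congr_of_eventuallyEq (hpg.mono fun y hy => by simp only [hy])
  have h2 : ∀ᶠ y in 𝓝 (p c), y ≠ p c → DifferentiableAt ℂ S y := by
    apply hmap
    rw [Filter.mem_map]
    filter_upwards [h1] with z hz hne
    exact hz fun h => hne (by rw [h])
  exact eventually_nhdsWithin_iff.2 h2

/-- A holomorphic function with nonpositive real part has negative real part as soon as it has
negative real part somewhere. -/
theorem re_neg_of_re_nonpos {U : Set ℂ} (hU : IsOpen U) (hc : IsPreconnected U) {F : ℂ → ℂ}
    (hF : DifferentiableOn ℂ F U) (h : ∀ z ∈ U, (F z).re ≤ 0) {a : ℂ} (ha : a ∈ U)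
    (hFa : (F a).re < 0) {z : ℂ} (hz : z ∈ U) : (F z).re < 0 := by
  by_contra hcon
  have h0 : (F z).re = 0 := le_antisymm (h z hz) (not_lt.1 hcon)
  have := Complex.norm_eqOn_of_isPreconnected_of_isMaxOn hc hU hF.cexp hz
    (fun w hw => by simpa [Complex.norm_exp, h0] using h w hw) ha
  simp [Complex.norm_exp, h0] at this
  exact hFa.ne this

theorem re_pos_of_re_nonneg {U : Set ℂ} (hU : IsOpen U) (hc : IsPreconnected U) {F : ℂ → ℂ}
    (hF : DifferentiableOn ℂ F U) (h : ∀ z ∈ U, 0 ≤ (F z).re) {a : ℂ} (ha : a ∈ U)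
    (hFa : 0 < (F a).re) {z : ℂ} (hz : z ∈ U) : 0 < (F z).re := by
  simpa using re_neg_of_re_nonpos hU hc hF.neg (by simpa using h) ha (by simpa using hFa) hz

/-- Minimum principle for the real part on the closed disk. -/
theorem re_nonneg_of_sphere {F : ℂ → ℂ} (hF : DiffContOnCl ℂ F disk)
    (h : ∀ z ∈ circle, 0 ≤ (F z).re) {z : ℂ} (hz : z ∈ closedDisk) : 0 ≤ (F z).re := by
  have hd : DiffContOnCl ℂ (fun z => exp (-F z)) disk :=
    ⟨hF.1.neg.cexp, hF.2.neg.cexp⟩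
  have := Complex.norm_le_of_forall_mem_frontier_norm_le (C := 1) isBounded_ball hd
    (fun w hw => by
      rw [frontier_ball _ one_ne_zero] at hw
      simpa [Complex.norm_exp] using h w hw) (z := z)
      (by rw [closure_ball _ one_ne_zero]; exact hz)
  simpa [Complex.norm_exp] using this

/-- Jack's lemma: if `Re φ` is positive at the origin but not on the whole disk, then at some
point of the disk `Re φ` vanishes and `z φ'(z)` is real and nonpositive. -/
theorem exists_re_eq_zero_of_not_re_pos {φ : ℂ → ℂ} (hφ : DifferentiableOn ℂ φ disk)
    (h0 : 0 < (φ 0).re) (h : ¬ ∀ z ∈ disk, 0 < (φ z).re) :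
    ∃ z ∈ disk, (φ z).re = 0 ∧ (z * deriv φ z).im = 0 ∧ (z * deriv φ z).re ≤ 0 := by
  push Not at h
  obtain ⟨a, ha, hφa⟩ := h
  have hcb : closedBall (0 : ℂ) ‖a‖ ⊆ disk := closedBall_subset_ball (by simpa using ha)
  have hcont : ContinuousOn φ (closedBall 0 ‖a‖) := hφ.continuousOn.mono hcb
  have hcl : IsCompact (closedBall (0 : ℂ) ‖a‖ ∩ {z | (φ z).re ≤ 0}) := by
    refine (isCompact_closedBall _ _).of_isClosed_subset ?_ inter_subset_left
    exact (Complex.continuous_re.comp_continuousOn hcont).preimage_isClosed_of_isClosed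
      isClosed_closedBall isClosed_Iic
  -- Take a point of least modulus with Re φ ≤ 0. Then Re φ ≥ 0 on the closed disk through z and Re
  -- φ(z) = 0: minimality along the circle gives the imaginary part of z φ'(z), minimality along the
  -- radius the sign of its real part.
  obtain ⟨z, ⟨hza, hz0⟩, hmin⟩ := hcl.exists_isMinOn ⟨a, by simp, hφa⟩ continuous_norm.continuousOn
  have hzd : z ∈ disk := hcb hza
  have hzn : z ≠ 0 := by rintro rfl; exact absurd hz0 (not_le.2 h0)
  have hpos : ∀ w : ℂ, ‖w‖ < ‖z‖ → 0 < (φ w).re := by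
    intro w hw
    by_contra hcon
    have : ‖z‖ ≤ ‖w‖ := hmin ⟨by simp at hza ⊢; linarith, not_lt.1 hcon⟩
    linarith
  have hder : HasDerivAt φ (deriv φ z) z :=
    (hφ.differentiableAt (isOpen_ball.mem_nhds hzd)).hasDerivAt
  have hge : ∀ w : ℂ, ‖w‖ ≤ ‖z‖ → 0 ≤ (φ w).re := by
    intro w hw
    have hwd : w ∈ disk := by simp at hzd ⊢; linarith
    have ht : Tendsto (fun t : ℝ => (φ (t * w)).re) (𝓝[<] 1) (𝓝 (φ w).re) := by
      have h1 : ContinuousAt φ w := (hφ.differentiableAt (isOpen_ball.mem_nhds hwd)).continuousAt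
      have h2 : Tendsto (fun t : ℝ => (t : ℂ) * w) (𝓝 1) (𝓝 w) := by
        have : Continuous fun t : ℝ => (t : ℂ) * w := by fun_prop
        simpa using this.tendsto 1
      exact ((Complex.continuous_re.tendsto _).comp (h1.tendsto.comp h2)).mono_left
        nhdsWithin_le_nhds
    refine ge_of_tendsto ht ?_
    filter_upwards [Ioo_mem_nhdsLT (show (0 : ℝ) < 1 by norm_num)] with t ht
    refine (hpos _ ?_).le
    rw [norm_mul, Complex.norm_real, Real.norm_of_nonneg ht.1.le]
    nlinarith [ht.1, ht.2, norm_pos_iff.2 hzn, norm_nonneg w]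
  have hz00 : (φ z).re = 0 := le_antisymm hz0 (hge z le_rfl)
  refine ⟨z, hzd, hz00, ?_, ?_⟩
  · have h1 : HasDerivAt (fun t : ℝ => z * exp (t * I)) (z * I) 0 := by
      have h2 : HasDerivAt (fun t : ℝ => (t : ℂ) * I) (1 * I) 0 :=
        (hasDerivAt_id (0 : ℝ)).ofReal_comp.mul_const I
      simpa using h2.cexp.const_mul z
    have h2 : HasDerivAt (fun t : ℝ => φ (z * exp (t * I))) (deriv φ z * (z * I)) 0 := by
      have : HasDerivAt φ (deriv φ z) (z * exp ((0 : ℝ) * I)) := by simpa using hder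
      exact this.comp (0 : ℝ) h1
    have h3 : HasDerivAt (fun t : ℝ => (φ (z * exp (t * I))).re) (deriv φ z * (z * I)).re 0 :=
      Complex.reCLM.hasFDerivAt.comp_hasDerivAt (0 : ℝ) h2
    have h4 : IsLocalMin (fun t : ℝ => (φ (z * exp (t * I))).re) 0 := by
      refine .of_forall fun t => ?_
      simp only [ofReal_zero, zero_mul, Complex.exp_zero, mul_one, hz00]
      exact hge _ (by simp [Complex.norm_exp])
    have h5 := h4.hasDerivAt_eq_zero h3
    have : deriv φ z * (z * I) = (z * deriv φ z) * I := by ring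
    rw [this, Complex.mul_I_re] at h5
    linarith
  · have h1 : HasDerivAt (fun t : ℝ => (t : ℂ) * z) z 1 := by
      simpa using (hasDerivAt_id (1 : ℝ)).ofReal_comp.mul_const z
    have h2 : HasDerivAt (fun t : ℝ => φ (t * z)) (deriv φ z * z) 1 := by
      have : HasDerivAt φ (deriv φ z) ((1 : ℝ) * z) := by simpa using hder
      exact this.comp (1 : ℝ) h1
    have h3 : HasDerivAt (fun t : ℝ => (φ (t * z)).re) (deriv φ z * z).re 1 :=
      Complex.reCLM.hasFDerivAt.comp_hasDerivAt (1 : ℝ) h2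
    rw [mul_comm z]
    have h4 := h3.hasDerivWithinAt (s := Iio 1)
    rw [hasDerivWithinAt_iff_tendsto_slope' (by simp)] at h4
    refine le_of_tendsto h4 ?_
    filter_upwards [Ioo_mem_nhdsLT (show (0 : ℝ) < 1 by norm_num)] with t ht
    rw [slope_def_field]
    simp only [ofReal_one, one_mul, hz00]
    refine div_nonpos_of_nonneg_of_nonpos ?_ (by linarith [ht.2])
    have := hge (t * z) (by
      rw [norm_mul, Complex.norm_real, Real.norm_of_nonneg ht.1.le]
      nlinarith [ht.1, ht.2, norm_nonneg z])
    linarith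

/-! ### Convex conformal maps: subordination and Study's theorem. -/

/-- `P` maps the unit disk conformally onto the convex set `Ω`. -/
structure IsConvexMap (P : ℂ → ℂ) (Ω : Set ℂ) : Prop where
  diff : DifferentiableOn ℂ P disk
  bij : BijOn P disk Ω
  convex : Convex ℝ Ω

theorem _root_.HasDerivAt.nonpos_of_le_right {ψ : ℝ → ℝ} {d : ℝ} (h : HasDerivAt ψ d 0)
    (hle : ∀ t ∈ Ioo (0 : ℝ) 1, ψ t ≤ ψ 0) : d ≤ 0 := by
  have h4 := h.hasDerivWithinAt (s := Ioi 0)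
  rw [hasDerivWithinAt_iff_tendsto_slope' (by simp)] at h4
  refine le_of_tendsto h4 ?_
  filter_upwards [Ioo_mem_nhdsGT (show (0 : ℝ) < 1 by norm_num)] with t ht
  rw [slope_def_field]
  exact div_nonpos_of_nonpos_of_nonneg (by linarith [hle t ht]) (by linarith [ht.1])

/-- If s were positive, the second-derivative test would make the maximum a local minimum as well,
so ψ would be locally constant and s = 0. -/
theorem second_deriv_nonpos_of_isMax {ψ ψ' : ℝ → ℝ} {s : ℝ} (h : ∀ t, HasDerivAt ψ (ψ' t) t)
    (h' : HasDerivAt ψ' s 0) (hmax : ∀ t, ψ t ≤ ψ 0) : s ≤ 0 := by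
  by_contra! hs
  have hd : deriv ψ = ψ' := funext fun t => (h t).deriv
  have hmaxl : IsLocalMax ψ 0 := .of_forall hmax
  have hmin : IsLocalMin ψ 0 := by
    refine isLocalMin_of_deriv_deriv_pos ?_ hmaxl.deriv_eq_zero (h 0).continuousAt
    rwa [hd, h'.deriv]
  have hc : ψ =ᶠ[𝓝 0] fun _ => ψ 0 := by
    filter_upwards [hmin] with t ht using le_antisymm (hmax t) ht
  have h2 : ψ' =ᶠ[𝓝 0] fun _ => 0 := by
    have := hc.deriv
    rw [hd] at this
    simpa using this
  have := (h'.congr_of_eventuallyEq h2.symm).unique (hasDerivAt_const (0 : ℝ) (0 : ℝ))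
  exact hs.ne' this

namespace IsConvexMap

variable {P : ℂ → ℂ} {Ω : Set ℂ}

/-- The inverse composed with P is the identity, so `analyticAt_of_comp` makes the inverse analytic
without knowing P' ≠ 0; the chain rule then gives P' ≠ 0. -/
theorem exists_inverse (h : IsConvexMap P Ω) :
    ∃ R : ℂ → ℂ, (∀ z ∈ disk, R (P z) = z) ∧ (∀ w ∈ Ω, R w ∈ disk ∧ P (R w) = w) ∧
      DifferentiableOn ℂ R Ω ∧ ∀ z ∈ disk, deriv P z ≠ 0 ∧ HasDerivAt R (deriv P z)⁻¹ (P z) := by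
  have hl : ∀ z ∈ disk, Function.invFunOn P disk (P z) = z := fun z hz =>
    h.bij.injOn.leftInvOn_invFunOn hz
  have hr : ∀ w ∈ Ω, Function.invFunOn P disk w ∈ disk ∧ P (Function.invFunOn P disk w) = w :=
    fun w hw => ⟨Function.invFunOn_mem (h.bij.surjOn hw), Function.invFunOn_eq (h.bij.surjOn hw)⟩
  have key : ∀ z ∈ disk, AnalyticAt ℂ (Function.invFunOn P disk) (P z) := by
    intro z hz
    refine analyticAt_of_comp (h.diff.analyticAt (isOpen_ball.mem_nhds hz)) ?_ ?_
    · intro hc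
      obtain ⟨w, ⟨hw, hwd⟩, hne⟩ : ∃ w, (P w = P z ∧ w ∈ disk) ∧ w ≠ z :=
        (((hc.and (isOpen_ball.mem_nhds hz)).filter_mono nhdsWithin_le_nhds).and
          (eventually_mem_nhdsWithin (a := z) (s := {z}ᶜ))).exists
      exact hne (h.bij.injOn hwd hz hw)
    · refine analyticAt_id.congr ?_
      filter_upwards [isOpen_ball.mem_nhds hz] with w hw using (hl w hw).symm
  refine ⟨Function.invFunOn P disk, hl, hr, ?_, ?_⟩
  · intro w hw
    have := key _ (hr w hw).1
    rw [(hr w hw).2] at this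
    exact this.differentiableAt.differentiableWithinAt
  · intro z hz
    have h1 := (key z hz).differentiableAt.hasDerivAt
    have h2 := (h.diff.differentiableAt (isOpen_ball.mem_nhds hz)).hasDerivAt
    have h3 : HasDerivAt (fun w => Function.invFunOn P disk (P w))
      (deriv (Function.invFunOn P disk) (P z) * deriv P z) z := h1.comp z h2
    have h4 : HasDerivAt (fun w => Function.invFunOn P disk (P w)) 1 z := by
      refine (hasDerivAt_id z).congr_of_eventuallyEq ?_
      filter_upwards [isOpen_ball.mem_nhds hz] with w hw using hl w hw
    have h5 := h3.unique h4
    have h6 : deriv P z ≠ 0 := right_ne_zero_of_mul_eq_one h5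
    exact ⟨h6, by rw [← eq_inv_of_mul_eq_one_left h5]; exact h1⟩

theorem deriv_ne_zero (h : IsConvexMap P Ω) {z : ℂ} (hz : z ∈ disk) : deriv P z ≠ 0 :=
  let ⟨_, _, _, _, h4⟩ := h.exists_inverse
  (h4 z hz).1

/-- The subordination principle. -/
theorem exists_schwarz (h : IsConvexMap P Ω) {F : ℂ → ℂ} (hF : DifferentiableOn ℂ F disk)
    (hm : MapsTo F disk Ω) (h0 : F 0 = P 0) :
    ∃ ω : ℂ → ℂ, DifferentiableOn ℂ ω disk ∧ MapsTo ω disk disk ∧ ω 0 = 0 ∧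
      ∀ z ∈ disk, F z = P (ω z) := by
  obtain ⟨R, h1, h2, h3, -⟩ := h.exists_inverse
  refine ⟨fun z => R (F z), h3.comp hF hm, fun z hz => (h2 _ (hm hz)).1, ?_,
    fun z hz => (h2 _ (hm hz)).2.symm⟩
  simp only [h0]
  exact h1 0 (mem_ball_self one_pos)

/-- For z₂ ≠ 0 put η = z₁/z₂. The function z ↦ (1 - t) P(z) + t P(ηz) takes values in the convex set
Ω and agrees with P at 0, so it is P ∘ ω with ω a Schwarz function; take w = ω(z₂). -/
theorem exists_norm_le (h : IsConvexMap P Ω) {z₁ z₂ : ℂ} (h12 : ‖z₁‖ ≤ ‖z₂‖) (h2 : z₂ ∈ disk)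
    {t : ℝ} (ht : t ∈ Icc (0 : ℝ) 1) :
    ∃ w, ‖w‖ ≤ ‖z₂‖ ∧ (1 - t) * P z₂ + t * P z₁ = P w := by
  rcases eq_or_ne z₂ 0 with rfl | hz
  · have : z₁ = 0 := by simpa using h12
    exact ⟨0, by simp, by rw [this]; ring⟩
  set η := z₁ / z₂ with hη
  have hη1 : ‖η‖ ≤ 1 := by
    rw [hη, norm_div]; exact div_le_one_of_le₀ h12 (norm_nonneg _)
  have hηm : MapsTo (fun z => η * z) disk disk := fun z hz => by
    simp only [mem_ball_zero_iff, norm_mul] at hz ⊢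
    nlinarith [norm_nonneg z]
  obtain ⟨ω, h3, h4, h5, h6⟩ := h.exists_schwarz
    (F := fun z => (1 - t) * P z + t * P (η * z))
    ((h.diff.const_mul _).add ((h.diff.comp (by fun_prop) hηm).const_mul _))
    (fun z hz => by
      have := h.convex (h.bij.mapsTo hz) (h.bij.mapsTo (hηm hz)) (sub_nonneg.2 ht.2) ht.1 (by ring)
      simpa using this)
    (by simp; ring)
  refine ⟨ω z₂, Complex.norm_le_norm_of_mapsTo_ball h3 (h4.mono_right ball_subset_closedBall) h5
    (by simpa using h2), ?_⟩
  rw [← h6 z₂ h2, hη, div_mul_cancel₀ _ hz]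

/-- Along the segment from P(z₂) to P(z₁) the inverse of P stays in |w| ≤ |z₂|, so the real part of
conj(z₂) times the inverse is largest at the start. The quotient is |z₂|⁻² times the corresponding
derivative. -/
theorem re_div_nonpos (h : IsConvexMap P Ω) {z₁ z₂ : ℂ} (h12 : ‖z₁‖ ≤ ‖z₂‖) (h2 : z₂ ∈ disk)
    (hz : z₂ ≠ 0) : ((P z₁ - P z₂) / (z₂ * deriv P z₂)).re ≤ 0 := by
  obtain ⟨R, hR1, -, -, hR⟩ := h.exists_inverse
  have h1 : HasDerivAt (fun t : ℝ => (1 - t : ℂ) * P z₂ + t * P z₁) (-1 * P z₂ + 1 * P z₁) 0 := by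
    have := (hasDerivAt_id (0 : ℝ)).ofReal_comp
    exact ((this.const_sub 1).mul_const _).add (this.mul_const _)
  have h3 : HasDerivAt R (deriv P z₂)⁻¹ ((1 - (0 : ℝ) : ℂ) * P z₂ + (0 : ℝ) * P z₁) := by
    simpa using (hR z₂ h2).2
  have h4 := ((h3.comp (0 : ℝ) h1).const_mul ((starRingEnd ℂ) z₂))
  have h5 := Complex.reCLM.hasFDerivAt.comp_hasDerivAt (0 : ℝ) h4
  have h6 := HasDerivAt.nonpos_of_le_right h5 (fun t ht => by
    obtain ⟨w, hw, he⟩ := h.exists_norm_le h12 h2 (Ioo_subset_Icc_self ht)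
    have hwd : w ∈ disk := by simp only [mem_ball_zero_iff] at h2 ⊢; linarith
    simp only [Function.comp, he, reCLM_apply, hR1 w hwd]
    simp only [ofReal_zero, sub_zero, one_mul, zero_mul, add_zero, hR1 z₂ h2]
    rw [← Complex.normSq_eq_conj_mul_self, ofReal_re, Complex.normSq_eq_norm_sq]
    refine (Complex.re_le_norm _).trans ?_
    rw [norm_mul, Complex.norm_conj]
    nlinarith [norm_nonneg z₂])
  simp only [reCLM_apply] at h6
  have hd := h.deriv_ne_zero h2
  have h7 : (P z₁ - P z₂) / (z₂ * deriv P z₂) = ((Complex.normSq z₂)⁻¹ : ℝ) *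
      ((starRingEnd ℂ) z₂ * ((deriv P z₂)⁻¹ * (-1 * P z₂ + 1 * P z₁))) := by
    have hz' : (starRingEnd ℂ) z₂ ≠ 0 := by simpa using hz
    rw [ofReal_inv, Complex.normSq_eq_conj_mul_self]
    field_simp
    ring
  rw [h7, Complex.re_ofReal_mul]
  exact mul_nonpos_of_nonneg_of_nonpos (inv_nonneg.2 (Complex.normSq_nonneg _)) h6

/-- Strictness comes from the maximum principle in z with η = z₁/z₂ fixed: (P(ηz) - P(z))/(z P'(z))
extends analytically to z = 0 with the value η - 1, whose real part is negative because |η| ≤ 1 and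
η ≠ 1. -/
theorem re_div_neg (h : IsConvexMap P Ω) {z₁ z₂ : ℂ} (h12 : ‖z₁‖ ≤ ‖z₂‖) (h2 : z₂ ∈ disk)
    (hne : z₁ ≠ z₂) : ((P z₁ - P z₂) / (z₂ * deriv P z₂)).re < 0 := by
  have hz : z₂ ≠ 0 := by
    rintro rfl
    exact hne (by simpa using h12)
  set η := z₁ / z₂ with hη
  have hη1 : ‖η‖ ≤ 1 := by
    rw [hη, norm_div]; exact div_le_one_of_le₀ h12 (norm_nonneg _)
  have hηne : η ≠ 1 := fun h => hne (by rwa [hη, div_eq_one_iff_eq hz] at h)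
  have hηre : (η - 1).re < 0 := by
    have h1 : η.re ≤ 1 := (Complex.re_le_norm _).trans hη1
    rcases h1.lt_or_eq with h1 | h1
    · simpa using h1
    · exfalso
      apply hηne
      have h3 : ‖η‖ ^ 2 = η.re ^ 2 + η.im ^ 2 := by
        rw [Complex.sq_norm, Complex.normSq_apply]; ring
      have h4 : η.im ^ 2 = 0 := by nlinarith [norm_nonneg η, sq_nonneg η.im]
      exact Complex.ext h1 (by simpa using h4)
  have hηm : MapsTo (fun z => η * z) disk disk := fun z hz => by
    simp only [mem_ball_zero_iff, norm_mul] at hz ⊢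
    nlinarith [norm_nonneg z]
  have h0d : (0 : ℂ) ∈ disk := mem_ball_self one_pos
  have hF : DifferentiableOn ℂ (fun z => P (η * z) - P z) disk :=
    (h.diff.comp (by fun_prop) hηm).sub h.diff
  have hF0 : HasDerivAt (fun z => P (η * z) - P z) ((η - 1) * deriv P 0) 0 := by
    have hd : HasDerivAt P (deriv P 0) 0 :=
      (h.diff.differentiableAt (isOpen_ball.mem_nhds h0d)).hasDerivAt
    have h3 : HasDerivAt (fun z => P (η * z)) (deriv P 0 * η) 0 := by
      have h4 : HasDerivAt P (deriv P 0) (η * 0) := by simpa using hd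
      have h5 : HasDerivAt (fun z => η * z) η 0 := by simpa using (hasDerivAt_id (0 : ℂ)).const_mul η
      exact h4.comp 0 h5
    exact (h3.sub hd).congr_deriv (by ring)
  have hG : DifferentiableOn ℂ (fun z => dslope (fun z => P (η * z) - P z) 0 z / deriv P z) disk :=
    ((Complex.differentiableOn_dslope (isOpen_ball.mem_nhds h0d)).2 hF).div
      (h.diff.deriv isOpen_ball) fun z hz => h.deriv_ne_zero hz
  have hG0 : dslope (fun z => P (η * z) - P z) 0 0 / deriv P 0 = η - 1 := by
    rw [dslope_same, hF0.deriv, mul_div_cancel_right₀ _ (h.deriv_ne_zero h0d)]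
  have hGz : ∀ z ≠ 0, dslope (fun z => P (η * z) - P z) 0 z / deriv P z =
      (P (η * z) - P z) / (z * deriv P z) := by
    intro z hz
    rw [dslope_of_ne _ hz, slope_def_field]
    simp only [mul_zero, sub_self, sub_zero]
    rw [div_div]
  have := re_neg_of_re_nonpos isOpen_ball (convex_ball _ _).isPreconnected hG (fun z hz => by
    rcases eq_or_ne z 0 with rfl | hz0
    · rw [hG0]; exact hηre.le
    · rw [hGz z hz0]
      refine h.re_div_nonpos ?_ hz hz0
      rw [norm_mul]
      exact mul_le_of_le_one_left (norm_nonneg _) hη1) h0d (by rw [hG0]; exact hηre) h2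
  rwa [hGz _ hz, hη, div_mul_cancel₀ _ hz] at this

theorem convex_image_ball (h : IsConvexMap P Ω) {r : ℝ} (hr : r ≤ 1) :
    Convex ℝ (P '' ball 0 r) := by
  have key : ∀ z₁ z₂ : ℂ, ‖z₁‖ ≤ ‖z₂‖ → z₂ ∈ ball (0 : ℂ) r → ∀ a b : ℝ, 0 ≤ a → 0 ≤ b →
      a + b = 1 → a • P z₁ + b • P z₂ ∈ P '' ball 0 r := by
    intro z₁ z₂ h12 h2 a b ha hb hab
    obtain ⟨w, hw, he⟩ := h.exists_norm_le h12 (ball_subset_ball hr h2) (t := a)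
      ⟨ha, by linarith⟩
    refine ⟨w, by simp only [mem_ball_zero_iff] at h2 ⊢; linarith, ?_⟩
    rw [← he, show b = 1 - a by linarith]
    simp
    ring
  rintro _ ⟨z₁, h1, rfl⟩ _ ⟨z₂, h2, rfl⟩ a b ha hb hab
  rcases le_total ‖z₁‖ ‖z₂‖ with h12 | h12
  · exact key z₁ z₂ h12 h2 a b ha hb hab
  · rw [add_comm]
    exact key z₂ z₁ h12 h1 b a hb ha (by linarith)

/-- Study's inequality. -/
theorem re_one_add_nonneg (h : IsConvexMap P Ω) {z : ℂ} (hz : z ∈ disk) :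
    0 ≤ (1 + z * (deriv (deriv P) z / deriv P z)).re := by
  rcases eq_or_ne z 0 with rfl | hz0
  · simp
  have hd := h.deriv_ne_zero hz
  have hmem : ∀ t : ℝ, z * exp (t * I) ∈ disk := fun t => by
    simpa [Complex.norm_exp] using hz
  have hE : ∀ t : ℝ, HasDerivAt (fun t : ℝ => z * exp (t * I)) (z * exp (t * I) * I) t := by
    intro t
    have h2 : HasDerivAt (fun t : ℝ => (t : ℂ) * I) (1 * I) t :=
      (hasDerivAt_id t).ofReal_comp.mul_const I
    exact (h2.cexp.const_mul z).congr_deriv (by ring)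
  -- By `re_div_nonpos`, the function t ↦ Re((P(z e^{it}) - P(z)) C) has its maximum at t = 0. Its
  -- second derivative there is -Re(1 + z P''/P').
  set C := (z * deriv P z)⁻¹ with hC
  have h1 : ∀ t : ℝ, HasDerivAt (fun t : ℝ => ((P (z * exp (t * I)) - P z) * C).re)
      ((deriv P (z * exp (t * I)) * (z * exp (t * I) * I) * C).re) t := by
    intro t
    have h2 := (h.diff.differentiableAt (isOpen_ball.mem_nhds (hmem t))).hasDerivAt
    exact Complex.reCLM.hasFDerivAt.comp_hasDerivAt t
      (((h2.comp t (hE t)).sub_const (P z)).mul_const C)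
  have h2 : HasDerivAt (fun t : ℝ => (deriv P (z * exp (t * I)) * (z * exp (t * I) * I) * C).re)
      ((deriv (deriv P) z * (z * I) * (z * I) + deriv P z * (z * I * I)) * C).re 0 := by
    have h3 := ((h.diff.deriv isOpen_ball).differentiableAt
      (isOpen_ball.mem_nhds (hmem 0))).hasDerivAt
    have h4 := Complex.reCLM.hasFDerivAt.comp_hasDerivAt (0 : ℝ)
      (((h3.comp (0 : ℝ) (hE 0)).mul ((hE 0).mul_const I)).mul_const C)
    refine h4.congr_deriv ?_
    simp only [ofReal_zero, zero_mul, Complex.exp_zero, mul_one, reCLM_apply, Function.comp_apply]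
  have h3 := second_deriv_nonpos_of_isMax h1 h2 (fun t => by
    simp only [ofReal_zero, zero_mul, Complex.exp_zero, mul_one, sub_self, Complex.zero_re]
    have hn : ‖z * exp (t * I)‖ ≤ ‖z‖ := by simp [Complex.norm_exp]
    have := h.re_div_nonpos hn hz hz0
    rwa [div_eq_mul_inv] at this)
  have h4 : (deriv (deriv P) z * (z * I) * (z * I) + deriv P z * (z * I * I)) * C =
      -(1 + z * (deriv (deriv P) z / deriv P z)) := by
    rw [hC]
    field_simp
    linear_combination (deriv (deriv P) z * z + deriv P z) * Complex.I_sq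
  rw [h4, Complex.neg_re] at h3
  linarith

end IsConvexMap

/-! ### Disk automorphisms and convex maps. -/

/-- The disk automorphism `w ↦ (w + γ) / (1 + γ̄ w)`. -/
noncomputable def mob (γ w : ℂ) : ℂ := (w + γ) / (1 + (starRingEnd ℂ) γ * w)

theorem re_one_add_pos {γ w : ℂ} (hγ : ‖γ‖ < 1) (hw : ‖w‖ ≤ 1) :
    0 < (1 + (starRingEnd ℂ) γ * w).re := by
  have h1 : ‖(starRingEnd ℂ) γ * w‖ < 1 := by
    rw [norm_mul, Complex.norm_conj]; nlinarith [norm_nonneg γ, norm_nonneg w]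
  have := (abs_le.1 (Complex.abs_re_le_norm ((starRingEnd ℂ) γ * w))).1
  simp only [Complex.add_re, Complex.one_re]
  linarith

theorem one_add_ne_zero {γ w : ℂ} (hγ : ‖γ‖ < 1) (hw : ‖w‖ ≤ 1) :
    1 + (starRingEnd ℂ) γ * w ≠ 0 := fun h => by
  have := re_one_add_pos hγ hw
  simp [h] at this

theorem normSq_mob_aux (γ w : ℂ) :
    Complex.normSq (1 + (starRingEnd ℂ) γ * w) - Complex.normSq (w + γ) =
      (1 - Complex.normSq γ) * (1 - Complex.normSq w) := by
  simp only [Complex.normSq_apply, Complex.add_re, Complex.add_im, Complex.mul_re, Complex.mul_im,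
    Complex.conj_re, Complex.conj_im, Complex.one_re, Complex.one_im]
  ring

theorem norm_mob_le {γ w : ℂ} (hγ : ‖γ‖ < 1) (hw : ‖w‖ ≤ 1) : ‖mob γ w‖ ≤ 1 := by
  rw [mob, norm_div]
  refine div_le_one_of_le₀ ?_ (norm_nonneg _)
  have h := normSq_mob_aux γ w
  simp only [Complex.normSq_eq_norm_sq] at h
  refine (pow_le_pow_iff_left₀ (norm_nonneg _) (norm_nonneg _) two_ne_zero).1 ?_
  have h1 : ‖γ‖ ^ 2 ≤ 1 := by nlinarith [norm_nonneg γ]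
  have h2 : ‖w‖ ^ 2 ≤ 1 := by nlinarith [norm_nonneg w]
  nlinarith [mul_nonneg (sub_nonneg.2 h1) (sub_nonneg.2 h2)]

theorem norm_mob_lt {γ w : ℂ} (hγ : ‖γ‖ < 1) (hw : ‖w‖ < 1) : ‖mob γ w‖ < 1 := by
  have h0 := norm_pos_iff.2 (one_add_ne_zero hγ hw.le)
  rw [mob, norm_div, div_lt_one h0]
  have h := normSq_mob_aux γ w
  simp only [Complex.normSq_eq_norm_sq] at h
  refine lt_of_pow_lt_pow_left₀ 2 (norm_nonneg _) ?_
  have h1 : ‖γ‖ ^ 2 < 1 := by nlinarith [norm_nonneg γ]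
  have h2 : ‖w‖ ^ 2 < 1 := by nlinarith [norm_nonneg w]
  nlinarith [mul_pos (sub_pos.2 h1) (sub_pos.2 h2)]

theorem one_sub_conj_mul_ne_zero {γ : ℂ} (hγ : ‖γ‖ < 1) : 1 - (starRingEnd ℂ) γ * γ ≠ 0 := by
  have := one_add_ne_zero hγ (w := -γ) (by simpa using hγ.le)
  rwa [mul_neg, ← sub_eq_add_neg] at this

theorem hasDerivAt_mob {γ w : ℂ} (h : 1 + (starRingEnd ℂ) γ * w ≠ 0) :
    HasDerivAt (mob γ) ((1 - (starRingEnd ℂ) γ * γ) / (1 + (starRingEnd ℂ) γ * w) ^ 2) w := by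
  have h1 : HasDerivAt (fun w => w + γ) 1 w := (hasDerivAt_id w).add_const γ
  have h2 : HasDerivAt (fun w => 1 + (starRingEnd ℂ) γ * w) ((starRingEnd ℂ) γ * 1) w :=
    ((hasDerivAt_id w).const_mul _).const_add 1
  exact (h1.div h2 h).congr_deriv (by ring)

theorem mob_neg_mob {γ w : ℂ} (hγ : ‖γ‖ < 1) (hw : ‖w‖ ≤ 1) : mob (-γ) (mob γ w) = w := by
  have h1 := one_add_ne_zero hγ hw
  have h2 := one_sub_conj_mul_ne_zero hγ
  have h3 : 1 + (starRingEnd ℂ) (-γ) * mob γ w =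
      (1 - (starRingEnd ℂ) γ * γ) / (1 + (starRingEnd ℂ) γ * w) := by
    rw [mob, map_neg]; field_simp; ring
  rw [mob, h3, mob]
  obtain ⟨a, ha⟩ : ∃ a, a = 1 + (starRingEnd ℂ) γ * w := ⟨_, rfl⟩
  obtain ⟨b, hb⟩ : ∃ b, b = 1 - (starRingEnd ℂ) γ * γ := ⟨_, rfl⟩
  rw [← ha] at h1 ⊢
  rw [← hb] at h2 ⊢
  field_simp
  rw [ha, hb]
  ring

theorem bijOn_mob {γ : ℂ} (hγ : ‖γ‖ < 1) : BijOn (mob γ) disk disk := by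
  have hγ' : ‖-γ‖ < 1 := by simpa using hγ
  refine InvOn.bijOn (f' := mob (-γ)) ⟨fun w hw => ?_, fun w hw => ?_⟩ (fun w hw => ?_)
    fun w hw => ?_ <;> simp only [mem_ball_zero_iff] at hw
  · exact mob_neg_mob hγ hw.le
  · simpa using mob_neg_mob hγ' hw.le
  · simpa using norm_mob_lt hγ hw
  · simpa using norm_mob_lt hγ' hw

theorem differentiableOn_mob {γ : ℂ} (hγ : ‖γ‖ < 1) : DifferentiableOn ℂ (mob γ) disk :=
  fun _ hw => (hasDerivAt_mob (one_add_ne_zero hγ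
    (mem_ball_zero_iff.1 hw).le)).differentiableAt.differentiableWithinAt

/-- Composing a convex map with a smaller disk and a disk automorphism. -/
theorem IsConvexMap.comp_mob {P : ℂ → ℂ} {Ω : Set ℂ} (h : IsConvexMap P Ω) {γ ζ : ℂ}
    (hγ : ‖γ‖ < 1) (hζ : ζ ∈ disk) (hζ0 : ζ ≠ 0) :
    IsConvexMap (fun w => P (ζ * mob γ w)) (P '' ball 0 ‖ζ‖) := by
  have hζn : ‖ζ‖ < 1 := mem_ball_zero_iff.1 hζ
  have hm : MapsTo (fun w => ζ * mob γ w) disk disk := fun w hw => by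
    have := norm_mob_lt hγ (mem_ball_zero_iff.1 hw)
    simp only [mem_ball_zero_iff, norm_mul]
    nlinarith [norm_nonneg ζ, norm_nonneg (mob γ w)]
  have hb : BijOn (fun w => ζ * mob γ w) disk (ball 0 ‖ζ‖) := by
    have h1 : BijOn (fun w => ζ * w) disk (ball 0 ‖ζ‖) := by
      refine ⟨fun w hw => ?_, fun a _ b _ hab => mul_left_cancel₀ hζ0 hab, fun w hw => ?_⟩
      · simp only [mem_ball_zero_iff, norm_mul] at hw ⊢
        nlinarith [norm_pos_iff.2 hζ0]
      · refine ⟨w / ζ, ?_, by field_simp⟩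
        simp only [mem_ball_zero_iff, norm_div] at hw ⊢
        rwa [div_lt_one (norm_pos_iff.2 hζ0)]
    exact h1.comp (bijOn_mob hγ)
  refine ⟨h.diff.comp ((differentiableOn_mob hγ).const_mul ζ) hm, ?_, h.convex_image_ball hζn.le⟩
  exact (h.bij.injOn.mono (ball_subset_ball hζn.le)).bijOn_image.comp hb

/-! ### The extremal Schwarz functions and the positivity of `convT`. -/

/-- `ω_ε(ζ) = ζ (εζ + γ) / (1 + γ̄εζ)`. -/
noncomputable def om (γ ε ζ : ℂ) : ℂ := ζ * mob γ (ε * ζ)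

/-- The derivative of `ω_ε`. -/
noncomputable def omD (γ ε ζ : ℂ) : ℂ :=
  mob γ (ε * ζ) + ζ * (ε * ((1 - (starRingEnd ℂ) γ * γ) / (1 + (starRingEnd ℂ) γ * (ε * ζ)) ^ 2))

theorem hasDerivAt_om {γ ε ζ : ℂ} (h : 1 + (starRingEnd ℂ) γ * (ε * ζ) ≠ 0) :
    HasDerivAt (om γ ε) (omD γ ε ζ) ζ := by
  have h1 : HasDerivAt (fun ζ => ε * ζ) ε ζ := by simpa using (hasDerivAt_id ζ).const_mul ε
  have h2 := (hasDerivAt_mob h).comp ζ h1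
  exact ((hasDerivAt_id ζ).mul h2).congr_deriv (by simp only [omD, Function.comp, id]; ring)

theorem norm_om_le {γ ε ζ : ℂ} (hγ : ‖γ‖ < 1) (h : ‖ε * ζ‖ ≤ 1) : ‖om γ ε ζ‖ ≤ ‖ζ‖ := by
  rw [om, norm_mul]
  exact mul_le_of_le_one_right (norm_nonneg _) (norm_mob_le hγ h)

theorem norm_mul_le_one {ε ζ : ℂ} (hε : ε ∈ closedDisk) (hζ : ζ ∈ closedDisk) : ‖ε * ζ‖ ≤ 1 := by
  rw [mem_closedBall_zero_iff] at hε hζ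
  rw [norm_mul]
  exact mul_le_one₀ hε (norm_nonneg _) hζ

theorem om_mem_disk {γ ε ζ : ℂ} (hγ : ‖γ‖ < 1) (hε : ε ∈ closedDisk) (hζ : ζ ∈ disk) :
    om γ ε ζ ∈ disk := by
  have := norm_om_le hγ (norm_mul_le_one hε (ball_subset_closedBall hζ))
  rw [mem_ball_zero_iff] at hζ ⊢
  linarith

/-- Here y' stands for the conjugate of y and g for that of γ. Only y y' = 1 is used, which keeps
the identity algebraic. -/
theorem mob_boundary_aux {y y' g γ : ℂ} (h1 : y * y' = 1) (h2 : 1 + g * y ≠ 0)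
    (h3 : 1 + γ * y' ≠ 0) :
    (y + γ) / (1 + g * y) + y * ((1 - g * γ) / (1 + g * y) ^ 2) =
      (1 / (1 + g * y) + 1 / (1 + γ * y')) * ((y + γ) / (1 + g * y)) := by
  obtain ⟨a, ha⟩ : ∃ a, a = 1 + g * y := ⟨_, rfl⟩
  obtain ⟨b, hb⟩ : ∃ b, b = 1 + γ * y' := ⟨_, rfl⟩
  rw [← ha] at h2 ⊢
  rw [← hb] at h3 ⊢
  field_simp
  rw [ha, hb]
  linear_combination ((y + γ) * g * γ + γ * (1 - g * γ)) * h1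

/-- ω_ε is a Blaschke product with a zero at 0, so z ω'/ω is real and positive on the unit circle.
Its value is the real part of the first summand of `convT`, and therefore the two summands of Re
`convT` share a factor there. -/
theorem mul_omD_eq {γ ε z : ℂ} (hγ : ‖γ‖ < 1) (hε : ε ∈ circle) (hz : z ∈ circle) :
    z * omD γ ε z = (2 * (1 / (1 + (starRingEnd ℂ) γ * (ε * z))).re : ℝ) * om γ ε z := by
  have hy : ‖ε * z‖ = 1 := by
    rw [norm_mul, mem_sphere_zero_iff_norm.1 hε, mem_sphere_zero_iff_norm.1 hz, one_mul]
  have h1 : (ε * z) * (starRingEnd ℂ) (ε * z) = 1 := by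
    rw [Complex.mul_conj, Complex.normSq_eq_norm_sq, hy]; simp
  have h2 := one_add_ne_zero hγ hy.le
  have h3 : 1 + γ * (starRingEnd ℂ) (ε * z) ≠ 0 := by
    have := (map_ne_zero (starRingEnd ℂ)).2 h2
    simpa using this
  have h4 : ((2 * (1 / (1 + (starRingEnd ℂ) γ * (ε * z))).re : ℝ) : ℂ) =
      1 / (1 + (starRingEnd ℂ) γ * (ε * z)) + 1 / (1 + γ * (starRingEnd ℂ) (ε * z)) := by
    rw [← Complex.add_conj]
    simp
  rw [h4, om, omD]
  simp only [mob]
  set y := ε * z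
  set y' := (starRingEnd ℂ) y
  set g := (starRingEnd ℂ) γ
  have h5 : z * (ε * ((1 - g * γ) / (1 + g * y) ^ 2)) = y * ((1 - g * γ) / (1 + g * y) ^ 2) := by
    ring
  rw [h5]
  rw [mob_boundary_aux h1 h2 h3]
  ring

section Positivity

variable {P : ℂ → ℂ} {Ω : Set ℂ} {γ : ℂ}

/-- The quantity `1 + z G''(z) / G'(z)` for `G = ∂Q/∂ε`. -/
noncomputable def convT (P : ℂ → ℂ) (γ ε z : ℂ) : ℂ :=
  2 / (1 + (starRingEnd ℂ) γ * (ε * z)) +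
    z * omD γ ε z * (deriv (deriv P) (om γ ε z) / deriv P (om γ ε z))

theorem IsConvexMap.differentiableOn_logDeriv (h : IsConvexMap P Ω) :
    DifferentiableOn ℂ (fun w => deriv (deriv P) w / deriv P w) disk :=
  ((h.diff.deriv isOpen_ball).deriv isOpen_ball).div (h.diff.deriv isOpen_ball)
    fun _ hz => h.deriv_ne_zero hz

/-- P need not extend to the unit circle, so it is replaced by P(r ·) with r < 1. On |z| = 1 the
real part becomes 2 Re(1/(1 + γ̄εz)) times Study's expression at r ω(z). The minimum principle
carries the sign into the disk, and then r tends to 1. -/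
theorem IsConvexMap.re_convT_nonneg_of_circle (h : IsConvexMap P Ω) (hγ : ‖γ‖ < 1) {ε z : ℂ}
    (hε : ε ∈ circle) (hz : z ∈ disk) : 0 ≤ (convT P γ ε z).re := by
  have hεc : ε ∈ closedDisk := sphere_subset_closedBall hε
  set S : ℂ → ℂ := fun w => deriv (deriv P) w / deriv P w with hS
  have hSd := h.differentiableOn_logDeriv
  have key : ∀ r ∈ Ioo (0 : ℝ) 1, 0 ≤ (2 / (1 + (starRingEnd ℂ) γ * (ε * z)) +
      z * omD γ ε z * (r * S (r * om γ ε z))).re := by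
    intro r hr
    have hmem : ∀ w ∈ closedDisk, (r : ℂ) * om γ ε w ∈ disk := by
      intro w hw
      have h1 := norm_om_le hγ (norm_mul_le_one hεc hw)
      rw [mem_closedBall_zero_iff] at hw
      rw [mem_ball_zero_iff, norm_mul, Complex.norm_real, Real.norm_of_nonneg hr.1.le]
      nlinarith [hr.1, hr.2, norm_nonneg (om γ ε w)]
    refine re_nonneg_of_sphere (F := fun z => 2 / (1 + (starRingEnd ℂ) γ * (ε * z)) +
      z * omD γ ε z * (r * S (r * om γ ε z))) ?_ ?_ (ball_subset_closedBall hz)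
    · refine DifferentiableOn.diffContOnCl fun w hw => ?_
      rw [closure_ball _ one_ne_zero] at hw
      have hne := one_add_ne_zero hγ (norm_mul_le_one hεc hw)
      have hom := (hasDerivAt_om hne).differentiableAt
      have h1 : DifferentiableAt ℂ (fun z => S (r * om γ ε z)) w :=
        DifferentiableAt.comp w (hSd.differentiableAt (isOpen_ball.mem_nhds (hmem w hw)))
          (hom.const_mul _)
      have h2 : DifferentiableAt ℂ (fun z => 1 + (starRingEnd ℂ) γ * (ε * z)) w := by fun_prop
      have h3 : DifferentiableAt ℂ (omD γ ε) w := by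
        unfold omD
        refine .add ?_ ?_
        · exact DifferentiableAt.comp w (hasDerivAt_mob hne).differentiableAt (by fun_prop)
        · exact differentiableAt_id.mul (((differentiableAt_const _).div (h2.pow 2)
            (pow_ne_zero 2 hne)).const_mul _)
      exact (((differentiableAt_const _).div h2 hne).add
        ((differentiableAt_id.mul h3).mul (h1.const_mul _))).differentiableWithinAt
    · intro w hw
      have hwc := sphere_subset_closedBall hw
      have hn := norm_mul_le_one hεc hwc
      rw [mul_omD_eq hγ hε hw]
      set c := 1 + (starRingEnd ℂ) γ * (ε * w)
      have hq : 0 ≤ (1 / c).re := by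
        rw [one_div, Complex.inv_re]
        exact div_nonneg (re_one_add_pos hγ hn).le (Complex.normSq_nonneg _)
      have h1 := h.re_one_add_nonneg (hmem w hwc)
      have h2 : (2 / c + ((2 * (1 / c).re : ℝ) : ℂ) * om γ ε w * (r * S (r * om γ ε w))).re =
          2 * (1 / c).re * (1 + r * om γ ε w * (S (r * om γ ε w))).re := by
        have h3 : (2 / c).re = 2 * (1 / c).re := by
          rw [show 2 / c = ((2 : ℝ) : ℂ) * (1 / c) by push_cast; ring, Complex.re_ofReal_mul]
        rw [Complex.add_re, h3, mul_assoc, Complex.re_ofReal_mul, Complex.add_re, Complex.one_re,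
          show om γ ε w * (r * S (r * om γ ε w)) = r * om γ ε w * S (r * om γ ε w) by ring]
        ring
      rw [h2]
      positivity
  have hzo := om_mem_disk hγ hεc hz
  have hc : ContinuousAt (fun r : ℝ => (2 / (1 + (starRingEnd ℂ) γ * (ε * z)) +
      z * omD γ ε z * (r * S (r * om γ ε z))).re) 1 := by
    refine Complex.continuous_re.continuousAt.comp ?_
    refine continuousAt_const.add (continuousAt_const.mul ?_)
    refine (Complex.continuous_ofReal.continuousAt).mul ?_
    refine ContinuousAt.comp (g := S) (f := fun r : ℝ => (r : ℂ) * om γ ε z) ?_ (by fun_prop)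
    simpa using (hSd.differentiableAt (isOpen_ball.mem_nhds hzo)).continuousAt
  have ht := hc.tendsto.mono_left (nhdsWithin_le_nhds (s := Iio 1))
  have := ge_of_tendsto ht (by
    filter_upwards [Ioo_mem_nhdsLT (show (0 : ℝ) < 1 by norm_num)] with r hr using key r hr)
  simpa [convT] using this

/-- The minimum principle is used twice: in ε for fixed z, to pass from the circle to the closed
disk, and in z, where the value 2 at z = 0 makes the inequality strict. -/
theorem IsConvexMap.re_convT_pos (h : IsConvexMap P Ω) (hγ : ‖γ‖ < 1) {ε z : ℂ}
    (hε : ε ∈ closedDisk) (hz : z ∈ disk) : 0 < (convT P γ ε z).re := by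
  have hSd := h.differentiableOn_logDeriv
  have hnn : ∀ z ∈ disk, 0 ≤ (convT P γ ε z).re := by
    intro z hz
    refine re_nonneg_of_sphere (F := fun ε => convT P γ ε z) ?_
      (fun ε hε => h.re_convT_nonneg_of_circle hγ hε hz) hε
    refine DifferentiableOn.diffContOnCl fun e he => ?_
    rw [closure_ball _ one_ne_zero] at he
    have hne := one_add_ne_zero hγ (norm_mul_le_one he (ball_subset_closedBall hz))
    have h2 : DifferentiableAt ℂ (fun e => 1 + (starRingEnd ℂ) γ * (e * z)) e := by fun_prop
    have hm : DifferentiableAt ℂ (fun e => mob γ (e * z)) e :=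
      DifferentiableAt.comp e (f := fun e => e * z) (hasDerivAt_mob hne).differentiableAt
        (by fun_prop)
    have h1 : DifferentiableAt ℂ (fun e => deriv (deriv P) (om γ e z) / deriv P (om γ e z)) e :=
      DifferentiableAt.comp e (f := fun e => om γ e z)
        (hSd.differentiableAt (isOpen_ball.mem_nhds (om_mem_disk hγ he hz))) (hm.const_mul _)
    have h3 : DifferentiableAt ℂ (fun e => omD γ e z) e := by
      unfold omD
      exact hm.add ((differentiableAt_id.mul ((differentiableAt_const _).div (h2.pow 2)
            (pow_ne_zero 2 hne))).const_mul _)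
    unfold convT
    exact (((differentiableAt_const _).div h2 hne).add ((h3.const_mul _).mul
      h1)).differentiableWithinAt
  refine re_pos_of_re_nonneg isOpen_ball (convex_ball _ _).isPreconnected (F := convT P γ ε)
    (fun w hw => ?_) hnn (mem_ball_self one_pos) ?_ hz
  · have hne := one_add_ne_zero hγ (norm_mul_le_one hε (ball_subset_closedBall hw))
    have h2 : DifferentiableAt ℂ (fun z => 1 + (starRingEnd ℂ) γ * (ε * z)) w := by fun_prop
    have h1 : DifferentiableAt ℂ (fun z => deriv (deriv P) (om γ ε z) / deriv P (om γ ε z)) w :=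
      DifferentiableAt.comp w (hSd.differentiableAt (isOpen_ball.mem_nhds (om_mem_disk hγ hε hw)))
        (hasDerivAt_om hne).differentiableAt
    have h3 : DifferentiableAt ℂ (omD γ ε) w := by
      unfold omD
      refine .add ?_ ?_
      · exact DifferentiableAt.comp w (hasDerivAt_mob hne).differentiableAt (by fun_prop)
      · exact differentiableAt_id.mul (((differentiableAt_const _).div (h2.pow 2)
          (pow_ne_zero 2 hne)).const_mul _)
    exact (((differentiableAt_const _).div h2 hne).add ((differentiableAt_id.mul h3).mul
      h1)).differentiableWithinAt
  · simp [convT]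

end Positivity

/-! ### Averages, starlikeness and quotients of integrals. -/

/-- The weighted average `∫_0^1 t F(tz) dt`. -/
noncomputable def avg (F : ℂ → ℂ) (z : ℂ) : ℂ := ∫ t in (0 : ℝ)..1, (t : ℂ) * F (t * z)

theorem real_mul_mem_disk {t : ℝ} (ht : t ∈ Icc (0 : ℝ) 1) {z : ℂ} (hz : z ∈ disk) :
    (t : ℂ) * z ∈ disk := by
  rw [mem_ball_zero_iff] at hz ⊢
  rw [norm_mul, Complex.norm_real, Real.norm_of_nonneg ht.1]
  nlinarith [ht.1, ht.2, norm_nonneg z]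

theorem continuousOn_comp_real_mul {F : ℂ → ℂ} (hF : ContinuousOn F disk) {z : ℂ}
    (hz : z ∈ disk) : ContinuousOn (fun t : ℝ => F (t * z)) (Icc 0 1) :=
  hF.comp (by fun_prop) fun _ ht => real_mul_mem_disk ht hz

/-- z² avg F(z) is the primitive of ζ F(ζ), and the differential equation is its derivative divided
by z. Integrating the t-derivative of t² F(tz) proves it at z = 0 as well. -/
theorem avg_spec {F : ℂ → ℂ} (hF : DifferentiableOn ℂ F disk) :
    DifferentiableOn ℂ (avg F) disk ∧
      ∀ z ∈ disk, z * deriv (avg F) z + 2 * avg F z = F z := by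
  have hF' : DifferentiableOn ℂ (deriv F) disk := hF.deriv isOpen_ball
  have key : ∀ z ∈ disk, HasDerivAt (avg F) (∫ t in (0 : ℝ)..1, (t : ℂ) * (deriv F (t * z) * t)) z := by
    intro z hz
    refine hasDerivAt_intervalIntegral_param (F := fun t z => (t : ℂ) * F (t * z))
      (F' := fun t z => (t : ℂ) * (deriv F (t * z) * t)) isOpen_ball ?_ ?_ ?_ hz
    · intro z hz
      exact (Continuous.continuousOn (by fun_prop)).mul (continuousOn_comp_real_mul hF.continuousOn hz)
    · have hm : MapsTo (fun p : ℝ × ℂ => (p.1 : ℂ) * p.2) (Icc 0 1 ×ˢ disk) disk := fun p hp =>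
        real_mul_mem_disk hp.1 hp.2
      exact (Continuous.continuousOn (by fun_prop)).mul
        ((hF'.continuousOn.comp (by fun_prop) hm).mul (by fun_prop))
    · intro t ht z hz
      have h1 : HasDerivAt F (deriv F (t * z)) (t * z) :=
        (hF.differentiableAt (isOpen_ball.mem_nhds (real_mul_mem_disk ht hz))).hasDerivAt
      have h3 : HasDerivAt (fun w : ℂ => (t : ℂ) * w) t z := by
        simpa using (hasDerivAt_id z).const_mul (t : ℂ)
      exact (h1.comp z h3).const_mul _
  refine ⟨fun z hz => (key z hz).differentiableAt.differentiableWithinAt, fun z hz => ?_⟩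
  have hr : ContinuousOn (fun t : ℝ => (t : ℂ)) (Icc 0 1) := continuous_ofReal.continuousOn
  have h1 := continuousOn_comp_real_mul hF.continuousOn hz
  have h2 := continuousOn_comp_real_mul hF'.continuousOn hz
  rw [(key z hz).deriv, avg, ← intervalIntegral.integral_const_mul,
    ← intervalIntegral.integral_const_mul, ← intervalIntegral.integral_add]
  · have : ∀ t ∈ uIcc (0 : ℝ) 1, HasDerivAt (fun t : ℝ => (t : ℂ) ^ 2 * F (t * z))
        (z * ((t : ℂ) * (deriv F (t * z) * t)) + 2 * ((t : ℂ) * F (t * z))) t := by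
      intro t ht
      rw [uIcc_of_le zero_le_one] at ht
      have h1 : HasDerivAt F (deriv F (t * z)) (t * z) :=
        (hF.differentiableAt (isOpen_ball.mem_nhds (real_mul_mem_disk ht hz))).hasDerivAt
      have h2 : HasDerivAt (fun t : ℝ => (t : ℂ)) 1 t := (hasDerivAt_id t).ofReal_comp
      have h3 : HasDerivAt (fun t : ℝ => (t : ℂ) * z) (1 * z) t := h2.mul_const z
      have h4 := (h2.pow 2).mul (h1.comp t h3)
      exact h4.congr_deriv (by simp; ring)
    rw [intervalIntegral.integral_eq_sub_of_hasDerivAt this]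
    · simp
    · refine ContinuousOn.intervalIntegrable ?_
      rw [uIcc_of_le zero_le_one]
      exact (continuousOn_const.mul (hr.mul (h2.mul hr))).add (continuousOn_const.mul (hr.mul h1))
  all_goals
    refine ContinuousOn.intervalIntegrable ?_
    rw [uIcc_of_le zero_le_one]
    first
    | exact continuousOn_const.mul (hr.mul (h2.mul hr))
    | exact continuousOn_const.mul (hr.mul h1)

theorem two_mul_avg_zero {F : ℂ → ℂ} (hF : DifferentiableOn ℂ F disk) : 2 * avg F 0 = F 0 := by
  simpa using (avg_spec hF).2 0 (mem_ball_self one_pos)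

/-- If `z² avg d` is convex, then it is starlike. -/
theorem re_avg_div_pos {d : ℂ → ℂ} (hd : DifferentiableOn ℂ d disk) (hne : ∀ z ∈ disk, d z ≠ 0)
    (hT : ∀ z ∈ disk, 0 < (2 + z * (deriv d z / d z)).re) :
    ∀ z ∈ disk, 0 < (avg d z / d z).re := by
  obtain ⟨hm, hmz⟩ := avg_spec hd
  have h0d : (0 : ℂ) ∈ disk := mem_ball_self one_pos
  have h0 : avg d 0 / d 0 = 1 / 2 := by
    have h1 := hne 0 h0d
    rw [← two_mul_avg_zero hd] at h1 ⊢
    have h2 : avg d 0 ≠ 0 := right_ne_zero_of_mul h1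
    field_simp
  by_contra hcon
  -- The function φ = avg d / d satisfies z φ' = 1 - φ (2 + z d'/d). At Jack's point φ is imaginary
  -- and z φ' is real, so taking imaginary parts gives φ = 0; then z φ' = 1, against z φ' ≤ 0.
  obtain ⟨z, hz, h1, h2, h3⟩ := exists_re_eq_zero_of_not_re_pos (φ := fun z => avg d z / d z)
    (hm.div hd hne) (by simp only [h0]; norm_num) hcon
  have hda := hd.differentiableAt (isOpen_ball.mem_nhds hz)
  have hma := hm.differentiableAt (isOpen_ball.mem_nhds hz)
  have hdz := hne z hz
  have hder : z * deriv (fun z => avg d z / d z) z =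
      1 - avg d z / d z * (2 + z * (deriv d z / d z)) := by
    have hq : HasDerivAt (fun z => avg d z / d z) _ z := hma.hasDerivAt.div hda.hasDerivAt hdz
    rw [hq.deriv]
    have := hmz z hz
    field_simp
    linear_combination (d z) * this
  rw [hder] at h2 h3
  have hTz := hT z hz
  simp only [Complex.sub_im, Complex.one_im, Complex.mul_im, h1, Complex.sub_re, Complex.one_re,
    Complex.mul_re (avg d z / d z)] at h2 h3
  have h4 : (avg d z / d z).im = 0 := by
    have : (avg d z / d z).im * (2 + z * (deriv d z / d z)).re = 0 := by
      linarith
    exact (mul_eq_zero.1 this).resolve_right hTz.ne'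
  rw [h4] at h3
  norm_num at h3

/-- For p = -avg ν / avg d one has ν/d = -p - z p' (avg d / d). At a point from Jack's lemma Re p =
0 and z p' ≤ 0, so starlikeness makes Re(ν/d) ≥ 0, a contradiction. -/
theorem re_avg_div_avg_neg {d ν : ℂ → ℂ} (hd : DifferentiableOn ℂ d disk)
    (hν : DifferentiableOn ℂ ν disk) (hne : ∀ z ∈ disk, d z ≠ 0)
    (hA : ∀ z ∈ disk, 0 < (avg d z / d z).re) (hνd : ∀ z ∈ disk, (ν z / d z).re < 0) :
    ∀ z ∈ disk, (avg ν z / avg d z).re < 0 := by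
  obtain ⟨hm, hmz⟩ := avg_spec hd
  obtain ⟨hn, hnz⟩ := avg_spec hν
  have h0d : (0 : ℂ) ∈ disk := mem_ball_self one_pos
  have hmne : ∀ z ∈ disk, avg d z ≠ 0 := fun z hz h => by
    have := hA z hz
    simp [h] at this
  suffices h : ∀ z ∈ disk, 0 < (-(avg ν z / avg d z)).re by
    intro z hz
    have := h z hz
    rw [Complex.neg_re] at this
    linarith
  by_contra hcon
  have h0 : avg ν 0 / avg d 0 = ν 0 / d 0 := by
    rw [← two_mul_avg_zero hd, ← two_mul_avg_zero hν, mul_div_mul_left _ _ two_ne_zero]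
  obtain ⟨z, hz, h1, h2, h3⟩ := exists_re_eq_zero_of_not_re_pos
    (φ := fun z => -(avg ν z / avg d z)) (hn.div hm hmne).neg
    (by simp only [h0, Complex.neg_re]; linarith [hνd 0 h0d]) hcon
  have hna := hn.differentiableAt (isOpen_ball.mem_nhds hz)
  have hma := hm.differentiableAt (isOpen_ball.mem_nhds hz)
  have hdz := hne z hz
  have hmz0 := hmne z hz
  have hder : ν z / d z = -(-(avg ν z / avg d z)) -
      z * deriv (fun z => -(avg ν z / avg d z)) z * (avg d z / d z) := by
    have hq : HasDerivAt (fun z => -(avg ν z / avg d z)) _ z :=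
      (hna.hasDerivAt.div hma.hasDerivAt hmz0).neg
    rw [hq.deriv]
    have e1 := hmz z hz
    have e2 := hnz z hz
    field_simp
    linear_combination (-avg d z) * e2 + avg ν z * e1
  have h4 := hνd z hz
  have h5 := hA z hz
  rw [hder, Complex.sub_re, Complex.neg_re, h1, Complex.mul_re _ (avg d z / d z), h2] at h4
  nlinarith

/-! ### The support inequality. -/

/-- `∂²Q/∂ε∂z = z d_ε(z)`. -/
noncomputable def dfun (P : ℂ → ℂ) (γ ε z : ℂ) : ℂ :=
  deriv P (om γ ε z) * ((1 - (starRingEnd ℂ) γ * γ) / (1 + (starRingEnd ℂ) γ * (ε * z)) ^ 2)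

section

variable {P : ℂ → ℂ} {Ω : Set ℂ} {γ ε : ℂ}

theorem IsConvexMap.dfun_ne_zero (h : IsConvexMap P Ω) (hγ : ‖γ‖ < 1) (hε : ε ∈ closedDisk)
    {z : ℂ} (hz : z ∈ disk) : dfun P γ ε z ≠ 0 :=
  mul_ne_zero (h.deriv_ne_zero (om_mem_disk hγ hε hz)) (div_ne_zero (one_sub_conj_mul_ne_zero hγ)
    (pow_ne_zero 2 (one_add_ne_zero hγ (norm_mul_le_one hε (ball_subset_closedBall hz)))))

theorem IsConvexMap.hasDerivAt_dfun (h : IsConvexMap P Ω) (hγ : ‖γ‖ < 1) (hε : ε ∈ closedDisk)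
    {z : ℂ} (hz : z ∈ disk) : DifferentiableAt ℂ (dfun P γ ε) z ∧
      2 + z * (deriv (dfun P γ ε) z / dfun P γ ε z) = convT P γ ε z := by
  have hne := one_add_ne_zero hγ (norm_mul_le_one hε (ball_subset_closedBall hz))
  have ho := om_mem_disk hγ hε hz
  have h1 : HasDerivAt (fun z => deriv P (om γ ε z))
      (deriv (deriv P) (om γ ε z) * omD γ ε z) z :=
    HasDerivAt.comp z ((h.diff.deriv isOpen_ball).differentiableAt
      (isOpen_ball.mem_nhds ho)).hasDerivAt (hasDerivAt_om hne)
  have h2 : HasDerivAt (fun z => 1 + (starRingEnd ℂ) γ * (ε * z)) ((starRingEnd ℂ) γ * (ε * 1)) z :=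
    (((hasDerivAt_id z).const_mul ε).const_mul _).const_add 1
  have h3 : HasDerivAt (dfun P γ ε) (deriv (deriv P) (om γ ε z) * omD γ ε z *
      ((1 - (starRingEnd ℂ) γ * γ) / (1 + (starRingEnd ℂ) γ * (ε * z)) ^ 2) +
      deriv P (om γ ε z) * (-((1 - (starRingEnd ℂ) γ * γ) *
        (2 * (1 + (starRingEnd ℂ) γ * (ε * z)) * ((starRingEnd ℂ) γ * ε))) /
        ((1 + (starRingEnd ℂ) γ * (ε * z)) ^ 2) ^ 2)) z :=
    (h1.mul ((hasDerivAt_const z (1 - (starRingEnd ℂ) γ * γ)).div (h2.pow 2)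
      (pow_ne_zero 2 hne))).congr_deriv (by
        simp only [Pi.div_apply, Pi.pow_apply]
        push_cast
        ring)
  refine ⟨h3.differentiableAt, ?_⟩
  rw [h3.deriv]
  have hP := h.deriv_ne_zero ho
  have hc := one_sub_conj_mul_ne_zero hγ
  simp only [dfun, convT]
  obtain ⟨a, ha⟩ : ∃ a, a = 1 + (starRingEnd ℂ) γ * (ε * z) := ⟨_, rfl⟩
  obtain ⟨b, hb⟩ : ∃ b, b = 1 - (starRingEnd ℂ) γ * γ := ⟨_, rfl⟩
  rw [← ha] at hne ⊢
  rw [← hb] at hc ⊢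
  field_simp
  linear_combination (2 * deriv P (om γ ε z)) * ha

theorem IsConvexMap.re_avg_dfun_pos (h : IsConvexMap P Ω) (hγ : ‖γ‖ < 1) (hε : ε ∈ closedDisk) :
    ∀ z ∈ disk, 0 < (avg (dfun P γ ε) z / dfun P γ ε z).re :=
  re_avg_div_pos (fun _ hz => (h.hasDerivAt_dfun hγ hε hz).1.differentiableWithinAt)
    (fun _ hz => h.dfun_ne_zero hγ hε hz)
    (fun _ hz => by
      rw [(h.hasDerivAt_dfun hγ hε hz).2]
      exact h.re_convT_pos hγ hε hz)

/-- `∫_0^z ζ⁻¹ (P(ζ b(ζ)) - 1) dζ`. -/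
noncomputable def logInt (P b : ℂ → ℂ) (z : ℂ) : ℂ :=
  segIntegral (fun ζ => ζ⁻¹ * (P (ζ * b ζ) - 1)) z

theorem sub_one_eq (h0 : P 0 = 1) (w : ℂ) : P w - 1 = w * dslope P 0 w := by
  have := sub_smul_dslope P 0 w
  rw [h0, sub_zero, smul_eq_mul] at this
  exact this.symm

/-- This trades ζ⁻¹ (P - 1) for an integrand analytic at 0. The convention 0⁻¹ = 0 affects only t =
0, which the half-open interval of integration omits. -/
theorem logInt_eq (h0 : P 0 = 1) (b : ℂ → ℂ) (z : ℂ) :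
    logInt P b z = segIntegral (fun ζ => b ζ * dslope P 0 (ζ * b ζ)) z := by
  rcases eq_or_ne z 0 with rfl | hz
  · simp [logInt, segIntegral]
  refine intervalIntegral.integral_congr_ae (.of_forall fun t ht => ?_)
  rw [uIoc_of_le zero_le_one] at ht
  have : (t : ℂ) ≠ 0 := by exact_mod_cast ht.1.ne'
  simp only [sub_one_eq h0]
  field_simp

theorem mul_mem_disk {b : ℂ → ℂ} (hm : MapsTo b disk closedDisk) {z : ℂ} (hz : z ∈ disk) :
    z * b z ∈ disk := by
  have := mem_closedBall_zero_iff.1 (hm hz)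
  rw [mem_ball_zero_iff] at hz ⊢
  rw [norm_mul]
  nlinarith [norm_nonneg z]

theorem IsConvexMap.differentiableOn_integrand (h : IsConvexMap P Ω) {b : ℂ → ℂ}
    (hb : DifferentiableOn ℂ b disk) (hm : MapsTo b disk closedDisk) :
    DifferentiableOn ℂ (fun ζ => b ζ * dslope P 0 (ζ * b ζ)) disk :=
  hb.mul (((Complex.differentiableOn_dslope (ball_mem_nhds 0 one_pos)).2 h.diff).comp
    (differentiableOn_id.mul hb) fun _ hz => mul_mem_disk hm hz)

theorem IsConvexMap.hasDerivAt_logInt (h : IsConvexMap P Ω) (h0 : P 0 = 1) {b : ℂ → ℂ}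
    (hb : DifferentiableOn ℂ b disk) (hm : MapsTo b disk closedDisk) {z : ℂ} (hz : z ∈ disk) :
    HasDerivAt (logInt P b) (b z * dslope P 0 (z * b z)) z := by
  rw [show logInt P b = _ from funext (logInt_eq h0 b)]
  exact hasDerivAt_segIntegral isOpen_ball ((convex_ball (0 : ℂ) 1).starConvex
    (mem_ball_self one_pos)) (h.differentiableOn_integrand hb hm) hz

theorem mapsTo_mob_mul (hγ : ‖γ‖ < 1) {b : ℂ → ℂ} (hm : MapsTo b disk closedDisk) :
    MapsTo (fun ζ => mob γ (ζ * b ζ)) disk closedDisk := fun _ hz =>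
  mem_closedBall_zero_iff.2 (norm_mob_le hγ (mem_ball_zero_iff.1 (mul_mem_disk hm hz)).le)

theorem differentiableOn_mob_mul (hγ : ‖γ‖ < 1) {b : ℂ → ℂ} (hb : DifferentiableOn ℂ b disk)
    (hm : MapsTo b disk closedDisk) : DifferentiableOn ℂ (fun ζ => mob γ (ζ * b ζ)) disk :=
  (differentiableOn_mob hγ).comp (differentiableOn_id.mul hb) fun _ hz => mul_mem_disk hm hz

/-- The support inequality: the comparison of an arbitrary competitor with an extremal one. -/
theorem IsConvexMap.re_logInt_sub_neg (h : IsConvexMap P Ω) (h0 : P 0 = 1) (hγ : ‖γ‖ < 1)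
    (hε : ε ∈ closedDisk) {b : ℂ → ℂ} (hb : DifferentiableOn ℂ b disk)
    (hbε : ∀ z ∈ disk, ‖b z‖ ≤ ‖ε‖ ∧ b z ≠ ε) {z : ℂ} (hz : z ∈ disk) (hz0 : z ≠ 0) :
    ((logInt P (fun ζ => mob γ (ζ * b ζ)) z - logInt P (fun ζ => mob γ (ζ * ε)) z) /
      (ε * (z ^ 2 * avg (dfun P γ ε) z))).re < 0 := by
  have hm : MapsTo b disk closedDisk := fun w hw => by
    have := (hbε w hw).1
    rw [mem_closedBall_zero_iff] at hε ⊢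
    linarith
  have hε0 : ε ≠ 0 := by
    rintro rfl
    have := hbε 0 (mem_ball_self one_pos)
    simp at this
  have hεm : MapsTo (fun _ : ℂ => ε) disk closedDisk := fun _ _ => hε
  have hF₁ := h.differentiableOn_integrand (differentiableOn_mob_mul hγ hb hm)
    (mapsTo_mob_mul hγ hm)
  have hF₂ := h.differentiableOn_integrand
    (differentiableOn_mob_mul hγ (differentiableOn_const ε) hεm) (mapsTo_mob_mul hγ hεm)
  set F₁ : ℂ → ℂ := fun ζ => mob γ (ζ * b ζ) * dslope P 0 (ζ * mob γ (ζ * b ζ)) with hF₁d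
  set F₂ : ℂ → ℂ := fun ζ => mob γ (ζ * ε) * dslope P 0 (ζ * mob γ (ζ * ε)) with hF₂d
  -- Both integrands equal γ P'(0) at ζ = 0, whatever b is, so their difference is ζ ν(ζ) with ν
  -- analytic. The extra factor ζ matches the one in ∂²Q/∂ε∂z.
  set ν : ℂ → ℂ := dslope (fun ζ => F₁ ζ - F₂ ζ) 0 with hνd
  have hν : DifferentiableOn ℂ ν disk :=
    (Complex.differentiableOn_dslope (ball_mem_nhds 0 one_pos)).2 (hF₁.sub hF₂)
  have hνz : ∀ ζ, F₁ ζ - F₂ ζ = ζ * ν ζ := by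
    intro ζ
    have h1 : F₁ 0 - F₂ 0 = 0 := by simp [hF₁d, hF₂d]
    have := sub_smul_dslope (fun ζ => F₁ ζ - F₂ ζ) 0 ζ
    simp only [h1, sub_zero, smul_eq_mul] at this
    exact this.symm
  have hdd : DifferentiableOn ℂ (dfun P γ ε) disk := fun _ hz =>
    (h.hasDerivAt_dfun hγ hε hz).1.differentiableWithinAt
  have hdne : ∀ z ∈ disk, dfun P γ ε z ≠ 0 := fun _ hz => h.dfun_ne_zero hγ hε hz
  have hpt : ∀ ζ ∈ disk, ζ ≠ 0 → (ν ζ / ε / dfun P γ ε ζ).re < 0 := by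
    intro ζ hζ hζ0
    -- With ζ fixed, compare the points ζ b(ζ) and εζ under the convex map w ↦ P(ζ mob γ w).
    have hR := h.comp_mob hγ hζ hζ0
    have hw2 : ε * ζ ∈ disk := by
      rw [mul_comm]; exact mul_mem_disk hεm hζ
    have hne := one_add_ne_zero hγ (mem_ball_zero_iff.1 hw2).le
    have hlt := hR.re_div_neg (z₁ := ζ * b ζ) (z₂ := ε * ζ)
      (by rw [norm_mul, norm_mul, mul_comm]
          exact mul_le_mul_of_nonneg_right (hbε ζ hζ).1 (norm_nonneg _)) hw2
      (fun he => (hbε ζ hζ).2 (mul_left_cancel₀ hζ0 (he.trans (mul_comm _ _))))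
    have hder : deriv (fun w => P (ζ * mob γ w)) (ε * ζ) = ζ * dfun P γ ε ζ := by
      have h1 := (h.diff.differentiableAt (isOpen_ball.mem_nhds
        (om_mem_disk hγ hε hζ))).hasDerivAt
      have h2 := (hasDerivAt_mob hne).const_mul ζ
      rw [show (fun w => P (ζ * mob γ w)) = P ∘ fun w => ζ * mob γ w from rfl,
        (HasDerivAt.comp (ε * ζ) h1 h2).deriv, dfun]
      ring
    rw [hder] at hlt
    convert hlt using 2
    have h3 : P (ζ * mob γ (ζ * b ζ)) - P (ζ * mob γ (ε * ζ)) = ζ * (ζ * ν ζ) := by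
      rw [← hνz, ← sub_sub_sub_cancel_right _ _ 1, sub_one_eq h0, sub_one_eq h0, hF₁d, hF₂d,
        mul_comm ε ζ]
      ring
    rw [h3]
    have := hdne ζ hζ
    field_simp
  -- At ζ = 0 continuity gives only ≤ 0; the maximum principle, anchored at the given z ≠ 0,
  -- restores strictness.
  have hneg : ∀ ζ ∈ disk, (ν ζ / ε / dfun P γ ε ζ).re < 0 := by
    have hq : DifferentiableOn ℂ (fun ζ => ν ζ / ε / dfun P γ ε ζ) disk :=
      (hν.div_const ε).div hdd hdne
    have h0d : (0 : ℂ) ∈ disk := mem_ball_self one_pos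
    have hle : ∀ ζ ∈ disk, (ν ζ / ε / dfun P γ ε ζ).re ≤ 0 := by
      intro ζ hζ
      rcases eq_or_ne ζ 0 with rfl | hζ0
      · have hc := (hq.differentiableAt (isOpen_ball.mem_nhds h0d)).continuousAt.tendsto
        refine le_of_tendsto (((Complex.continuous_re.tendsto _).comp hc).mono_left
          (nhdsWithin_le_nhds (s := {0}ᶜ))) ?_
        filter_upwards [eventually_mem_nhdsWithin (a := (0 : ℂ)) (s := {0}ᶜ),
          nhdsWithin_le_nhds (isOpen_ball.mem_nhds h0d)] with w hw0 hw using (hpt w hw hw0).le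
      · exact (hpt ζ hζ hζ0).le
    intro ζ hζ
    exact re_neg_of_re_nonpos isOpen_ball (convex_ball _ _).isPreconnected hq hle hz
      (hpt z hz hz0) hζ
  -- The difference of the two integrals is z² avg ν, so the quotient in question is that of the
  -- averages of ν/ε and d.
  have hfin := re_avg_div_avg_neg hdd (hν.div_const ε) hdne (h.re_avg_dfun_pos hγ hε) hneg z hz
  convert hfin using 2
  have hI : logInt P (fun ζ => mob γ (ζ * b ζ)) z - logInt P (fun ζ => mob γ (ζ * ε)) z =
      z ^ 2 * avg ν z := by
    rw [logInt_eq h0, logInt_eq h0, segIntegral, segIntegral, avg,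
      ← intervalIntegral.integral_sub, ← intervalIntegral.integral_const_mul]
    · refine intervalIntegral.integral_congr fun t _ => ?_
      have := hνz (t * z)
      simp only [hF₁d, hF₂d] at this
      simp only [← sub_mul, this]
      ring
    · refine ContinuousOn.intervalIntegrable ?_
      rw [uIcc_of_le zero_le_one]
      exact (continuousOn_comp_real_mul hF₁.continuousOn hz).mul continuousOn_const
    · refine ContinuousOn.intervalIntegrable ?_
      rw [uIcc_of_le zero_le_one]
      exact (continuousOn_comp_real_mul hF₂.continuousOn hz).mul continuousOn_const
  have hav : avg (fun ζ => ν ζ / ε) z = avg ν z / ε := by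
    simp only [avg, mul_div_assoc', intervalIntegral.integral_div]
  rw [hI, hav]
  field_simp

end

/-! ### The class in terms of analytic functions bounded by one. -/

theorem eqOn_disk_of_ne_zero {F G : ℂ → ℂ} (hF : ContinuousOn F disk) (hG : ContinuousOn G disk)
    (h : ∀ z ∈ disk, z ≠ 0 → F z = G z) {z : ℂ} (hz : z ∈ disk) : F z = G z := by
  rcases eq_or_ne z 0 with rfl | hz0
  · have hn := isOpen_ball.mem_nhds hz
    have h1 := ((hF.continuousAt hn).tendsto.mono_left (nhdsWithin_le_nhds (s := {0}ᶜ)))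
    have h2 := ((hG.continuousAt hn).tendsto.mono_left (nhdsWithin_le_nhds (s := {0}ᶜ)))
    refine tendsto_nhds_unique h1 (h2.congr' ?_)
    filter_upwards [eventually_mem_nhdsWithin (a := (0 : ℂ)) (s := {0}ᶜ),
      nhdsWithin_le_nhds hn] with w hw0 hw using (h w hw hw0).symm
  · exact h z hz hz0

theorem eqOn_disk_of_hasDerivAt {F G F' : ℂ → ℂ} (hF : ∀ z ∈ disk, HasDerivAt F (F' z) z)
    (hG : ∀ z ∈ disk, HasDerivAt G (F' z) z) (h0 : F 0 = G 0) : EqOn F G disk :=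
  isOpen_ball.eqOn_of_deriv_eq (convex_ball _ _).isPreconnected
    (fun z hz => (hF z hz).differentiableAt.differentiableWithinAt)
    (fun z hz => (hG z hz).differentiableAt.differentiableWithinAt)
    (fun z hz => by rw [(hF z hz).deriv, (hG z hz).deriv]) (mem_ball_self one_pos) h0

section

variable {P : ℂ → ℂ} {Ω : Set ℂ}

theorem hasDerivAt_segIntegral_disk {F : ℂ → ℂ} (hF : DifferentiableOn ℂ F disk) {z : ℂ}
    (hz : z ∈ disk) : HasDerivAt (segIntegral F) (F z) z :=
  hasDerivAt_segIntegral isOpen_ball ((convex_ball (0 : ℂ) 1).starConvex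
    (mem_ball_self one_pos)) hF hz

theorem coeff_two (f : ℂ → ℂ) : coeff 2 f = deriv (deriv f) 0 / 2 := by
  rw [coeff, iteratedDeriv_succ, iteratedDeriv_one]; simp

/-- Every function of the class comes from a function with values in the closed disk. -/
theorem IsConvexMap.exists_of_memCV (h : IsConvexMap P Ω) (h0 : P 0 = 1) {f : ℂ → ℂ}
    (hf : MemCV Ω f) : ∃ b : ℂ → ℂ, DifferentiableOn ℂ b disk ∧ MapsTo b disk closedDisk ∧
      coeff 2 f = deriv P 0 * b 0 / 2 ∧ ∀ L, IsLogDeriv f L → EqOn L (logInt P b) disk := by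
  have h0d : (0 : ℂ) ∈ disk := mem_ball_self one_pos
  have hf1 := hf.analytic.deriv isOpen_ball
  have hf2 := hf1.deriv isOpen_ball
  have hg : DifferentiableOn ℂ (fun z => 1 + z * deriv (deriv f) z / deriv f z) disk :=
    ((differentiableOn_id.mul hf2).div hf1 hf.deriv_ne_zero).const_add 1
  obtain ⟨ω, hω, hωm, hω0, hωP⟩ := h.exists_schwarz hg hf.mem (by simp [h0])
  -- The function b is ω(z)/z, bounded by 1 by Schwarz's lemma.
  have hb : DifferentiableOn ℂ (dslope ω 0) disk :=
    (Complex.differentiableOn_dslope (ball_mem_nhds 0 one_pos)).2 hω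
  have hbm : MapsTo (dslope ω 0) disk closedDisk := fun z hz => by
    have := Complex.norm_dslope_le_div_of_mapsTo_ball hω
      (hωm.mono_right (by rw [hω0]; exact ball_subset_closedBall)) hz
    simpa using this
  have hωb : ∀ z, ω z = z * dslope ω 0 z := fun z => by
    have := sub_smul_dslope ω 0 z
    rw [hω0] at this
    simpa using this.symm
  -- Off the origin this is 1 + z f''/f' = P(z b) with a factor z cancelled. Continuity supplies z =
  -- 0, where the identity computes a₂.
  have hq : ∀ z ∈ disk, deriv (deriv f) z / deriv f z =
      dslope ω 0 z * dslope P 0 (z * dslope ω 0 z) := by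
    intro z hz
    refine eqOn_disk_of_ne_zero (hf2.div hf1 hf.deriv_ne_zero).continuousOn
      (h.differentiableOn_integrand hb hbm).continuousOn (fun z hz hz0 => ?_) hz
    have h1 := hωP z hz
    have h2 := sub_one_eq h0 (ω z)
    rw [← h1, add_sub_cancel_left, hωb, mul_div_assoc, mul_assoc] at h2
    exact mul_left_cancel₀ hz0 h2
  refine ⟨dslope ω 0, hb, hbm, ?_, fun L hL => ?_⟩
  · have := hq 0 h0d
    rw [hf.deriv_zero, div_one, zero_mul, dslope_same P] at this
    rw [coeff_two, this]
    ring
  · refine eqOn_disk_of_hasDerivAt (fun z hz => ?_) (fun z hz => h.hasDerivAt_logInt h0 hb hbm hz) ?_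
    · have h1 := (hL.analytic.differentiableAt (isOpen_ball.mem_nhds hz)).hasDerivAt
      have h2 : HasDerivAt (deriv f) (exp (L z) * deriv L z) z := by
        refine h1.cexp.congr_of_eventuallyEq ?_
        filter_upwards [isOpen_ball.mem_nhds hz] with w hw using (hL.exp_eq w hw).symm
      rw [← hq z hz, h2.deriv, hL.exp_eq z hz, mul_div_cancel_left₀ _ (hf.deriv_ne_zero z hz)]
      exact h1
    · rw [hL.map_zero, logInt, segIntegral_zero]

/-- From f' = exp(`logInt P b`) one gets z f''/f' = P(z b) - 1. The formula for f is needed only on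
the disk, since the class does not constrain values outside it. -/
theorem IsConvexMap.memCV_segIntegral (h : IsConvexMap P Ω) (h0 : P 0 = 1) {b : ℂ → ℂ}
    (hb : DifferentiableOn ℂ b disk) (hm : MapsTo b disk closedDisk) {f : ℂ → ℂ}
    (hf : EqOn f (segIntegral fun ζ => exp (logInt P b ζ)) disk) :
    MemCV Ω f ∧ IsLogDeriv f (logInt P b) ∧ coeff 2 f = deriv P 0 * b 0 / 2 := by
  have h0d : (0 : ℂ) ∈ disk := mem_ball_self one_pos
  have hL : DifferentiableOn ℂ (logInt P b) disk := fun z hz =>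
    (h.hasDerivAt_logInt h0 hb hm hz).differentiableAt.differentiableWithinAt
  have hL0 : logInt P b 0 = 0 := segIntegral_zero _
  have hfd : ∀ z ∈ disk, HasDerivAt f (exp (logInt P b z)) z := fun z hz =>
    (hasDerivAt_segIntegral_disk hL.cexp hz).congr_of_eventuallyEq
      (hf.eventuallyEq_of_mem (isOpen_ball.mem_nhds hz))
  have hfd' : ∀ z ∈ disk, deriv f z = exp (logInt P b z) := fun z hz => (hfd z hz).deriv
  have hfd2 : ∀ z ∈ disk, deriv (deriv f) z =
      exp (logInt P b z) * (b z * dslope P 0 (z * b z)) := fun z hz => by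
    have h1 : HasDerivAt (deriv f) _ z :=
      (h.hasDerivAt_logInt h0 hb hm hz).cexp.congr_of_eventuallyEq
        (by filter_upwards [isOpen_ball.mem_nhds hz] with w hw using hfd' w hw)
    exact h1.deriv
  refine ⟨⟨fun z hz => (hfd z hz).differentiableAt.differentiableWithinAt, ?_, ?_, ?_, ?_⟩,
    ⟨hL, hL0, fun z hz => (hfd' z hz).symm⟩, ?_⟩
  · rw [hf h0d, segIntegral_zero]
  · rw [hfd' 0 h0d, hL0, Complex.exp_zero]
  · intro z hz
    rw [hfd' z hz]
    exact Complex.exp_ne_zero _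
  · intro z hz
    have h1 : 1 + z * deriv (deriv f) z / deriv f z = P (z * b z) := by
      rw [hfd2 z hz, hfd' z hz, ← sub_add_cancel (P (z * b z)) 1, sub_one_eq h0]
      have := Complex.exp_ne_zero (logInt P b z)
      field_simp
      ring
    rw [h1]
    exact h.bij.mapsTo (mul_mem_disk hm hz)
  · rw [coeff_two, hfd2 0 h0d, hL0, Complex.exp_zero, zero_mul, dslope_same P]
    ring

theorem MemCV.eqOn_segIntegral {f L : ℂ → ℂ} (hf : MemCV Ω f) (hL : IsLogDeriv f L)
    {M : ℂ → ℂ} (hLM : EqOn L M disk) : EqOn f (segIntegral fun ζ => exp (M ζ)) disk := by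
  have hM : DifferentiableOn ℂ M disk := hL.analytic.congr fun z hz => (hLM hz).symm
  refine eqOn_disk_of_hasDerivAt (F' := deriv f) (fun z hz =>
    (hf.analytic.differentiableAt (isOpen_ball.mem_nhds hz)).hasDerivAt) (fun z hz => ?_) ?_
  · rw [← hL.exp_eq z hz, hLM hz]
    exact hasDerivAt_segIntegral_disk hM.cexp hz
  · rw [hf.map_zero, segIntegral_zero]

theorem eqOn_const_of_norm_eq_one {b : ℂ → ℂ} (hb : DifferentiableOn ℂ b disk)
    (hm : MapsTo b disk closedDisk) {a : ℂ} (ha : a ∈ disk) (hba : ‖b a‖ = 1) :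
    EqOn b (fun _ => b a) disk :=
  Complex.eqOn_of_isPreconnected_of_isMaxOn_norm (convex_ball _ _).isPreconnected isOpen_ball hb ha
    (fun z hz => by
      have := mem_closedBall_zero_iff.1 (hm hz)
      simp only [Function.comp, Set.mem_ofPred_eq]
      rw [hba]
      exact this)

/-- The first step of the Schur algorithm. -/
theorem exists_schur {γ : ℂ} (hγ : ‖γ‖ < 1) {b : ℂ → ℂ} (hb : DifferentiableOn ℂ b disk)
    (hm : MapsTo b disk closedDisk) (hb0 : b 0 = γ) : ∃ c : ℂ → ℂ, DifferentiableOn ℂ c disk ∧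
      MapsTo c disk closedDisk ∧ EqOn b (fun z => mob γ (z * c z)) disk := by
  have h0d : (0 : ℂ) ∈ disk := mem_ball_self one_pos
  have hγ' : ‖-γ‖ < 1 := by simpa using hγ
  -- If |b| reached 1 inside the disk, b would be constant of modulus 1, against b(0) = γ.
  have hlt : MapsTo b disk disk := fun z hz => by
    by_contra hcon
    have h1 := mem_closedBall_zero_iff.1 (hm hz)
    have h2 : ‖b z‖ = 1 := le_antisymm h1 (by simpa using hcon)
    have h3 := eqOn_const_of_norm_eq_one hb hm hz h2 h0d
    simp only at h3
    rw [← h3, hb0] at h2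
    linarith
  have hm' := (bijOn_mob hγ').mapsTo
  set B : ℂ → ℂ := fun z => mob (-γ) (b z)
  have hB : DifferentiableOn ℂ B disk := (differentiableOn_mob hγ').comp hb hlt
  have hBm : MapsTo B disk disk := fun z hz => hm' (hlt hz)
  have hB0 : B 0 = 0 := by simp [B, mob, hb0]
  refine ⟨dslope B 0, (Complex.differentiableOn_dslope (ball_mem_nhds 0 one_pos)).2 hB,
    fun z hz => ?_, fun z hz => ?_⟩
  · have := Complex.norm_dslope_le_div_of_mapsTo_ball hB
      (hBm.mono_right (by rw [hB0]; exact ball_subset_closedBall)) hz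
    simpa using this
  · have h1 := sub_smul_dslope B 0 z
    rw [hB0, sub_zero, sub_zero, smul_eq_mul] at h1
    simp only [h1, B]
    have := mob_neg_mob hγ' (mem_ball_zero_iff.1 (hlt hz)).le
    rw [neg_neg] at this
    exact this.symm

/-! ### Convexity of the image from its support lines. -/

/-- A function with `Re ((q(ε₁) - q(ε)) / (ε q'(ε))) < 0` is convex. -/
theorem convex_image_of_re_neg {q D : ℂ → ℂ} {U : Set ℂ} (hU : IsOpen U) (hUc : closedDisk ⊆ U)
    (hq : ∀ ε ∈ U, HasDerivAt q (D ε) ε) (hD : ∀ ε ∈ closedDisk, D ε ≠ 0)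
    (hneg : ∀ ε ∈ closedDisk, ∀ ε₁, ‖ε₁‖ ≤ ‖ε‖ → ε₁ ≠ ε → ((q ε₁ - q ε) / (ε * D ε)).re < 0) :
    InjOn q closedDisk ∧ Convex ℝ (q '' disk) ∧ Convex ℝ (q '' closedDisk) ∧
      {w | ∀ ε ∈ circle, ((w - q ε) / (ε * D ε)).re ≤ 0} ⊆ q '' closedDisk := by
  set S : Set ℂ := {w | ∀ ε ∈ circle, ((w - q ε) / (ε * D ε)).re ≤ 0} with hS
  have hqd : DifferentiableOn ℂ q U := fun ε hε => (hq ε hε).differentiableAt.differentiableWithinAt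
  have hDeq : EqOn D (deriv q) U := fun ε hε => (hq ε hε).deriv.symm
  have hDd : DifferentiableOn ℂ D U := (hqd.deriv hU).congr hDeq
  have hconv : Convex ℝ S := by
    intro w₁ h1 w₂ h2 a b ha hb hab ε hε
    have h3 := h1 ε hε
    have h4 := h2 ε hε
    have h5 : (a • w₁ + b • w₂ - q ε) / (ε * D ε) =
        (a : ℂ) * ((w₁ - q ε) / (ε * D ε)) + (b : ℂ) * ((w₂ - q ε) / (ε * D ε)) := by
      have : (a : ℂ) + b = 1 := by exact_mod_cast hab
      simp only [Complex.real_smul]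
      linear_combination (q ε / (ε * D ε)) * this
    rw [h5, Complex.add_re, Complex.re_ofReal_mul, Complex.re_ofReal_mul]
    nlinarith
  -- If w in S were omitted by q, then F = ε D/(q - w) would be analytic with Re F ≥ 0 on the
  -- circle, hence on the disk. But F(0) = 0, so Re F vanishes identically and F is the constant 0;
  -- at ε = 1/2 this contradicts D ≠ 0.
  have hsub : S ⊆ q '' closedDisk := by
    intro w hw
    by_contra hcon
    have hne : ∀ ε ∈ closedDisk, q ε - w ≠ 0 := fun ε hε h => hcon ⟨ε, hε, sub_eq_zero.1 h⟩
    set F : ℂ → ℂ := fun ε => ε * D ε / (q ε - w) with hF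
    have hFc : DifferentiableOn ℂ F closedDisk :=
      ((differentiableOn_id.mul hDd).mono hUc).div ((hqd.mono hUc).sub_const w) hne
    have hFd := hFc.mono ball_subset_closedBall
    have hre : ∀ ε ∈ closedDisk, 0 ≤ (F ε).re := by
      intro ε hε
      refine re_nonneg_of_sphere (F := F) ?_ (fun ε hε => ?_) hε
      · refine DifferentiableOn.diffContOnCl ?_
        rw [closure_ball _ one_ne_zero]
        exact hFc
      · have h1 := hw ε hε
        have h2 : F ε = (-((w - q ε) / (ε * D ε)))⁻¹ := by
          rw [hF, ← neg_div, neg_sub, inv_div]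
        rw [h2, Complex.inv_re]
        refine div_nonneg ?_ (Complex.normSq_nonneg _)
        rw [Complex.neg_re]; linarith
    have h0d : (0 : ℂ) ∈ disk := mem_ball_self one_pos
    have hF0 : F 0 = 0 := by simp [hF]
    have hz : ∀ ε ∈ disk, (F ε).re = 0 := by
      intro ε hε
      by_contra hne0
      have := re_pos_of_re_nonneg isOpen_ball (convex_ball _ _).isPreconnected hFd
        (fun z hz => hre z (ball_subset_closedBall hz)) hε
        (lt_of_le_of_ne (hre ε (ball_subset_closedBall hε)) (Ne.symm hne0)) h0d
      simp [hF0] at this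
    obtain ⟨c, hc⟩ := AnalyticOnNhd.eq_const_of_re_eq_const (hFd.analyticOnNhd isOpen_ball) hz
      isOpen_ball ⟨⟨0, h0d⟩, (convex_ball _ _).isPreconnected⟩
    have hhalf : (1 / 2 : ℂ) ∈ disk := by simp; norm_num
    have h1 := hc _ hhalf
    rw [← hc _ h0d, hF0, hF] at h1
    have h2 := hD _ (ball_subset_closedBall hhalf)
    have h3 := hne _ (ball_subset_closedBall hhalf)
    simp only at h1
    rw [div_eq_zero_iff, mul_eq_zero] at h1
    rcases h1 with (h1 | h1) | h1
    · norm_num at h1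
    · exact h2 h1
    · exact h3 h1
  have hsup : q '' closedDisk ⊆ S := by
    rintro _ ⟨ε₁, h1, rfl⟩ ε hε
    rcases eq_or_ne ε₁ ε with rfl | hne
    · simp
    · refine (hneg ε (sphere_subset_closedBall hε) ε₁ ?_ hne).le
      rw [mem_sphere_zero_iff_norm.1 hε]
      exact mem_closedBall_zero_iff.1 h1
  have heq : q '' closedDisk = S := hsup.antisymm hsub
  -- q is open on the disk since D ≠ 0. A point q(ε) with |ε| = 1 is not interior to S, because
  -- moving it in the outward direction ε D(ε) violates its own support inequality.
  have hint : q '' disk = interior S := by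
    refine Subset.antisymm ?_ ?_
    · refine interior_maximal ((image_mono ball_subset_closedBall).trans hsup) ?_
      rw [isOpen_iff_mem_nhds]
      rintro _ ⟨ε, hε, rfl⟩
      have hε' := ball_subset_closedBall hε
      have h1 : HasStrictDerivAt q (deriv q ε) ε :=
        ((hqd.analyticAt (hU.mem_nhds (hUc hε')))).hasStrictDerivAt
      rw [← h1.map_nhds_eq (by rw [← hDeq (hUc hε')]; exact hD ε hε')]
      exact image_mem_map (isOpen_ball.mem_nhds hε)
    · intro w hw
      obtain ⟨ε, hε, rfl⟩ := hsub (interior_subset hw)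
      rcases (mem_closedBall_zero_iff.1 hε).lt_or_eq with h1 | h1
      · exact ⟨ε, by simpa using h1, rfl⟩
      · exfalso
        have hεc : ε ∈ circle := by simpa using h1
        have hε0 : ε ≠ 0 := by rintro rfl; simp at h1
        have hc : Tendsto (fun t : ℝ => q ε + t * (ε * D ε)) (𝓝[>] 0) (𝓝 (q ε)) := by
          have : Continuous fun t : ℝ => q ε + t * (ε * D ε) := by fun_prop
          have h2 := this.tendsto 0
          simp only [ofReal_zero, zero_mul, add_zero] at h2
          exact h2.mono_left nhdsWithin_le_nhds
        obtain ⟨t, ht, ht0⟩ := ((hc.eventually (mem_interior_iff_mem_nhds.1 hw)).and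
          eventually_mem_nhdsWithin).exists
        have h3 := ht ε hεc
        rw [add_sub_cancel_left, mul_div_cancel_right₀ _ (mul_ne_zero hε0 (hD ε hε)),
          Complex.ofReal_re] at h3
        exact absurd ht0 (not_lt.2 h3)
  refine ⟨?_, hint ▸ hconv.interior, heq ▸ hconv, hsub⟩
  have key : ∀ ε₁ ε₂, ε₂ ∈ closedDisk → ‖ε₁‖ ≤ ‖ε₂‖ → q ε₁ = q ε₂ → ε₁ = ε₂ := by
    intro ε₁ ε₂ h2 h12 he
    by_contra hne
    have := hneg ε₂ h2 ε₁ h12 hne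
    simp [he] at this
  intro ε₁ h1 ε₂ h2 he
  rcases le_total ‖ε₁‖ ‖ε₂‖ with h | h
  · exact key _ _ h2 h he
  · exact (key _ _ h1 h he.symm).symm

end

/-! ### The region of variability for a general convex map. -/

section

variable {P : ℂ → ℂ} {Ω : Set ℂ} {γ : ℂ}

/-- Only |εz| < 1 is required, so the dependence on ε is analytic in a disk larger than the closed
unit disk when |z| < 1. At points with tz = 0, where ζ⁻¹ is useless, the integrand does not depend
on ε. -/
theorem IsConvexMap.hasDerivAt_logInt_param (h : IsConvexMap P Ω) (h0 : P 0 = 1) (hγ : ‖γ‖ < 1)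
    {z : ℂ} (hz : z ∈ disk) {ε : ℂ} (hε : ‖ε * z‖ < 1) :
    HasDerivAt (fun ε => logInt P (fun ζ => mob γ (ζ * ε)) z)
      (z ^ 2 * avg (dfun P γ ε) z) ε := by
  set U : Set ℂ := {ε | ‖ε * z‖ < 1} with hUdef
  have hU : IsOpen U := isOpen_lt (by fun_prop) continuous_const
  have hin : ∀ t ∈ Icc (0 : ℝ) 1, ∀ e ∈ U, e * (t * z) ∈ disk := by
    intro t ht e he
    rw [mul_left_comm]
    exact real_mul_mem_disk ht (mem_ball_zero_iff.2 he)
  have hom : ∀ t ∈ Icc (0 : ℝ) 1, ∀ e ∈ U, om γ e (t * z) ∈ disk := by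
    intro t ht e he
    have h1 := norm_om_le hγ (mem_ball_zero_iff.1 (hin t ht e he)).le
    have h2 := mem_ball_zero_iff.1 (real_mul_mem_disk ht hz)
    exact mem_ball_zero_iff.2 (h1.trans_lt h2)
  have hp1 : ContinuousOn (dslope P 0) disk :=
    ((Complex.differentiableOn_dslope (ball_mem_nhds 0 one_pos)).2 h.diff).continuousOn
  have hP' : ContinuousOn (deriv P) disk := (h.diff.deriv isOpen_ball).continuousOn
  have hmobc := (differentiableOn_mob hγ).continuousOn
  have key := hasDerivAt_intervalIntegral_param hU
    (F := fun t e => mob γ (e * (t * z)) * dslope P 0 (om γ e (t * z)) * z)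
    (F' := fun t e => (t : ℂ) * (z ^ 2 * dfun P γ e (t * z))) ?_ ?_ ?_ (z₀ := ε) hε
  · have e1 : (fun ε => logInt P (fun ζ => mob γ (ζ * ε)) z) = fun e =>
        ∫ t in (0 : ℝ)..1, mob γ (e * (t * z)) * dslope P 0 (om γ e (t * z)) * z := by
      funext e
      simp only [logInt_eq h0, segIntegral, om, mul_comm _ e]
    rw [e1]
    refine key.congr_deriv ?_
    rw [avg, ← intervalIntegral.integral_const_mul]
    refine intervalIntegral.integral_congr fun t _ => ?_
    ring
  · intro e he
    have h1 : ContinuousOn (fun t : ℝ => mob γ (e * (t * z))) (Icc 0 1) :=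
      hmobc.comp (by fun_prop) fun t ht => hin t ht e he
    have h2 : ContinuousOn (fun t : ℝ => om γ e (t * z)) (Icc 0 1) :=
      (Continuous.continuousOn (by fun_prop)).mul h1
    exact (h1.mul (hp1.comp h2 fun t ht => hom t ht e he)).mul continuousOn_const
  · have h1 : ContinuousOn (fun p : ℝ × ℂ => mob γ (p.2 * (p.1 * z))) (Icc 0 1 ×ˢ U) :=
      hmobc.comp (by fun_prop) fun p hp => hin p.1 hp.1 p.2 hp.2
    have h2 : ContinuousOn (fun p : ℝ × ℂ => om γ p.2 (p.1 * z)) (Icc 0 1 ×ˢ U) :=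
      (Continuous.continuousOn (by fun_prop)).mul h1
    unfold dfun
    refine (Continuous.continuousOn (by fun_prop)).mul (continuousOn_const.mul
      ((hP'.comp h2 fun p hp => hom p.1 hp.1 p.2 hp.2).mul (ContinuousOn.div continuousOn_const
        (Continuous.continuousOn (by fun_prop)) fun p hp => ?_)))
    exact pow_ne_zero 2 (one_add_ne_zero hγ (mem_ball_zero_iff.1 (hin p.1 hp.1 p.2 hp.2)).le)
  · intro t ht e he
    rcases eq_or_ne ((t : ℂ) * z) 0 with hs | hs
    · have h2 : (t : ℂ) * (z ^ 2 * dfun P γ e (t * z)) = 0 := by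
        rw [show (t : ℂ) * (z ^ 2 * dfun P γ e (t * z)) = (t * z) * (z * dfun P γ e (t * z)) by ring,
          hs, zero_mul]
      rw [h2]
      have : (fun e => mob γ (e * (t * z)) * dslope P 0 (om γ e (t * z)) * z) = fun _ =>
          mob γ 0 * dslope P 0 0 * z := by
        funext e; simp [om, hs]
      rw [this]
      exact hasDerivAt_const e _
    · have hne := one_add_ne_zero hγ (mem_ball_zero_iff.1 (hin t ht e he)).le
      have h1 : HasDerivAt (fun e => e * ((t : ℂ) * z)) (t * z) e := by
        simpa using (hasDerivAt_id e).mul_const ((t : ℂ) * z)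
      have h2 : HasDerivAt (fun e => om γ e (t * z)) _ e :=
        (HasDerivAt.comp e (hasDerivAt_mob hne) h1).const_mul _
      have h3 := HasDerivAt.comp e (h.diff.differentiableAt (isOpen_ball.mem_nhds
        (hom t ht e he))).hasDerivAt h2
      have ht0 := left_ne_zero_of_mul hs
      have hz0 := right_ne_zero_of_mul hs
      have h4 := ((h3.sub_const 1).const_mul ((t : ℂ) * z)⁻¹).mul_const z
      have e1 : (fun e => mob γ (e * (t * z)) * dslope P 0 (om γ e (t * z)) * z) = fun e =>
          ((t : ℂ) * z)⁻¹ * ((P ∘ fun e => om γ e (t * z)) e - 1) * z := by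
        funext e
        simp only [Function.comp, sub_one_eq h0]
        rw [om]
        field_simp
      rw [e1]
      refine h4.congr_deriv ?_
      rw [dfun]
      obtain ⟨a, ha⟩ : ∃ a, a = 1 + (starRingEnd ℂ) γ * (e * (t * z)) := ⟨_, rfl⟩
      rw [← ha] at hne ⊢
      field_simp

theorem logInt_congr {b c : ℂ → ℂ} (h : EqOn b c disk) {z : ℂ} (hz : z ∈ disk) :
    logInt P b z = logInt P c z := by
  refine intervalIntegral.integral_congr fun t ht => ?_
  rw [uIcc_of_le zero_le_one] at ht
  simp only [h (real_mul_mem_disk ht hz)]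

/-- The region of variability of `log f'(z₀)`. -/
theorem IsConvexMap.variability (h : IsConvexMap P Ω) (h0 : P 0 = 1) {α : ℝ} (hα : 0 < α)
    (hPα : deriv P 0 = (α : ℂ)) {z₀ : ℂ} (hz : z₀ ∈ disk) (hz0 : z₀ ≠ 0) {l : ℂ}
    (hγl : γ = 2 * l / (α : ℂ)) :
    (‖γ‖ = 1 → {w | ∃ f, MemCV Ω f ∧ coeff 2 f = l ∧ ∃ L, IsLogDeriv f L ∧ w = L z₀} =
      {segIntegral (fun ζ => ζ⁻¹ * (P (γ * ζ) - 1)) z₀}) ∧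
    (‖γ‖ < 1 →
      {w | ∃ f, MemCV Ω f ∧ coeff 2 f = l ∧ ∃ L, IsLogDeriv f L ∧ w = L z₀} =
        (fun ε => logInt P (fun ζ => mob γ (ζ * ε)) z₀) '' closedDisk ∧
      AnalyticOnNhd ℂ (fun ε => logInt P (fun ζ => mob γ (ζ * ε)) z₀) closedDisk ∧
      InjOn (fun ε => logInt P (fun ζ => mob γ (ζ * ε)) z₀) closedDisk ∧
      Convex ℝ ((fun ε => logInt P (fun ζ => mob γ (ζ * ε)) z₀) '' disk) ∧
      Convex ℝ ((fun ε => logInt P (fun ζ => mob γ (ζ * ε)) z₀) '' closedDisk) ∧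
      ∀ ε ∈ circle, ∀ f : ℂ → ℂ,
        (MemCV Ω f ∧ coeff 2 f = l ∧
          ∃ L, IsLogDeriv f L ∧ L z₀ = logInt P (fun ζ => mob γ (ζ * ε)) z₀) ↔
        ∀ z ∈ disk, f z = segIntegral (fun ζ => exp (logInt P (fun ζ => mob γ (ζ * ε)) ζ)) z) := by
  have h0d : (0 : ℂ) ∈ disk := mem_ball_self one_pos
  have hαc : (α : ℂ) ≠ 0 := by exact_mod_cast hα.ne'
  -- Since a₂ = P'(0) b(0)/2, prescribing a₂ is the same as prescribing b(0).
  have hl : ∀ c : ℂ, deriv P 0 * c / 2 = l ↔ c = γ := by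
    intro c
    rw [hPα, hγl, eq_div_iff hαc, div_eq_iff two_ne_zero, mul_comm (α : ℂ), mul_comm l]
  refine ⟨fun hγ => ?_, fun hγ => ?_⟩
  · have hm : MapsTo (fun _ : ℂ => γ) disk closedDisk := fun _ _ => by simp [hγ]
    have hval : segIntegral (fun ζ => ζ⁻¹ * (P (γ * ζ) - 1)) z₀ = logInt P (fun _ => γ) z₀ := by
      simp only [logInt, mul_comm γ]
    rw [hval]
    ext w
    simp only [Set.mem_ofPred_eq, mem_singleton_iff]
    constructor
    · rintro ⟨f, hf, hfl, L, hL, rfl⟩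
      obtain ⟨b, hb, hbm, hb0, hbL⟩ := h.exists_of_memCV h0 hf
      rw [hbL L hL hz]
      have hb0' : b 0 = γ := (hl _).1 (hb0.symm.trans hfl)
      refine logInt_congr ?_ hz
      have := eqOn_const_of_norm_eq_one hb hbm h0d (by rw [hb0', hγ])
      rwa [hb0'] at this
    · rintro rfl
      obtain ⟨h1, h2, h3⟩ := h.memCV_segIntegral h0 (differentiableOn_const γ) hm (eqOn_refl _ _)
      exact ⟨_, h1, h3.trans ((hl γ).2 rfl), _, h2, rfl⟩
  have hU : IsOpen {ε : ℂ | ‖ε * z₀‖ < 1} := isOpen_lt (by fun_prop) continuous_const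
  have hUc : closedDisk ⊆ {ε : ℂ | ‖ε * z₀‖ < 1} := fun ε hε => by
    have h1 := mem_closedBall_zero_iff.1 hε
    have h2 := mem_ball_zero_iff.1 hz
    simp only [Set.mem_ofPred_eq, norm_mul]
    nlinarith [norm_nonneg z₀]
  have hq : ∀ ε ∈ {ε : ℂ | ‖ε * z₀‖ < 1},
      HasDerivAt (fun ε => logInt P (fun ζ => mob γ (ζ * ε)) z₀)
        (z₀ ^ 2 * avg (dfun P γ ε) z₀) ε := fun ε hε => h.hasDerivAt_logInt_param h0 hγ hz hε
  have hD : ∀ ε ∈ closedDisk, z₀ ^ 2 * avg (dfun P γ ε) z₀ ≠ 0 := fun ε hε => by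
    refine mul_ne_zero (pow_ne_zero 2 hz0) fun he => ?_
    have := h.re_avg_dfun_pos hγ hε z₀ hz
    simp [he] at this
  obtain ⟨hinj, hc1, hc2, hsub⟩ := convex_image_of_re_neg hU hUc hq hD (fun ε hε ε₁ h12 hne =>
    h.re_logInt_sub_neg h0 hγ hε (differentiableOn_const ε₁) (fun _ _ => ⟨h12, hne⟩) hz hz0)
  have hεm : ∀ ε ∈ closedDisk, MapsTo (fun _ : ℂ => ε) disk closedDisk := fun ε hε _ _ => hε
  have hmem : ∀ ε ∈ closedDisk, ∀ f : ℂ → ℂ,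
      EqOn f (segIntegral fun ζ => exp (logInt P (fun ζ => mob γ (ζ * ε)) ζ)) disk →
      MemCV Ω f ∧ coeff 2 f = l ∧ IsLogDeriv f (logInt P (fun ζ => mob γ (ζ * ε))) := by
    intro ε hε f hf
    obtain ⟨h1, h2, h3⟩ := h.memCV_segIntegral h0
      (differentiableOn_mob_mul hγ (differentiableOn_const ε) (hεm ε hε))
      (mapsTo_mob_mul hγ (hεm ε hε)) hf
    exact ⟨h1, h3.trans ((hl _).2 (by simp [mob])), h2⟩
  have hrep : ∀ f, MemCV Ω f → coeff 2 f = l → ∀ L, IsLogDeriv f L → ∃ c : ℂ → ℂ,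
      DifferentiableOn ℂ c disk ∧ MapsTo c disk closedDisk ∧
      EqOn L (logInt P (fun ζ => mob γ (ζ * c ζ))) disk := by
    intro f hf hfl L hL
    obtain ⟨b, hb, hbm, hb0, hbL⟩ := h.exists_of_memCV h0 hf
    obtain ⟨c, hc, hcm, hbc⟩ := exists_schur hγ hb hbm ((hl _).1 (hb0.symm.trans hfl))
    exact ⟨c, hc, hcm, fun z hz => (hbL L hL hz).trans (logInt_congr hbc hz)⟩
  -- Either c takes the value ε of modulus 1, and is constant by the maximum principle, or it omits
  -- ε and the support inequality is strict. The second case is excluded on the boundary, which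
  -- gives the uniqueness of the extremal functions.
  have hdich : ∀ ε ∈ circle, ∀ c : ℂ → ℂ, DifferentiableOn ℂ c disk → MapsTo c disk closedDisk →
      EqOn c (fun _ => ε) disk ∨ ((logInt P (fun ζ => mob γ (ζ * c ζ)) z₀ -
        logInt P (fun ζ => mob γ (ζ * ε)) z₀) / (ε * (z₀ ^ 2 * avg (dfun P γ ε) z₀))).re < 0 := by
    intro ε hε c hc hcm
    have hε1 := mem_sphere_zero_iff_norm.1 hε
    by_cases hex : ∃ a ∈ disk, c a = ε
    · obtain ⟨a, ha, rfl⟩ := hex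
      exact .inl (eqOn_const_of_norm_eq_one hc hcm ha hε1)
    · push Not at hex
      exact .inr (h.re_logInt_sub_neg h0 hγ (sphere_subset_closedBall hε) hc
        (fun z hz => ⟨by rw [hε1]; exact mem_closedBall_zero_iff.1 (hcm hz), hex z hz⟩) hz hz0)
  have hcongr : ∀ ε, ∀ c : ℂ → ℂ, EqOn c (fun _ => ε) disk → EqOn (fun ζ => mob γ (ζ * c ζ))
      (fun ζ => mob γ (ζ * ε)) disk := fun ε c hc ζ hζ => by
    simp only [hc hζ]
  refine ⟨Subset.antisymm ?_ ?_, ?_, hinj, hc1, hc2, ?_⟩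
  · rintro w ⟨f, hf, hfl, L, hL, rfl⟩
    obtain ⟨c, hc, hcm, hLc⟩ := hrep f hf hfl L hL
    rw [hLc hz]
    refine hsub fun ε hε => ?_
    rcases hdich ε hε c hc hcm with h1 | h1
    · rw [logInt_congr (hcongr ε c h1) hz]
      simp
    · exact h1.le
  · rintro _ ⟨ε, hε, rfl⟩
    obtain ⟨h1, h2, h3⟩ := hmem ε hε _ (eqOn_refl _ _)
    exact ⟨_, h1, h2, _, h3, rfl⟩
  · intro ε hε
    exact DifferentiableOn.analyticAt (s := {ε : ℂ | ‖ε * z₀‖ < 1})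
      (fun e he => (hq e he).differentiableAt.differentiableWithinAt) (hU.mem_nhds (hUc hε))
  · intro ε hε f
    constructor
    · rintro ⟨hf, hfl, L, hL, hLz⟩
      obtain ⟨c, hc, hcm, hLc⟩ := hrep f hf hfl L hL
      rcases hdich ε hε c hc hcm with h1 | h1
      · exact hf.eqOn_segIntegral hL fun z hz =>
          (hLc hz).trans (logInt_congr (hcongr ε c h1) hz)
      · rw [← hLc hz, hLz] at h1
        simp at h1
    · intro hf
      obtain ⟨h1, h2, h3⟩ := hmem ε (sphere_subset_closedBall hε) f hf
      exact ⟨h1, h2, _, h3, rfl⟩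

theorem Q_eq_logInt (k x : ℝ) (γ z ε : ℂ) :
    Q k x γ z ε = logInt (KUCV.P k x) (fun ζ => mob γ (ζ * ε)) z := by
  simp only [Q, logInt, mob, mul_comm ε, mul_assoc]

end

/-! ### Focal distances for cosine, and the chain rule at a critical point. -/

theorem cos_re (η : ℂ) : (cos η).re = Real.cos η.re * Real.cosh η.im := by
  rw [Complex.cos_eq, ← ofReal_cos, ← ofReal_cosh, ← ofReal_sin, ← ofReal_sinh]
  simp [-ofReal_cos, -ofReal_cosh, -ofReal_sin, -ofReal_sinh]

theorem cos_im (η : ℂ) : (cos η).im = -(Real.sin η.re * Real.sinh η.im) := by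
  rw [Complex.cos_eq, ← ofReal_cos, ← ofReal_cosh, ← ofReal_sin, ← ofReal_sinh]
  simp [-ofReal_cos, -ofReal_cosh, -ofReal_sin, -ofReal_sinh]

/-- The point 1 is a focus of the conics into which cos carries lines parallel to the axes, so the
distance to it separates the two coordinates. This factors the inequality defining Ω_k when k ≠ 1.
-/
theorem norm_one_sub_cos (η : ℂ) : ‖1 - cos η‖ = Real.cosh η.im - Real.cos η.re := by
  have h1 : 0 ≤ Real.cosh η.im - Real.cos η.re := by
    linarith [Real.one_le_cosh η.im, Real.cos_le_one η.re]
  rw [← sq_eq_sq₀ (norm_nonneg _) h1, Complex.sq_norm, Complex.normSq_apply]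
  simp only [Complex.sub_re, Complex.sub_im, Complex.one_re, Complex.one_im, cos_re, cos_im]
  have h2 := Real.sin_sq_add_cos_sq η.re
  have h3 := Real.cosh_sq η.im
  linear_combination (Real.sinh η.im ^ 2) * h2 + (Real.cos η.re ^ 2 - 1) * h3

/-- The second-order chain rule at a critical point. -/
theorem deriv_eq_of_comp {P p e p' e' : ℂ → ℂ} {c p₂ e₂ : ℂ} (hP : AnalyticAt ℂ P (p c))
    (hp : ∀ᶠ s in 𝓝 c, HasDerivAt p (p' s) s) (he : ∀ᶠ s in 𝓝 c, HasDerivAt e (e' s) s)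
    (hc : ∀ᶠ s in 𝓝 c, P (p s) = e s) (hp' : HasDerivAt p' p₂ c) (he' : HasDerivAt e' e₂ c)
    (hp0 : p' c = 0) (hp2 : p₂ ≠ 0) : deriv P (p c) = e₂ / p₂ := by
  have hcp : ContinuousAt p c := hp.self_of_nhds.continuousAt
  -- At s = c this relation is empty because p'(c) = 0, so it is differentiated once more; only
  -- P'(p(c)) p''(c) survives.
  have h1 : (fun s => deriv P (p s) * p' s) =ᶠ[𝓝 c] e' := by
    filter_upwards [hp, he, hc.eventually_nhds, hcp.eventually hP.eventually_analyticAt] with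
      s h1 h2 h3 h4
    have h5 : HasDerivAt (fun s => P (p s)) (deriv P (p s) * p' s) s :=
      h4.differentiableAt.hasDerivAt.comp s h1
    exact h5.unique (h2.congr_of_eventuallyEq h3)
  have h2 : HasDerivAt (fun s => deriv P (p s) * p' s)
      (deriv (deriv P) (p c) * p' c * p' c + deriv P (p c) * p₂) c :=
    (hP.deriv.differentiableAt.hasDerivAt.comp c hp.self_of_nhds).mul hp'
  have h3 := h2.unique (he'.congr_of_eventuallyEq h1)
  rw [hp0, mul_zero, zero_add] at h3
  exact eq_div_of_mul_eq hp2 h3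

/-! ### Even maps of a strip as maps of the disk. -/

section LogQuot

/-- `log ((1 + s) / (1 - s))`. -/
noncomputable def logMob (s : ℂ) : ℂ := log ((1 + s) / (1 - s))

theorem one_sub_ne_zero {s : ℂ} (hs : s ∈ disk) : 1 - s ≠ 0 := by
  intro h
  rw [← sub_eq_zero.1 h] at hs
  simp at hs

theorem one_add_ne_zero' {s : ℂ} (hs : s ∈ disk) : 1 + s ≠ 0 := by
  have := one_sub_ne_zero (s := -s) (by simpa using hs)
  rwa [sub_neg_eq_add] at this

theorem re_mob_pos {s : ℂ} (hs : s ∈ disk) : 0 < ((1 + s) / (1 - s)).re := by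
  have h1 := Complex.normSq_pos.2 (one_sub_ne_zero hs)
  have h2 : Complex.normSq s < 1 := by
    rw [Complex.normSq_eq_norm_sq]
    have := mem_ball_zero_iff.1 hs
    nlinarith [norm_nonneg s]
  have h3 : ((1 + s) / (1 - s)).re = (1 - Complex.normSq s) / Complex.normSq (1 - s) := by
    rw [Complex.div_re, ← add_div]
    congr 1
    simp only [Complex.normSq_apply, Complex.add_re, Complex.sub_re, Complex.one_re,
      Complex.add_im, Complex.sub_im, Complex.one_im]
    ring
  rw [h3]
  exact div_pos (by linarith) h1

theorem hasDerivAt_logMob {s : ℂ} (hs : s ∈ disk) :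
    HasDerivAt logMob (2 / (1 - s ^ 2)) s := by
  have h1 := one_sub_ne_zero hs
  have h2 := one_add_ne_zero' hs
  have h3 : HasDerivAt (fun s : ℂ => (1 + s) / (1 - s)) _ s :=
    ((hasDerivAt_id s).const_add 1).div ((hasDerivAt_id s).const_sub 1) h1
  refine (h3.clog (.inl (re_mob_pos hs))).congr_deriv ?_
  have h4 : 1 - s ^ 2 = (1 - s) * (1 + s) := by ring
  rw [h4]
  simp only [id]
  field_simp
  ring

theorem abs_im_logMob_lt {s : ℂ} (hs : s ∈ disk) : |(logMob s).im| < Real.pi / 2 := by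
  rw [logMob, Complex.log_im]
  exact Complex.abs_arg_lt_pi_div_two_iff.2 (.inl (re_mob_pos hs))

theorem exp_logMob {s : ℂ} (hs : s ∈ disk) : exp (logMob s) = (1 + s) / (1 - s) :=
  Complex.exp_log (div_ne_zero (one_add_ne_zero' hs) (one_sub_ne_zero hs))

theorem logMob_injOn : InjOn logMob disk := by
  intro s hs t ht h
  have h1 : (1 + s) / (1 - s) = (1 + t) / (1 - t) := by
    rw [← exp_logMob hs, ← exp_logMob ht, h]
  rw [div_eq_div_iff (one_sub_ne_zero hs) (one_sub_ne_zero ht)] at h1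
  linear_combination (1 / 2) * h1

theorem logMob_neg {s : ℂ} (hs : s ∈ disk) : logMob (-s) = -logMob s := by
  have h1 : (1 + -s) / (1 - -s) = ((1 + s) / (1 - s))⁻¹ := by
    rw [inv_div, sub_neg_eq_add, ← sub_eq_add_neg]
  rw [logMob, h1, Complex.log_inv, logMob]
  intro h
  have h2 := Complex.abs_arg_lt_pi_div_two_iff.2 (.inl (re_mob_pos hs))
  rw [h, abs_of_pos Real.pi_pos] at h2
  linarith [Real.pi_pos]

theorem exists_logMob_eq {L : ℂ} (hL : |L.im| < Real.pi / 2) : ∃ s ∈ disk, logMob s = L := by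
  obtain ⟨h1, h2⟩ := abs_lt.1 hL
  have hre : 0 < (exp L).re := by
    rw [Complex.exp_re]
    exact mul_pos (Real.exp_pos _) (Real.cos_pos_of_mem_Ioo ⟨by linarith, h2⟩)
  have hne : exp L + 1 ≠ 0 := fun h => by
    have := congrArg Complex.re h
    simp only [Complex.add_re, Complex.one_re, Complex.zero_re] at this
    linarith
  -- The witness is tanh(L/2), which solves (1 + s)/(1 - s) = e^L. It lies in the disk because Re
  -- e^L > 0.
  refine ⟨(exp L - 1) / (exp L + 1), ?_, ?_⟩
  · rw [mem_ball_zero_iff, norm_div, div_lt_one (norm_pos_iff.2 hne)]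
    refine lt_of_pow_lt_pow_left₀ 2 (norm_nonneg _) ?_
    rw [Complex.sq_norm, Complex.sq_norm, Complex.normSq_apply, Complex.normSq_apply]
    simp only [Complex.add_re, Complex.sub_re, Complex.one_re, Complex.add_im, Complex.sub_im,
      Complex.one_im]
    nlinarith
  · have h3 : (1 + (exp L - 1) / (exp L + 1)) / (1 - (exp L - 1) / (exp L + 1)) = exp L := by
      rw [one_add_div hne, one_sub_div hne, div_div_div_cancel_right₀ hne]
      ring_nf
    rw [logMob, h3, Complex.log_exp] <;> linarith [Real.pi_pos]

theorem sq_cpow_half (z : ℂ) : (z ^ (1 / 2 : ℂ)) ^ 2 = z := by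
  rw [one_div]
  exact Complex.cpow_nat_inv_pow z two_ne_zero

theorem cpow_half_mem_disk {z : ℂ} (hz : z ∈ disk) : z ^ (1 / 2 : ℂ) ∈ disk := by
  rw [mem_ball_zero_iff] at hz ⊢
  have h1 : ‖z ^ (1 / 2 : ℂ)‖ ^ 2 = ‖z‖ := by rw [← norm_pow, sq_cpow_half]
  nlinarith [norm_nonneg (z ^ (1 / 2 : ℂ))]

theorem sq_mem_disk {s : ℂ} (hs : s ∈ disk) : s ^ 2 ∈ disk := by
  rw [mem_ball_zero_iff] at hs ⊢
  rw [norm_pow]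
  nlinarith [norm_nonneg s]

/-- An even conformal map of the strip `|Im L| < π / 2` gives a conformal map of the disk. -/
theorem isConvexMap_comp_logQuot {Φ Φ' : ℂ → ℂ} {Φ₂ : ℂ} {Ω : Set ℂ} (hΩ : Convex ℝ Ω)
    (hΦ : ∀ L, HasDerivAt Φ (Φ' L) L) (hΦ' : HasDerivAt Φ' Φ₂ 0) (heven : ∀ L, Φ (-L) = Φ L)
    (hmem : ∀ L : ℂ, |L.im| < Real.pi / 2 → Φ L ∈ Ω)
    (hsurj : ∀ w ∈ Ω, ∃ L : ℂ, |L.im| < Real.pi / 2 ∧ Φ L = w)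
    (hinj : ∀ L M : ℂ, |L.im| < Real.pi / 2 → |M.im| < Real.pi / 2 → Φ L = Φ M → L = M ∨ L = -M) :
    IsConvexMap (fun z => Φ (logQuot z)) Ω ∧ deriv (fun z => Φ (logQuot z)) 0 = 2 * Φ₂ := by
  have hq : ∀ z, logQuot z = logMob (z ^ (1 / 2 : ℂ)) := fun z => rfl
  -- The principal root of s² is s or -s. The sign is harmless because `logMob` is odd and Φ even,
  -- so the branch cut of the root disappears.
  have hsq : ∀ s ∈ disk, Φ (logQuot (s ^ 2)) = Φ (logMob s) := by
    intro s hs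
    rcases sq_eq_sq_iff_eq_or_eq_neg.1 (sq_cpow_half (s ^ 2)) with h | h
    · rw [hq, h]
    · rw [hq, h, logMob_neg hs, heven]
  have han : ∀ s ∈ disk, AnalyticAt ℂ (fun z => Φ (logQuot z)) (s ^ 2) := by
    intro s hs
    refine analyticAt_of_comp (p := fun s => s ^ 2) (by fun_prop) ?_ ?_
    · intro h
      have h1 : HasDerivAt (fun s : ℂ => s ^ 2) (2 * s) s := by simpa using hasDerivAt_pow 2 s
      have h2 : (fun z : ℂ => 2 * z) =ᶠ[𝓝 s] fun _ => 0 := by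
        filter_upwards [h.eventually_nhds] with z hz
        have h3 : HasDerivAt (fun s : ℂ => s ^ 2) (2 * z) z := by simpa using hasDerivAt_pow 2 z
        exact h3.unique ((hasDerivAt_const z (s ^ 2)).congr_of_eventuallyEq hz)
      have h4 : HasDerivAt (fun z : ℂ => 2 * z) 2 s := by
        simpa using (hasDerivAt_id s).const_mul (2 : ℂ)
      have := h4.unique ((hasDerivAt_const s (0 : ℂ)).congr_of_eventuallyEq h2)
      norm_num at this
    · have h1 : DifferentiableOn ℂ (fun s => Φ (logMob s)) disk := fun s hs =>
        ((hΦ _).comp s (hasDerivAt_logMob hs)).differentiableAt.differentiableWithinAt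
      refine (h1.analyticAt (isOpen_ball.mem_nhds hs)).congr ?_
      filter_upwards [isOpen_ball.mem_nhds hs] with t ht using (hsq t ht).symm
  have h0d : (0 : ℂ) ∈ disk := mem_ball_self one_pos
  refine ⟨⟨fun z hz => ?_, ⟨fun z hz => ?_, ?_, fun w hw => ?_⟩, hΩ⟩, ?_⟩
  · have := han _ (cpow_half_mem_disk hz)
    rw [sq_cpow_half] at this
    exact this.differentiableAt.differentiableWithinAt
  · exact hmem _ (abs_im_logMob_lt (cpow_half_mem_disk hz))
  · intro z hz w hw h
    have hz' := cpow_half_mem_disk hz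
    have hw' := cpow_half_mem_disk hw
    rw [← sq_cpow_half z, ← sq_cpow_half w]
    rcases hinj _ _ (abs_im_logMob_lt hz') (abs_im_logMob_lt hw') h with h1 | h1
    · rw [logMob_injOn hz' hw' h1]
    · rw [← logMob_neg hw'] at h1
      rw [logMob_injOn hz' (by simpa using hw') h1, neg_sq]
  · obtain ⟨L, hL, rfl⟩ := hsurj w hw
    obtain ⟨s, hs, rfl⟩ := exists_logMob_eq hL
    exact ⟨s ^ 2, sq_mem_disk hs, hsq s hs⟩
  · have hΦ0 : Φ' 0 = 0 := by
      have h1 : HasDerivAt (fun L => Φ (-L)) (Φ' (-0) * -1) 0 := (hΦ _).comp 0 (hasDerivAt_neg 0)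
      have h2 := h1.unique ((hΦ 0).congr_of_eventuallyEq (.of_forall heven))
      rw [neg_zero] at h2
      linear_combination (-1 / 2) * h2
    have hlm0 : logMob 0 = 0 := by simp [logMob]
    -- The squaring map is critical at 0, so second derivatives are compared: that of Φ ∘ `logMob`
    -- is 4Φ₂, since `logMob` has derivative 2 at 0 and Φ'(0) = 0, and that of s² is 2.
    have h1 := deriv_eq_of_comp (P := fun z => Φ (logQuot z)) (p := fun s => s ^ 2) (c := 0)
      (p' := fun s => 2 * s) (p₂ := 2) (e := fun s => Φ (logMob s))
      (e' := fun s => Φ' (logMob s) * (2 / (1 - s ^ 2))) (e₂ := 4 * Φ₂) (han 0 h0d)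
      (.of_forall fun s => by simpa using hasDerivAt_pow 2 s)
      (by filter_upwards [isOpen_ball.mem_nhds h0d] with s hs using
            (hΦ _).comp s (hasDerivAt_logMob hs))
      (by filter_upwards [isOpen_ball.mem_nhds h0d] with s hs using hsq s hs)
      (by simpa using (hasDerivAt_id (0 : ℂ)).const_mul (2 : ℂ)) ?_ (by simp) two_ne_zero
    · simp only [zero_pow two_ne_zero] at h1
      rw [h1]
      ring
    · have h2 : HasDerivAt (fun s => Φ' (logMob s)) (Φ₂ * (2 / (1 - 0 ^ 2))) 0 :=
        HasDerivAt.comp (0 : ℂ) (by rw [hlm0]; exact hΦ') (hasDerivAt_logMob h0d)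
      have h3 : HasDerivAt (fun s : ℂ => 2 / (1 - s ^ 2)) _ 0 :=
        (hasDerivAt_const (0 : ℂ) (2 : ℂ)).div ((hasDerivAt_pow 2 (0 : ℂ)).const_sub 1) (by simp)
      refine (h2.mul h3).congr_deriv ?_
      simp [hlm0, hΦ0]
      ring

end LogQuot

/-! ### The maps `P` for k = 1 and k < 1. -/

theorem mem_Omega {k : ℝ} {w : ℂ} : w ∈ Omega k ↔ k * ‖w - 1‖ < w.re := Iff.rfl

theorem convex_Omega {k : ℝ} (hk : 0 ≤ k) : Convex ℝ (Omega k) := by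
  intro w₁ h1 w₂ h2 a b ha hb hab
  rw [mem_Omega] at h1 h2 ⊢
  have h3 : a • w₁ + b • w₂ - 1 = a • (w₁ - 1) + b • (w₂ - 1) := by
    have : (a : ℂ) + b = 1 := by exact_mod_cast hab
    simp only [Complex.real_smul]
    linear_combination this
  have h4 : ‖a • w₁ + b • w₂ - 1‖ ≤ a * ‖w₁ - 1‖ + b * ‖w₂ - 1‖ := by
    rw [h3]
    refine (norm_add_le _ _).trans (le_of_eq ?_)
    rw [norm_smul, norm_smul, Real.norm_of_nonneg ha, Real.norm_of_nonneg hb]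
  have h5 : (a • w₁ + b • w₂).re = a * w₁.re + b * w₂.re := by simp
  rw [h5]
  have h6 := mul_le_mul_of_nonneg_left h4 hk
  rcases ha.eq_or_lt with h | h
  · subst h
    have : b = 1 := by linarith
    subst this
    linarith
  · nlinarith [mul_lt_mul_of_pos_left h1 h, mul_le_mul_of_nonneg_left h2.le hb]

/-- With c = 2/π² and w = 1 + cL², one has |w - 1| = c |L|² and Re w = 1 + c ((Re L)² - (Im L)²).
Hence w lies in Ω₁ exactly when 2c (Im L)² < 1, that is, |Im L| < π/2. -/
theorem conformal_one (x : ℝ) : IsConvexMap (P 1 x) (Omega 1) ∧ P 1 x 0 = 1 ∧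
    deriv (P 1 x) 0 = (alpha 1 x : ℂ) ∧ 0 < alpha 1 x := by
  have hP : P 1 x = fun z => (fun L : ℂ => 1 + 2 / (Real.pi : ℂ) ^ 2 * L ^ 2) (logQuot z) := by
    funext z
    simp [P]
  have hα : alpha 1 x = 8 / Real.pi ^ 2 := by simp [alpha]
  have hpi : (Real.pi : ℂ) ≠ 0 := by exact_mod_cast Real.pi_ne_zero
  have hc : (0 : ℝ) < 2 / Real.pi ^ 2 := by positivity
  have hcast : 2 / (Real.pi : ℂ) ^ 2 = ((2 / Real.pi ^ 2 : ℝ) : ℂ) := by push_cast; rfl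
  have hiff : ∀ L : ℂ, 1 + 2 / (Real.pi : ℂ) ^ 2 * L ^ 2 ∈ Omega 1 ↔ |L.im| < Real.pi / 2 := by
    intro L
    have h1 : ‖1 + 2 / (Real.pi : ℂ) ^ 2 * L ^ 2 - 1‖ =
        2 / Real.pi ^ 2 * (L.re ^ 2 + L.im ^ 2) := by
      rw [add_sub_cancel_left, hcast, norm_mul, norm_pow, Complex.sq_norm, Complex.normSq_apply,
        Complex.norm_real, Real.norm_of_nonneg hc.le]
      ring
    have h2 : (1 + 2 / (Real.pi : ℂ) ^ 2 * L ^ 2).re =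
        1 + 2 / Real.pi ^ 2 * (L.re ^ 2 - L.im ^ 2) := by
      rw [hcast, Complex.add_re, Complex.re_ofReal_mul, Complex.one_re,
        show (L ^ 2).re = L.re ^ 2 - L.im ^ 2 by rw [pow_two, Complex.mul_re]; ring]
    have h3 : (2 / Real.pi ^ 2) * (Real.pi / 2) ^ 2 * 2 = 1 := by
      field_simp
    rw [mem_Omega, h1, h2, ← abs_of_pos Real.pi_div_two_pos, ← sq_lt_sq]
    constructor <;> intro h <;> nlinarith
  obtain ⟨h1, h2⟩ := isConvexMap_comp_logQuot (Φ := fun L : ℂ => 1 + 2 / (Real.pi : ℂ) ^ 2 * L ^ 2)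
    (Φ' := fun L => 2 / (Real.pi : ℂ) ^ 2 * (2 * L)) (Φ₂ := 2 / (Real.pi : ℂ) ^ 2 * 2)
    (convex_Omega zero_le_one)
    (fun L => by simpa using ((hasDerivAt_pow 2 L).const_mul (2 / (Real.pi : ℂ) ^ 2)).const_add 1)
    (by simpa using ((hasDerivAt_id (0 : ℂ)).const_mul 2).const_mul (2 / (Real.pi : ℂ) ^ 2))
    (fun L => by simp) (fun L hL => (hiff L).2 hL)
    (fun w hw => by
      obtain ⟨L, hL⟩ := IsAlgClosed.exists_pow_nat_eq ((w - 1) / (2 / (Real.pi : ℂ) ^ 2)) two_pos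
      have h : 1 + 2 / (Real.pi : ℂ) ^ 2 * L ^ 2 = w := by
        rw [hL]; field_simp; ring
      exact ⟨L, (hiff L).1 (by rwa [h]), h⟩)
    (fun L M _ _ h => by
      have h' : L ^ 2 = M ^ 2 := by
        have hne : 2 / (Real.pi : ℂ) ^ 2 ≠ 0 := by simp [hpi]
        exact mul_left_cancel₀ hne (add_left_cancel h)
      exact sq_eq_sq_iff_eq_or_eq_neg.1 h')
  rw [hP]
  refine ⟨h1, ?_, ?_, ?_⟩
  · simp [logQuot]
  · rw [h2, hα]
    push_cast
    ring
  · rw [hα]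
    positivity

/-- With ζ = A L, `norm_one_sub_cos` rewrites the inequality of Ω_k as (cosh Re ζ + k)(cos Im ζ - k)
> 0. For |Im ζ| ≤ π this says |Im ζ| < arccos k, and A scales that strip to |Im L| < π/2. -/
theorem conformal_lt_one {k : ℝ} (hk : 0 ≤ k) (hk1 : k < 1) (x : ℝ) :
    IsConvexMap (P k x) (Omega k) ∧ P k x 0 = 1 ∧
    deriv (P k x) 0 = (alpha k x : ℂ) ∧ 0 < alpha k x := by
  have hP : P k x = fun z => (fun L : ℂ => 1 / (1 - (k : ℂ) ^ 2) * cosh ((A k : ℂ) * L) -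
      (k : ℂ) ^ 2 / (1 - (k : ℂ) ^ 2)) (logQuot z) := by
    funext z
    simp [P, hk1]
  have hα : alpha k x = 2 * A k ^ 2 / (1 - k ^ 2) := by simp [alpha, hk1]
  have hk2 : 0 < 1 - k ^ 2 := by nlinarith
  have hk2c : (1 : ℂ) - (k : ℂ) ^ 2 ≠ 0 := by exact_mod_cast hk2.ne'
  have hθ : 0 < Real.arccos k := Real.arccos_pos.2 hk1
  have hθ2 : Real.arccos k ≤ Real.pi / 2 := Real.arccos_le_pi_div_two.2 hk
  have hA : 0 < A k := by unfold A; positivity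
  have hAθ : A k * (Real.pi / 2) = Real.arccos k := by
    unfold A; field_simp
  have hAc : (A k : ℂ) ≠ 0 := by exact_mod_cast hA.ne'
  have hcos : Real.cos (Real.arccos k) = k := Real.cos_arccos (by linarith) hk1.le
  have hstrip : ∀ L : ℂ, |L.im| < Real.pi / 2 ↔ |((A k : ℂ) * L).im| < Real.arccos k := by
    intro L
    rw [Complex.im_ofReal_mul, abs_mul, abs_of_pos hA, ← hAθ, mul_lt_mul_iff_right₀ hA]
  have hiff : ∀ ζ : ℂ, |ζ.im| ≤ Real.pi →
      (1 / (1 - (k : ℂ) ^ 2) * cosh ζ - (k : ℂ) ^ 2 / (1 - (k : ℂ) ^ 2) ∈ Omega k ↔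
        |ζ.im| < Real.arccos k) := by
    intro ζ hζ
    have h0 : cosh ζ = cos (ζ * I) := (Complex.cos_mul_I ζ).symm
    have hre : (ζ * I).re = -ζ.im := by simp
    have him : (ζ * I).im = ζ.re := by simp
    have h1 : 1 / (1 - (k : ℂ) ^ 2) * cosh ζ - (k : ℂ) ^ 2 / (1 - (k : ℂ) ^ 2) - 1 =
        -(((1 - k ^ 2 : ℝ) : ℂ)⁻¹ * (1 - cos (ζ * I))) := by
      rw [h0]; push_cast; field_simp; ring
    have h2 : (1 / (1 - (k : ℂ) ^ 2) * cosh ζ - (k : ℂ) ^ 2 / (1 - (k : ℂ) ^ 2)).re =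
        (1 - k ^ 2)⁻¹ * (Real.cos ζ.im * Real.cosh ζ.re - k ^ 2) := by
      have : 1 / (1 - (k : ℂ) ^ 2) * cosh ζ - (k : ℂ) ^ 2 / (1 - (k : ℂ) ^ 2) =
          (((1 - k ^ 2)⁻¹ : ℝ) : ℂ) * (cos (ζ * I) - ((k ^ 2 : ℝ) : ℂ)) := by
        rw [h0]; push_cast; field_simp
      rw [this, Complex.re_ofReal_mul, Complex.sub_re, cos_re, Complex.ofReal_re, hre, him,
        Real.cos_neg]
    have h3 : (k * ‖1 / (1 - (k : ℂ) ^ 2) * cosh ζ - (k : ℂ) ^ 2 / (1 - (k : ℂ) ^ 2) - 1‖ <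
        (1 / (1 - (k : ℂ) ^ 2) * cosh ζ - (k : ℂ) ^ 2 / (1 - (k : ℂ) ^ 2)).re) ↔
        0 < (Real.cosh ζ.re + k) * (Real.cos ζ.im - k) := by
      rw [h1, h2, norm_neg, norm_mul, norm_one_sub_cos, norm_inv, Complex.norm_real,
        Real.norm_of_nonneg hk2.le, hre, him, Real.cos_neg, mul_left_comm,
        mul_lt_mul_iff_right₀ (inv_pos.2 hk2), ← sub_pos]
      constructor <;> intro h <;> linarith
    have h4 : 0 < Real.cosh ζ.re + k := by linarith [Real.cosh_pos ζ.re]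
    refine h3.trans ((mul_pos_iff_of_pos_left h4).trans ?_)
    rw [sub_pos, ← Real.cos_abs ζ.im]
    conv_lhs => rw [← hcos]
    exact Real.strictAntiOn_cos.lt_iff_gt ⟨hθ.le, by linarith [Real.pi_pos]⟩
      ⟨abs_nonneg _, hζ⟩
  obtain ⟨h1, h2⟩ := isConvexMap_comp_logQuot
    (Φ := fun L : ℂ => 1 / (1 - (k : ℂ) ^ 2) * cosh ((A k : ℂ) * L) -
      (k : ℂ) ^ 2 / (1 - (k : ℂ) ^ 2))
    (Φ' := fun L => 1 / (1 - (k : ℂ) ^ 2) * (sinh ((A k : ℂ) * L) * A k))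
    (Φ₂ := 1 / (1 - (k : ℂ) ^ 2) * (A k * A k)) (convex_Omega hk)
    (fun L => by
      have h : HasDerivAt (fun L : ℂ => (A k : ℂ) * L) (A k) L := by
        simpa using (hasDerivAt_id L).const_mul (A k : ℂ)
      exact ((h.ccosh.const_mul _).sub_const _))
    (by
      have h : HasDerivAt (fun L : ℂ => (A k : ℂ) * L) (A k) 0 := by
        simpa using (hasDerivAt_id (0 : ℂ)).const_mul (A k : ℂ)
      exact ((h.csinh.mul_const (A k : ℂ)).const_mul (1 / (1 - (k : ℂ) ^ 2))).congr_deriv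
        (by simp))
    (fun L => by simp only [mul_neg, Complex.cosh_neg])
    (fun L hL => by
      have := (hstrip L).1 hL
      exact (hiff _ (by linarith [Real.pi_pos])).2 this)
    (fun w hw => by
      obtain ⟨η, hη⟩ := Complex.cos_surjective ((1 - (k : ℂ) ^ 2) * w + k ^ 2)
      -- Periodicity brings the preimage into |Im ζ| ≤ π, the range in which the criterion `hiff`
      -- holds.
      obtain ⟨ζ, hζ, hζπ⟩ : ∃ ζ : ℂ, cosh ζ = (1 - (k : ℂ) ^ 2) * w + k ^ 2 ∧ |ζ.im| ≤ Real.pi := by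
        set m := toIocDiv Real.two_pi_pos (-Real.pi) η.re with hm
        have hmem := sub_toIocDiv_zsmul_mem_Ioc Real.two_pi_pos (-Real.pi) η.re
        refine ⟨(η - m * (2 * Real.pi)) * I, ?_, ?_⟩
        · rw [Complex.cosh_mul_I, Complex.cos_sub_int_mul_two_pi, hη]
        · have : ((η - m * (2 * Real.pi)) * I).im = η.re - m • (2 * Real.pi) := by
            simp
          rw [this, abs_le]
          exact ⟨hmem.1.le, by linarith [hmem.2]⟩
      have h : 1 / (1 - (k : ℂ) ^ 2) * cosh ζ - (k : ℂ) ^ 2 / (1 - (k : ℂ) ^ 2) = w := by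
        rw [hζ]; field_simp; ring
      refine ⟨ζ / A k, ?_, ?_⟩
      · rw [hstrip, mul_div_cancel₀ _ hAc]
        exact (hiff ζ hζπ).1 (by rwa [h])
      · simp only [mul_div_cancel₀ _ hAc, h])
    (fun L M hL hM h => by
      have h3 : cosh ((A k : ℂ) * L) = cosh ((A k : ℂ) * M) := by
        have hne : 1 / (1 - (k : ℂ) ^ 2) ≠ 0 := by simp [hk2c]
        exact mul_left_cancel₀ hne (sub_left_injective h)
      rw [← Complex.cos_mul_I, ← Complex.cos_mul_I, Complex.cos_eq_cos_iff] at h3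
      obtain ⟨n, hn⟩ := h3
      have hL' := abs_lt.1 ((hstrip L).1 hL)
      have hM' := abs_lt.1 ((hstrip M).1 hM)
      -- Both imaginary parts are below arccos k ≤ π/2 in absolute value, so |2nπ| < π.
      have hn0 : n = 0 := by
        have h4 : |(n : ℝ)| < 1 := by
          have hpi := Real.pi_pos
          rcases hn with hn | hn <;> have h5 := congrArg Complex.re hn <;>
            simp only [Complex.mul_I_re, Complex.add_re, Complex.sub_re] at h5 <;>
            rw [show ((2 : ℂ) * n * Real.pi).re = 2 * n * Real.pi by
              rw [show (2 : ℂ) * n * Real.pi = ((2 * n * Real.pi : ℝ) : ℂ) by push_cast; ring,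
                Complex.ofReal_re] ] at h5 <;>
            rw [abs_lt] <;> constructor <;> nlinarith
        have h5 : |n| < 1 := by exact_mod_cast h4
        exact Int.abs_lt_one_iff.1 h5
      subst hn0
      rcases hn with hn | hn
      · left
        have h5 : (A k : ℂ) * M * I = (A k : ℂ) * L * I := by simpa using hn
        exact (mul_left_cancel₀ hAc (mul_right_cancel₀ I_ne_zero h5)).symm
      · right
        have h5 : (A k : ℂ) * M * I = (A k : ℂ) * (-L) * I := by rw [hn]; simp
        rw [mul_left_cancel₀ hAc (mul_right_cancel₀ I_ne_zero h5), neg_neg])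
  rw [hP]
  refine ⟨h1, ?_, ?_, ?_⟩
  · simp [logQuot]
    field_simp
  · rw [h2, hα]
    push_cast
    ring
  · rw [hα]
    positivity

/-! ### Complete elliptic integrals in trigonometric form. -/

section RealIntegrals

theorem one_sub_sq_mul_cos_sq_pos {x : ℝ} (hx : x ∈ Ico (0 : ℝ) 1) (α : ℝ) :
    0 < 1 - x ^ 2 * Real.cos α ^ 2 := by
  have h1 : x ^ 2 < 1 := by nlinarith [hx.1, hx.2]
  nlinarith [Real.cos_sq_le_one α, sq_nonneg (Real.cos α), sq_nonneg x]

/-- Legendre's form of the incomplete elliptic integral, counted from the end. -/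
noncomputable def legJ (x φ : ℝ) : ℝ := ∫ α in (0 : ℝ)..φ, 1 / Real.sqrt (1 - x ^ 2 * Real.cos α ^ 2)

theorem continuous_legJ_integrand {x : ℝ} (hx : x ∈ Ico (0 : ℝ) 1) :
    Continuous fun α : ℝ => 1 / Real.sqrt (1 - x ^ 2 * Real.cos α ^ 2) :=
  continuous_const.div (by fun_prop) fun α =>
    (Real.sqrt_pos.2 (one_sub_sq_mul_cos_sq_pos hx α)).ne'

theorem hasDerivAt_legJ {x : ℝ} (hx : x ∈ Ico (0 : ℝ) 1) (φ : ℝ) :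
    HasDerivAt (legJ x) (1 / Real.sqrt (1 - x ^ 2 * Real.cos φ ^ 2)) φ :=
  (continuous_legJ_integrand hx).integral_hasStrictDerivAt 0 φ |>.hasDerivAt

/-- The fundamental theorem of calculus for a nonnegative derivative with endpoint
singularities. -/
theorem integral_eq_sub_of_nonneg {a b : ℝ} (hab : a ≤ b) {G g : ℝ → ℝ}
    (hc : ContinuousOn G (Icc a b)) (hd : ∀ t ∈ Ioo a b, HasDerivAt G (g t) t)
    (hg : ∀ t ∈ Ioo a b, 0 ≤ g t) :
    IntervalIntegrable g volume a b ∧ ∫ t in a..b, g t = G b - G a := by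
  have hi : IntervalIntegrable g volume a b := by
    refine intervalIntegral.intervalIntegrable_deriv_of_nonneg (g := G) ?_ ?_ ?_
    · rwa [uIcc_of_le hab]
    · rwa [min_eq_left hab, max_eq_right hab]
    · rwa [min_eq_left hab, max_eq_right hab]
  exact ⟨hi, intervalIntegral.integral_eq_sub_of_hasDerivAt_of_le hab hc hd hi⟩

/-- The substitution t = cos α removes the singularity at t = 1. As the integrand is nonnegative,
integrability comes together with the value. -/
theorem ellK_eq_legJ {x : ℝ} (hx : x ∈ Ico (0 : ℝ) 1) :
    IntervalIntegrable (fun t => 1 / Real.sqrt ((1 - t ^ 2) * (1 - x ^ 2 * t ^ 2))) volume 0 1 ∧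
      ellK x = legJ x (Real.pi / 2) := by
  obtain ⟨h1, h2⟩ := integral_eq_sub_of_nonneg (a := 0) (b := 1) zero_le_one
    (G := fun t => -legJ x (Real.arccos t))
    (g := fun t => 1 / Real.sqrt ((1 - t ^ 2) * (1 - x ^ 2 * t ^ 2)))
    (by
      have : Continuous (legJ x) :=
        continuous_iff_continuousAt.2 fun φ => (hasDerivAt_legJ hx φ).continuousAt
      exact (this.comp Real.continuous_arccos).neg.continuousOn)
    (fun t ht => by
      have h1 := (hasDerivAt_legJ hx (Real.arccos t)).comp t
        (Real.hasDerivAt_arccos (by linarith [ht.1]) ht.2.ne)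
      refine h1.neg.congr_deriv ?_
      have h3 : 0 ≤ 1 - t ^ 2 := by nlinarith [ht.1, ht.2]
      rw [Real.cos_arccos (by linarith [ht.1]) ht.2.le, Real.sqrt_mul h3]
      field_simp)
    (fun t _ => by positivity)
  refine ⟨h1, ?_⟩
  rw [ellK, h2]
  simp [legJ]

theorem ellK_pos {x : ℝ} (hx : x ∈ Ico (0 : ℝ) 1) : 0 < ellK x := by
  rw [(ellK_eq_legJ hx).2, legJ]
  refine intervalIntegral.intervalIntegral_pos_of_pos
    ((continuous_legJ_integrand hx).intervalIntegrable _ _) (fun α => ?_) Real.pi_div_two_pos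
  exact one_div_pos.2 (Real.sqrt_pos.2 (one_sub_sq_mul_cos_sq_pos hx α))

theorem cos_sq_add_sq_mul_sin_sq_pos {x : ℝ} (hx : 0 < x) (φ : ℝ) :
    0 < Real.cos φ ^ 2 + x ^ 2 * Real.sin φ ^ 2 := by
  rcases eq_or_ne (Real.cos φ) 0 with h | h
  · have : Real.sin φ ^ 2 = 1 := by have := Real.sin_sq_add_cos_sq φ; rw [h] at this; linarith
    rw [h, this]; positivity
  · positivity

/-- The incomplete integral for the complementary modulus. -/
noncomputable def legE (x φ : ℝ) : ℝ :=
  ∫ α in (0 : ℝ)..φ, 1 / Real.sqrt (Real.cos α ^ 2 + x ^ 2 * Real.sin α ^ 2)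

theorem hasDerivAt_legE {x : ℝ} (hx : 0 < x) (φ : ℝ) :
    HasDerivAt (legE x) (1 / Real.sqrt (Real.cos φ ^ 2 + x ^ 2 * Real.sin φ ^ 2)) φ := by
  have : Continuous fun α : ℝ => 1 / Real.sqrt (Real.cos α ^ 2 + x ^ 2 * Real.sin α ^ 2) :=
    continuous_const.div (by fun_prop) fun α =>
      (Real.sqrt_pos.2 (cos_sq_add_sq_mul_sin_sq_pos hx α)).ne'
  exact (this.integral_hasStrictDerivAt 0 φ).hasDerivAt

theorem sqrt_one_sub_sq_mem {x : ℝ} (hx : x ∈ Ioo (0 : ℝ) 1) :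
    Real.sqrt (1 - x ^ 2) ∈ Ioo (0 : ℝ) 1 := by
  have h1 : x ^ 2 < 1 := by nlinarith [hx.1, hx.2]
  refine ⟨Real.sqrt_pos.2 (by linarith), ?_⟩
  rw [Real.sqrt_lt' one_pos]
  nlinarith [hx.1]

theorem ellK_compl_eq_legE {x : ℝ} (hx : x ∈ Ioo (0 : ℝ) 1) :
    ellK (Real.sqrt (1 - x ^ 2)) = legE x (Real.pi / 2) := by
  have h1 : x ^ 2 < 1 := by nlinarith [hx.1, hx.2]
  have h2 := intervalIntegral.integral_comp_sub_left (a := 0) (b := Real.pi / 2)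
    (fun α => 1 / Real.sqrt (Real.cos α ^ 2 + x ^ 2 * Real.sin α ^ 2)) (Real.pi / 2)
  simp only [Real.cos_pi_div_two_sub, Real.sin_pi_div_two_sub, sub_self, sub_zero] at h2
  rw [(ellK_eq_legJ (Ioo_subset_Ico_self (sqrt_one_sub_sq_mem hx))).2, legJ, legE, ← h2]
  refine intervalIntegral.integral_congr fun α _ => ?_
  rw [Real.sq_sqrt (by linarith), Real.sin_sq α]
  ring_nf

/-- The complementary incomplete integral takes half of its final value at `arctan (1 / √x)`. -/
theorem legE_arctan {x : ℝ} (hx : x ∈ Ioo (0 : ℝ) 1) :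
    legE x (Real.arctan (1 / Real.sqrt x)) = ellK (Real.sqrt (1 - x ^ 2)) / 2 := by
  have hx0 := hx.1
  -- A case of the addition theorem: this sum is constant in t. At t = 0 it is the complete
  -- integral, and at t = 1/√x its two terms coincide.
  have hd : ∀ t, HasDerivAt
      (fun t => legE x (Real.arctan t) + legE x (Real.pi / 2 - Real.arctan (x * t))) 0 t := by
    intro t
    have h1 := (hasDerivAt_legE hx0 (Real.arctan t)).comp t (Real.hasDerivAt_arctan t)
    have h2 : HasDerivAt (fun t => x * t) x t := by simpa using (hasDerivAt_id t).const_mul x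
    have h3 := (hasDerivAt_legE hx0 (Real.pi / 2 - Real.arctan (x * t))).comp t
      (h2.arctan.const_sub (Real.pi / 2))
    refine (h1.add h3).congr_deriv ?_
    have p1 : 0 < 1 + t ^ 2 := by positivity
    have p2 : 0 < 1 + (x * t) ^ 2 := by positivity
    rw [Real.cos_pi_div_two_sub, Real.sin_pi_div_two_sub, Real.cos_sq_arctan, Real.cos_sq_arctan,
      Real.sin_sq_arctan, Real.sin_sq_arctan]
    have e1 : 1 / (1 + t ^ 2) + x ^ 2 * (t ^ 2 / (1 + t ^ 2)) =
      (1 + (x * t) ^ 2) / (1 + t ^ 2) := by field_simp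
    have e2 : (x * t) ^ 2 / (1 + (x * t) ^ 2) + x ^ 2 * (1 / (1 + (x * t) ^ 2)) =
      x ^ 2 * ((1 + t ^ 2) / (1 + (x * t) ^ 2)) := by field_simp; ring
    rw [e1, e2, Real.sqrt_mul (by positivity), Real.sqrt_sq hx0.le, Real.sqrt_div p2.le,
      Real.sqrt_div p1.le]
    have s1 := Real.sq_sqrt p1.le
    have s2 := Real.sq_sqrt p2.le
    have q1 := Real.sqrt_pos.2 p1
    have q2 := Real.sqrt_pos.2 p2
    set r1 := Real.sqrt (1 + t ^ 2)
    set r2 := Real.sqrt (1 + (x * t) ^ 2)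
    rw [← s1, ← s2]
    field_simp
    ring
  have hconst := is_const_of_deriv_eq_zero (fun t => (hd t).differentiableAt)
    (fun t => (hd t).deriv) (1 / Real.sqrt x) 0
  have hs := Real.sqrt_pos.2 hx0
  have e : x * (1 / Real.sqrt x) = Real.sqrt x := by
    rw [mul_one_div, Real.div_sqrt]
  have h2 : Real.pi / 2 - Real.arctan (Real.sqrt x) = Real.arctan (1 / Real.sqrt x) := by
    rw [one_div, Real.arctan_inv_of_pos hs]
  simp only [e, h2, mul_zero, Real.arctan_zero, sub_zero] at hconst
  rw [← ellK_compl_eq_legE hx] at hconst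
  have : legE x 0 = 0 := by simp [legE]
  linarith

end RealIntegrals

/-! ### Existence and uniqueness of the modulus. -/

section Modulus

theorem ellK_strictMonoOn : StrictMonoOn ellK (Ico 0 1) := by
  intro x hx y hy hxy
  rw [(ellK_eq_legJ hx).2, (ellK_eq_legJ hy).2, legJ, legJ]
  have hxy2 : x ^ 2 < y ^ 2 := by nlinarith [hx.1]
  refine intervalIntegral.integral_lt_integral_of_continuousOn_of_le_of_exists_lt
    Real.pi_div_two_pos (continuous_legJ_integrand hx).continuousOn
    (continuous_legJ_integrand hy).continuousOn (fun α _ => ?_)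
    ⟨0, ⟨le_rfl, Real.pi_div_two_pos.le⟩, ?_⟩
  · refine one_div_le_one_div_of_le (Real.sqrt_pos.2 (one_sub_sq_mul_cos_sq_pos hy α))
      (Real.sqrt_le_sqrt ?_)
    nlinarith [sq_nonneg (Real.cos α)]
  · refine one_div_lt_one_div_of_lt (Real.sqrt_pos.2 (one_sub_sq_mul_cos_sq_pos hy 0))
      (Real.sqrt_lt_sqrt (one_sub_sq_mul_cos_sq_pos hy 0).le ?_)
    simp [hxy2]

theorem ellK_continuousOn : ContinuousOn ellK (Ico 0 1) := by
  rw [continuousOn_iff_continuous_domRestrict]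
  have h1 : (Ico (0 : ℝ) 1).domRestrict ellK = fun x : Ico (0 : ℝ) 1 =>
      ∫ α in (0 : ℝ)..(Real.pi / 2), 1 / Real.sqrt (1 - (x : ℝ) ^ 2 * Real.cos α ^ 2) := by
    funext x
    exact (ellK_eq_legJ x.2).2
  rw [h1]
  refine intervalIntegral.continuous_parametric_intervalIntegral_of_continuous' ?_ _ _
  exact continuous_const.div (by fun_prop) fun p =>
    (Real.sqrt_pos.2 (one_sub_sq_mul_cos_sq_pos p.1.2 p.2)).ne'

/-- For the modulus √(1 - δ²) the radicand is sin²α + δ² cos²α ≤ (α + δ)², so K is at least the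
integral of 1/(α + δ), which is at least -log δ = |M| + 1. -/
theorem exists_lt_ellK (M : ℝ) : ∃ y ∈ Ioo (0 : ℝ) 1, M < ellK y := by
  set δ := Real.exp (-(|M| + 1)) with hδ
  have hδ0 : 0 < δ := Real.exp_pos _
  have hδ1 : δ < 1 := Real.exp_lt_one_iff.2 (by linarith [abs_nonneg M])
  have hy := sqrt_one_sub_sq_mem ⟨hδ0, hδ1⟩
  refine ⟨_, hy, ?_⟩
  have hle : ∫ α in (0 : ℝ)..(Real.pi / 2), 1 / (α + δ) ≤ ellK (Real.sqrt (1 - δ ^ 2)) := by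
    rw [(ellK_eq_legJ (Ioo_subset_Ico_self hy)).2, legJ]
    refine intervalIntegral.integral_mono_on Real.pi_div_two_pos.le ?_
      ((continuous_legJ_integrand (Ioo_subset_Ico_self hy)).intervalIntegrable _ _) fun α hα => ?_
    · refine ContinuousOn.intervalIntegrable (continuousOn_const.div (by fun_prop) fun α hα => ?_)
      rw [uIcc_of_le Real.pi_div_two_pos.le] at hα
      linarith [hα.1]
    · have h1 := one_sub_sq_mul_cos_sq_pos (Ioo_subset_Ico_self hy) α
      refine one_div_le_one_div_of_le (Real.sqrt_pos.2 h1) ?_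
      rw [Real.sqrt_le_left (by linarith [hα.1]), Real.sq_sqrt (by nlinarith), Real.cos_sq']
      have h2 : Real.sin α ^ 2 ≤ α ^ 2 := by
        have h3 := Real.sin_le hα.1
        have h4 := Real.sin_nonneg_of_mem_Icc ⟨hα.1, by linarith [hα.2, Real.pi_pos]⟩
        nlinarith
      nlinarith [hα.1, sq_nonneg (Real.sin α), sq_nonneg δ, mul_nonneg hα.1 hδ0.le,
        mul_nonneg (sq_nonneg (Real.sin α)) (sq_nonneg δ)]
  have hint : ∫ α in (0 : ℝ)..(Real.pi / 2), 1 / (α + δ) =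
      Real.log (Real.pi / 2 + δ) - Real.log (0 + δ) := by
    refine intervalIntegral.integral_eq_sub_of_hasDerivAt
      (f := fun α => Real.log (α + δ)) (fun α hα => ?_) ?_
    · rw [uIcc_of_le Real.pi_div_two_pos.le] at hα
      exact ((hasDerivAt_id α).add_const δ).log (by simp only [id]; linarith [hα.1])
    · refine ContinuousOn.intervalIntegrable (continuousOn_const.div (by fun_prop) fun α hα => ?_)
      rw [uIcc_of_le Real.pi_div_two_pos.le] at hα
      linarith [hα.1]
  rw [hint, zero_add, hδ, Real.log_exp, ← hδ] at hle
  have : 0 ≤ Real.log (Real.pi / 2 + δ) := Real.log_nonneg (by linarith [Real.pi_gt_three])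
  linarith [le_abs_self M]

theorem exists_lt_ellK' (M a : ℝ) (ha : a ∈ Ioo (0 : ℝ) 1) :
    ∃ y ∈ Ioo (0 : ℝ) 1, a ≤ y ∧ M < ellK y := by
  obtain ⟨y, hy, h⟩ := exists_lt_ellK M
  have hm : max a y ∈ Ioo (0 : ℝ) 1 := ⟨lt_max_of_lt_left ha.1, max_lt ha.2 hy.2⟩
  exact ⟨max a y, hm, le_max_left _ _, h.trans_le (ellK_strictMonoOn.monotoneOn
    (Ioo_subset_Ico_self hy) (Ioo_subset_Ico_self hm) (le_max_right _ _))⟩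

theorem sqrt_one_sub_sq_sqrt {x : ℝ} (hx : x ∈ Ioo (0 : ℝ) 1) :
    Real.sqrt (1 - Real.sqrt (1 - x ^ 2) ^ 2) = x := by
  rw [Real.sq_sqrt (by nlinarith [hx.1, hx.2]), sub_sub_cancel, Real.sqrt_sq hx.1.le]

/-- The function h = πK'/(4K) is continuous and strictly decreasing on (0, 1) and takes every
positive value, in particular arcosh k. -/
theorem existsUnique_modulus {k : ℝ} (hk : 1 < k) : ∃! x : ℝ, IsModulus k x := by
  have hcompl : ∀ x ∈ Ioo (0 : ℝ) 1, Real.sqrt (1 - x ^ 2) ∈ Ico (0 : ℝ) 1 := fun x hx =>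
    Ioo_subset_Ico_self (sqrt_one_sub_sq_mem hx)
  have hpos : ∀ x ∈ Ioo (0 : ℝ) 1, 0 < ellK x := fun x hx => ellK_pos (Ioo_subset_Ico_self hx)
  have hpos' : ∀ x ∈ Ioo (0 : ℝ) 1, 0 < ellK (Real.sqrt (1 - x ^ 2)) := fun x hx =>
    ellK_pos (hcompl x hx)
  set h : ℝ → ℝ := fun x => Real.pi * ellK (Real.sqrt (1 - x ^ 2)) / (4 * ellK x) with hh
  have hhpos : ∀ x ∈ Ioo (0 : ℝ) 1, 0 < h x := fun x hx =>
    div_pos (mul_pos Real.pi_pos (hpos' x hx)) (mul_pos four_pos (hpos x hx))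
  have hanti : StrictAntiOn h (Ioo 0 1) := by
    intro x hx y hy hxy
    have h1 := ellK_strictMonoOn (Ioo_subset_Ico_self hx) (Ioo_subset_Ico_self hy) hxy
    have h2 := ellK_strictMonoOn (hcompl y hy) (hcompl x hx)
      (Real.sqrt_lt_sqrt (by nlinarith [hy.1, hy.2]) (by nlinarith [hx.1]))
    simp only [hh]
    rw [div_lt_div_iff₀ (by linarith [hpos y hy]) (by linarith [hpos x hx])]
    have h3 : ellK (Real.sqrt (1 - y ^ 2)) * ellK x < ellK (Real.sqrt (1 - x ^ 2)) * ellK y :=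
      mul_lt_mul'' h2 h1 (hpos' y hy).le (hpos x hx).le
    nlinarith [Real.pi_pos]
  have hcont : ContinuousOn h (Ioo 0 1) := by
    have h1 : ContinuousOn (fun x => ellK (Real.sqrt (1 - x ^ 2))) (Ioo 0 1) :=
      ellK_continuousOn.comp (by fun_prop) hcompl
    have h2 : ContinuousOn ellK (Ioo 0 1) := ellK_continuousOn.mono Ioo_subset_Ico_self
    exact (continuousOn_const.mul h1).div (continuousOn_const.mul h2) fun x hx =>
      (mul_pos four_pos (hpos x hx)).ne'
  have hsurj : ∀ T, 0 < T → ∃ x ∈ Ioo (0 : ℝ) 1, h x = T := by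
    intro T hT
    -- This modulus is its own complement. For y ≥ a the complementary integral is at most K(a), so
    -- making K(y) large makes h(y) small and h(√(1 - y²)) large.
    set a := Real.sqrt (1 / 2) with hadef
    have ha2 : a ^ 2 = 1 / 2 := Real.sq_sqrt (by norm_num)
    have ha : a ∈ Ioo (0 : ℝ) 1 := by
      have : 0 < a := Real.sqrt_pos.2 (by norm_num)
      exact ⟨this, by nlinarith⟩
    have hle : ∀ y ∈ Ioo (0 : ℝ) 1, a ≤ y → ellK (Real.sqrt (1 - y ^ 2)) ≤ ellK a := by
      intro y hy hay
      refine ellK_strictMonoOn.monotoneOn (hcompl y hy) (Ioo_subset_Ico_self ha) ?_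
      exact Real.sqrt_le_sqrt (by nlinarith [ha.1])
    have hKa := hpos a ha
    have hpi := Real.pi_pos
    obtain ⟨y, hy, hay, hyK⟩ := exists_lt_ellK' (Real.pi * ellK a / (4 * T)) a ha
    obtain ⟨z, hz, haz, hzK⟩ := exists_lt_ellK' (4 * T * ellK a / Real.pi) a ha
    have hy1 : h y ≤ T := by
      simp only [hh]
      rw [div_lt_iff₀ (by linarith)] at hyK
      rw [div_le_iff₀ (by linarith [hpos y hy])]
      nlinarith [hle y hy hay]
    have hz1 : T ≤ h (Real.sqrt (1 - z ^ 2)) := by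
      simp only [hh]
      rw [sqrt_one_sub_sq_sqrt hz, le_div_iff₀ (by linarith [hpos' z hz])]
      rw [div_lt_iff₀ hpi] at hzK
      nlinarith [hle z hz haz]
    obtain ⟨x, hx, hxT⟩ := isPreconnected_Ioo.intermediate_value hy (sqrt_one_sub_sq_mem hz) hcont
      ⟨hy1, hz1⟩
    exact ⟨x, hx, hxT⟩
  obtain ⟨x, hx, hxk⟩ := hsurj (Real.arcosh k) (Real.arcosh_pos hk)
  refine ⟨x, ⟨hx.1, hx.2, ?_⟩, fun y hy => ?_⟩
  · change k = Real.cosh (h x)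
    rw [hxk, Real.cosh_arcosh hk.le]
  · have hy' : y ∈ Ioo (0 : ℝ) 1 := ⟨hy.1, hy.2.1⟩
    refine hanti.injOn hy' hx ?_
    have h1 : k = Real.cosh (h y) := hy.2.2
    rw [hxk, h1, Real.arcosh_cosh (hhpos y hy').le]

end Modulus

/-! ### The elliptic integral as a function of χ, where v = cos χ. -/

section EllipticAmplitude

theorem normSq_cos (χ : ℂ) : normSq (cos χ) = Real.cos χ.re ^ 2 + Real.sinh χ.im ^ 2 := by
  rw [Complex.normSq_apply, cos_re, cos_im]
  linear_combination Real.cos χ.re ^ 2 * Real.cosh_sq χ.im +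
    Real.sinh χ.im ^ 2 * Real.sin_sq_add_cos_sq χ.re

theorem cos_sq_re (χ : ℂ) : (cos χ ^ 2).re =
    Real.cos χ.re ^ 2 * Real.cosh χ.im ^ 2 - Real.sin χ.re ^ 2 * Real.sinh χ.im ^ 2 := by
  rw [pow_two, Complex.mul_re, cos_re, cos_im]
  ring

theorem cos_sq_im (χ : ℂ) : (cos χ ^ 2).im =
    -(2 * (Real.cos χ.re * Real.cosh χ.im) * (Real.sin χ.re * Real.sinh χ.im)) := by
  rw [pow_two, Complex.mul_im, cos_re, cos_im]
  ring

theorem ofReal_cpow_half {r : ℝ} (hr : 0 ≤ r) : (r : ℂ) ^ (1 / 2 : ℂ) = (Real.sqrt r : ℂ) := by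
  rw [Real.sqrt_eq_rpow, Complex.ofReal_cpow hr]
  norm_num

theorem neg_ofReal_cpow_half {r : ℝ} (hr : 0 ≤ r) :
    (-(r : ℂ)) ^ (1 / 2 : ℂ) = I * (Real.sqrt r : ℂ) := by
  have h := Complex.ofReal_cpow_of_nonpos (x := -r) (by linarith) (1 / 2 : ℂ)
  rw [Complex.ofReal_neg, neg_neg] at h
  rw [h, ofReal_cpow_half hr, show (Real.pi : ℂ) * I * (1 / 2) = Real.pi / 2 * I by ring,
    Complex.exp_pi_div_two_mul_I, mul_comm]

theorem cpow_half_ne_zero {z : ℂ} (hz : z ≠ 0) : z ^ (1 / 2 : ℂ) ≠ 0 := fun h => hz (by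
  rw [← sq_cpow_half z, h]; simp)

theorem conj_cpow_half {z : ℂ} (hz : z ∈ slitPlane) :
    (starRingEnd ℂ z) ^ (1 / 2 : ℂ) = starRingEnd ℂ (z ^ (1 / 2 : ℂ)) := by
  rw [Complex.conj_cpow z _ (Complex.slitPlane_arg_ne_pi hz), map_div₀, map_one, map_ofNat]

theorem differentiableAt_inv_cpow_half {f : ℂ → ℂ} {z : ℂ} (hf : DifferentiableAt ℂ f z)
    (hz : f z ∈ slitPlane) : DifferentiableAt ℂ (fun z => 1 / (f z) ^ (1 / 2 : ℂ)) z :=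
  (differentiableAt_const 1).div (hf.cpow (differentiableAt_const _) hz)
    (cpow_half_ne_zero (Complex.slitPlane_ne_zero hz))

theorem segIntegral_ofReal (F : ℂ → ℂ) (r : ℝ) :
    segIntegral F r = ∫ s in (0 : ℝ)..r, F s := by
  have h := intervalIntegral.smul_integral_comp_mul_right (a := 0) (b := 1)
    (fun s : ℝ => F s) r
  rw [segIntegral, intervalIntegral.integral_mul_const, mul_comm]
  simpa using h

/-- The integrand `1 / √(1 - x² cos² χ)`. -/
noncomputable def ampD (x : ℝ) (χ : ℂ) : ℂ := 1 / (1 - (x : ℂ) ^ 2 * cos χ ^ 2) ^ (1 / 2 : ℂ)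

/-- The elliptic integral in trigonometric form, as a function on a slit strip. -/
noncomputable def amp (x : ℝ) (χ : ℂ) : ℂ := segIntegral (ampD x) χ

/-- The slit strip on which `amp` is holomorphic. -/
def slitStrip (x : ℝ) : Set ℂ := {χ | |χ.re| < Real.pi ∧ (χ.re ≠ 0 ∨ x * Real.cosh χ.im < 1)}

variable {x : ℝ}

theorem isOpen_slitStrip : IsOpen (slitStrip x) := by
  refine IsOpen.inter (isOpen_lt Complex.continuous_re.abs continuous_const)
    (IsOpen.union ?_ ?_)
  · exact isOpen_ne_fun Complex.continuous_re continuous_const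
  · exact isOpen_lt (continuous_const.mul (Real.continuous_cosh.comp Complex.continuous_im))
      continuous_const

theorem starConvex_slitStrip (hx : x ∈ Ioo (0 : ℝ) 1) : StarConvex ℝ 0 (slitStrip x) := by
  rw [starConvex_zero_iff]
  rintro χ ⟨h1, h2⟩ t ht0 ht1
  have e1 : (t • χ).re = t * χ.re := by simp
  have e2 : (t • χ).im = t * χ.im := by simp
  refine ⟨?_, ?_⟩
  · rw [e1, abs_mul, abs_of_nonneg ht0]
    nlinarith [abs_nonneg χ.re]
  · rw [e1, e2]
    rcases ht0.eq_or_lt with rfl | ht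
    · right; simpa using hx.2
    · rcases h2 with h2 | h2
      · exact .inl (mul_ne_zero ht.ne' h2)
      · right
        refine lt_of_le_of_lt (mul_le_mul_of_nonneg_left (Real.cosh_le_cosh.2 ?_) hx.1.le) h2
        rw [abs_mul, abs_of_nonneg ht0]
        nlinarith [abs_nonneg χ.im]

theorem ampD_base_re (χ : ℂ) : (1 - (x : ℂ) ^ 2 * cos χ ^ 2).re = 1 - x ^ 2 *
    (Real.cos χ.re ^ 2 * Real.cosh χ.im ^ 2 - Real.sin χ.re ^ 2 * Real.sinh χ.im ^ 2) := by
  rw [← cos_sq_re, Complex.sub_re, ← Complex.ofReal_pow, Complex.re_ofReal_mul, Complex.one_re]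

theorem ampD_base_im (χ : ℂ) : (1 - (x : ℂ) ^ 2 * cos χ ^ 2).im = x ^ 2 *
    (2 * (Real.cos χ.re * Real.cosh χ.im) * (Real.sin χ.re * Real.sinh χ.im)) := by
  rw [Complex.sub_im, ← Complex.ofReal_pow, Complex.im_ofReal_mul, Complex.one_im, cos_sq_im]
  ring

/-- If the imaginary part vanishes, then cos Re χ, sin Re χ or sinh Im χ is zero. In each case the
real part is positive; the condition x cosh(Im χ) < 1 is what handles Re χ = 0. -/
theorem ampD_base_mem_slitPlane (hx : x ∈ Ioo (0 : ℝ) 1) {χ : ℂ} (hχ : χ ∈ slitStrip x) :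
    1 - (x : ℂ) ^ 2 * cos χ ^ 2 ∈ slitPlane := by
  rw [Complex.mem_slitPlane_iff]
  by_contra! h
  obtain ⟨h1, h2⟩ := h
  obtain ⟨hχ1, hχ2⟩ := hχ
  have hb := one_sub_sq_mul_cos_sq_pos (Ioo_subset_Ico_self hx) χ.re
  have hcosh := Real.cosh_sq χ.im
  rw [ampD_base_re] at h1
  have hx2 : x ^ 2 ≠ 0 := pow_ne_zero _ hx.1.ne'
  rw [ampD_base_im] at h2
  have h3 : Real.cos χ.re * Real.cosh χ.im = 0 ∨ Real.sin χ.re * Real.sinh χ.im = 0 := by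
    simpa [hx2, (Real.cosh_pos χ.im).ne'] using h2
  rcases h3 with h3 | h3
  · have : Real.cos χ.re = 0 := by simpa [(Real.cosh_pos χ.im).ne'] using h3
    rw [this] at h1
    have : 0 ≤ x ^ 2 * (Real.sin χ.re ^ 2 * Real.sinh χ.im ^ 2) := by positivity
    linarith
  · rcases mul_eq_zero.1 h3 with h4 | h4
    · have hre : χ.re = 0 := by
        obtain ⟨h5, h6⟩ := abs_lt.1 hχ1
        rwa [Real.sin_eq_zero_iff_of_lt_of_lt h5 h6] at h4
      have h5 : x * Real.cosh χ.im < 1 := hχ2.resolve_left fun h => h hre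
      rw [h4, hre, Real.cos_zero] at h1
      have : 0 < x * Real.cosh χ.im := mul_pos hx.1 (Real.cosh_pos _)
      nlinarith
    · rw [h4] at h1 hcosh
      rw [hcosh] at h1
      linarith

theorem hasDerivAt_amp (hx : x ∈ Ioo (0 : ℝ) 1) {χ : ℂ} (hχ : χ ∈ slitStrip x) :
    HasDerivAt (amp x) (ampD x χ) χ :=
  hasDerivAt_segIntegral isOpen_slitStrip (starConvex_slitStrip hx)
    (fun χ hχ => (differentiableAt_inv_cpow_half
      (f := fun χ => 1 - (x : ℂ) ^ 2 * cos χ ^ 2) (by fun_prop)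
      (ampD_base_mem_slitPlane hx hχ)).differentiableWithinAt) hχ

theorem ampD_neg (χ : ℂ) : ampD x (-χ) = ampD x χ := by simp [ampD]

theorem amp_neg (χ : ℂ) : amp x (-χ) = -amp x χ := by
  simp only [amp, segIntegral, mul_neg, ampD_neg, intervalIntegral.integral_neg]

theorem ampD_conj (hx : x ∈ Ioo (0 : ℝ) 1) {χ : ℂ} (hχ : χ ∈ slitStrip x) :
    ampD x (starRingEnd ℂ χ) = starRingEnd ℂ (ampD x χ) := by
  have : 1 - (x : ℂ) ^ 2 * cos (starRingEnd ℂ χ) ^ 2 =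
      starRingEnd ℂ (1 - (x : ℂ) ^ 2 * cos χ ^ 2) := by
    rw [Complex.cos_conj]
    simp
  rw [ampD, this, conj_cpow_half (ampD_base_mem_slitPlane hx hχ), ampD]
  simp

theorem amp_conj (hx : x ∈ Ioo (0 : ℝ) 1) {χ : ℂ} (hχ : χ ∈ slitStrip x) :
    amp x (starRingEnd ℂ χ) = starRingEnd ℂ (amp x χ) := by
  rw [amp, segIntegral, amp, segIntegral, ← intervalIntegral.intervalIntegral_conj]
  refine intervalIntegral.integral_congr fun t ht => ?_
  rw [uIcc_of_le zero_le_one] at ht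
  have hmem : (t : ℂ) * χ ∈ slitStrip x := by
    simpa using (starConvex_slitStrip hx) hχ (sub_nonneg.2 ht.2) ht.1 (by ring)
  have := ampD_conj hx hmem
  simp only [map_mul, Complex.conj_ofReal] at this ⊢
  rw [this]

/-- `amp` is odd and commutes with conjugation, so it preserves the imaginary axis inside the strip.
-/
theorem amp_im_mul_I (hx : x ∈ Ioo (0 : ℝ) 1) {b : ℝ} (hb : x * Real.cosh b < 1) :
    (amp x (b * I)).re = 0 := by
  have hmem : (b : ℂ) * I ∈ slitStrip x := by
    refine ⟨by simpa using Real.pi_pos, .inr (by simpa using hb)⟩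
  have h1 := amp_conj hx hmem
  rw [map_mul, Complex.conj_ofReal, Complex.conj_I, mul_neg, amp_neg] at h1
  have := congrArg Complex.re h1
  simp only [Complex.neg_re, Complex.conj_re] at this
  linarith

theorem ampD_ofReal (hx : x ∈ Ioo (0 : ℝ) 1) (α : ℝ) :
    ampD x α = ((1 / Real.sqrt (1 - x ^ 2 * Real.cos α ^ 2) : ℝ) : ℂ) := by
  have h : 1 - (x : ℂ) ^ 2 * cos α ^ 2 = ((1 - x ^ 2 * Real.cos α ^ 2 : ℝ) : ℂ) := by
    push_cast; rfl
  rw [ampD, h, ofReal_cpow_half (one_sub_sq_mul_cos_sq_pos (Ioo_subset_Ico_self hx) α).le]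
  push_cast
  rfl

theorem ampD_mul_I (b : ℝ) (hb : x ^ 2 * Real.cosh b ^ 2 ≤ 1) :
    ampD x (b * I) = ((1 / Real.sqrt (1 - x ^ 2 * Real.cosh b ^ 2) : ℝ) : ℂ) := by
  have h : 1 - (x : ℂ) ^ 2 * cos (b * I) ^ 2 = ((1 - x ^ 2 * Real.cosh b ^ 2 : ℝ) : ℂ) := by
    rw [Complex.cos_mul_I]; push_cast; rfl
  rw [ampD, h, ofReal_cpow_half (by linarith)]
  push_cast
  rfl

theorem amp_pi_div_two (hx : x ∈ Ioo (0 : ℝ) 1) : amp x ((Real.pi / 2 : ℝ) : ℂ) = ellK x := by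
  rw [amp, segIntegral_ofReal, (ellK_eq_legJ (Ioo_subset_Ico_self hx)).2, legJ,
    ← intervalIntegral.integral_ofReal]
  exact intervalIntegral.integral_congr fun α _ => ampD_ofReal hx α

end EllipticAmplitude

/-! ### The incomplete integral along v = cos χ. -/

section AmplitudeOfCos

variable {x : ℝ}

/-- A disk with two slits on which `ellF` is holomorphic. -/
def slitDisk (x : ℝ) : Set ℂ := {v | normSq v < 1 / x ∧ (v.im ≠ 0 ∨ |v.re| < 1)}

theorem isOpen_slitDisk : IsOpen (slitDisk x) := by
  refine IsOpen.inter (isOpen_lt Complex.continuous_normSq continuous_const) (IsOpen.union ?_ ?_)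
  · exact isOpen_ne_fun Complex.continuous_im continuous_const
  · exact isOpen_lt Complex.continuous_re.abs continuous_const

theorem starConvex_slitDisk : StarConvex ℝ 0 (slitDisk x) := by
  rw [starConvex_zero_iff]
  rintro v ⟨h1, h2⟩ t ht0 ht1
  have e1 : (t • v).re = t * v.re := by simp
  have e2 : (t • v).im = t * v.im := by simp
  refine ⟨?_, ?_⟩
  · refine lt_of_le_of_lt ?_ h1
    have h3 := Complex.normSq_nonneg v
    have h4 : t ^ 2 ≤ 1 := by nlinarith
    rw [Complex.normSq_apply, e1, e2]
    rw [Complex.normSq_apply] at h3 ⊢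
    nlinarith
  · rw [e1, e2]
    rcases ht0.eq_or_lt with rfl | ht
    · right; simp
    · rcases h2 with h2 | h2
      · exact .inl (mul_ne_zero ht.ne' h2)
      · right
        rw [abs_mul, abs_of_nonneg ht0]
        nlinarith [abs_nonneg v.re]

/-- With v = a + ib, the imaginary part is 2ab (2x²(a² - b²) - (1 + x²)). Its last factor is
negative because x|v|² < 1 gives 2x²(a² - b²) < 2x ≤ 1 + x², so only the coordinate axes need a sign
check. -/
theorem ellF_base_mem_slitPlane (hx : x ∈ Ioo (0 : ℝ) 1) {v : ℂ} (hv : v ∈ slitDisk x) :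
    (1 - v ^ 2) * (1 - (x : ℂ) ^ 2 * v ^ 2) ∈ slitPlane := by
  obtain ⟨h1, h2⟩ := hv
  rw [lt_div_iff₀ hx.1, Complex.normSq_apply] at h1
  have e1 : (v ^ 2).re = v.re ^ 2 - v.im ^ 2 := by rw [pow_two, Complex.mul_re]; ring
  have e2 : (v ^ 2).im = 2 * v.re * v.im := by rw [pow_two, Complex.mul_im]; ring
  have e3 : ((1 - v ^ 2) * (1 - (x : ℂ) ^ 2 * v ^ 2)).im =
      (2 * v.re * v.im) * (2 * x ^ 2 * (v.re ^ 2 - v.im ^ 2) - (1 + x ^ 2)) := by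
    rw [Complex.mul_im, Complex.sub_re, Complex.sub_im, Complex.sub_re, Complex.sub_im,
      ← Complex.ofReal_pow, Complex.re_ofReal_mul, Complex.im_ofReal_mul, e1, e2]
    simp
    ring
  have e4 : ((1 - v ^ 2) * (1 - (x : ℂ) ^ 2 * v ^ 2)).re =
      (1 - (v.re ^ 2 - v.im ^ 2)) * (1 - x ^ 2 * (v.re ^ 2 - v.im ^ 2)) -
        x ^ 2 * (2 * v.re * v.im) ^ 2 := by
    rw [Complex.mul_re, Complex.sub_re, Complex.sub_im, Complex.sub_re, Complex.sub_im,
      ← Complex.ofReal_pow, Complex.re_ofReal_mul, Complex.im_ofReal_mul, e1, e2]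
    simp
    ring
  rw [Complex.mem_slitPlane_iff, e3, e4]
  have hneg : 2 * x ^ 2 * (v.re ^ 2 - v.im ^ 2) - (1 + x ^ 2) < 0 := by
    nlinarith [hx.1, hx.2, mul_lt_mul_of_pos_left h1 hx.1, sq_nonneg v.im, sq_nonneg (1 - x),
      mul_nonneg (sq_nonneg x) (sq_nonneg v.im)]
  rcases eq_or_ne v.im 0 with h3 | h3
  · left
    have h4 : |v.re| < 1 := h2.resolve_left fun h => h h3
    have h5 : v.re ^ 2 < 1 := by rwa [← sq_abs, sq_lt_one_iff₀ (abs_nonneg _)]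
    rw [h3]
    have h6 : 0 < 1 - v.re ^ 2 := by linarith
    have h7 : 0 < 1 - x ^ 2 * v.re ^ 2 := by nlinarith [hx.1, hx.2, sq_nonneg v.re]
    nlinarith [mul_pos h6 h7]
  · rcases eq_or_ne v.re 0 with h4 | h4
    · left
      rw [h4]
      have : 0 < (1 + v.im ^ 2) * (1 + x ^ 2 * v.im ^ 2) := by positivity
      nlinarith
    · right
      exact mul_ne_zero (mul_ne_zero (mul_ne_zero two_ne_zero h4) h3) hneg.ne

theorem hasDerivAt_ellF (hx : x ∈ Ioo (0 : ℝ) 1) {v : ℂ} (hv : v ∈ slitDisk x) :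
    HasDerivAt (ellF x) (1 / ((1 - v ^ 2) * (1 - (x : ℂ) ^ 2 * v ^ 2)) ^ (1 / 2 : ℂ)) v :=
  hasDerivAt_segIntegral isOpen_slitDisk starConvex_slitDisk
    (fun v hv => (differentiableAt_inv_cpow_half
      (f := fun v => (1 - v ^ 2) * (1 - (x : ℂ) ^ 2 * v ^ 2)) (by fun_prop)
      (ellF_base_mem_slitPlane hx hv)).differentiableWithinAt) hv

/-- The right half of the region on which `cos` takes values of modulus less than `1 / √x`. -/
def halfRegion (x : ℝ) : Set ℂ := {χ | (0 < χ.re ∧ χ.re < Real.pi) ∧ normSq (cos χ) < 1 / x}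

theorem isOpen_halfRegion : IsOpen (halfRegion x) := by
  refine IsOpen.inter (IsOpen.inter (isOpen_lt continuous_const Complex.continuous_re)
    (isOpen_lt Complex.continuous_re continuous_const)) ?_
  exact isOpen_lt (Complex.continuous_normSq.comp Complex.continuous_cos) continuous_const

theorem pi_div_two_mem_halfRegion (hx : 0 < x) : ((Real.pi / 2 : ℝ) : ℂ) ∈ halfRegion x := by
  have := Real.pi_pos
  refine ⟨by rw [Complex.ofReal_re]; constructor <;> linarith, ?_⟩
  rw [← Complex.ofReal_cos, Real.cos_pi_div_two]
  simpa using hx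

/-- The region is star-shaped about π/2: |cos χ|² = cos²(Re χ) + sinh²(Im χ), and both terms
decrease on the way to π/2. -/
theorem isPreconnected_halfRegion (hx : 0 < x) : IsPreconnected (halfRegion x) := by
  refine (StarConvex.isPathConnected (a := ((Real.pi / 2 : ℝ) : ℂ)) ?_
    (pi_div_two_mem_halfRegion hx)).isConnected.isPreconnected
  intro χ hχ s t hs ht hst
  obtain ⟨⟨h1, h2⟩, h3⟩ := hχ
  have e1 : (s • ((Real.pi / 2 : ℝ) : ℂ) + t • χ).re = Real.pi / 2 - t * (Real.pi / 2 - χ.re) := by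
    have : s = 1 - t := by linarith
    simp [this]; ring
  have e2 : (s • ((Real.pi / 2 : ℝ) : ℂ) + t • χ).im = t * χ.im := by simp
  have ht1 : t ≤ 1 := by linarith
  have hd : |Real.pi / 2 - χ.re| < Real.pi / 2 := abs_lt.2 ⟨by linarith, by linarith⟩
  have hd' : |t * (Real.pi / 2 - χ.re)| ≤ |Real.pi / 2 - χ.re| := by
    rw [abs_mul, abs_of_nonneg ht]
    nlinarith [abs_nonneg (Real.pi / 2 - χ.re)]
  have hd'' := abs_lt.1 (hd'.trans_lt hd)
  refine ⟨by rw [e1]; constructor <;> linarith [hd''.1, hd''.2], ?_⟩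
  refine lt_of_le_of_lt ?_ h3
  rw [normSq_cos, normSq_cos, e1, e2]
  have h4 : Real.cos (Real.pi / 2 - t * (Real.pi / 2 - χ.re)) ^ 2 ≤ Real.cos χ.re ^ 2 := by
    rw [Real.cos_pi_div_two_sub, show χ.re = Real.pi / 2 - (Real.pi / 2 - χ.re) by ring,
      Real.cos_pi_div_two_sub, sub_sub_cancel, sq_le_sq, Real.abs_sin_eq_sin_abs_of_abs_le_pi,
      Real.abs_sin_eq_sin_abs_of_abs_le_pi]
    · exact Real.strictMonoOn_sin.monotoneOn ⟨by linarith [abs_nonneg (t * (Real.pi / 2 - χ.re)),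
        Real.pi_pos], by linarith⟩
        ⟨by linarith [abs_nonneg (Real.pi / 2 - χ.re), Real.pi_pos], hd.le⟩ hd'
    · linarith [Real.pi_pos]
    · linarith [Real.pi_pos]
  have h5 : Real.sinh (t * χ.im) ^ 2 ≤ Real.sinh χ.im ^ 2 := by
    have h6 : Real.cosh (t * χ.im) ≤ Real.cosh χ.im := by
      rw [Real.cosh_le_cosh, abs_mul, abs_of_nonneg ht]
      nlinarith [abs_nonneg χ.im]
    nlinarith [Real.cosh_sq χ.im, Real.cosh_sq (t * χ.im), Real.cosh_pos (t * χ.im)]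
  linarith

theorem halfRegion_subset_slitStrip : halfRegion x ⊆ slitStrip x := fun χ hχ =>
  ⟨by rw [abs_of_pos hχ.1.1]; exact hχ.1.2, .inl hχ.1.1.ne'⟩

theorem cos_mem_slitDisk {χ : ℂ} (hχ : χ ∈ halfRegion x) : cos χ ∈ slitDisk x := by
  refine ⟨hχ.2, ?_⟩
  have hs := Real.sin_pos_of_pos_of_lt_pi hχ.1.1 hχ.1.2
  rw [cos_im, cos_re]
  rcases eq_or_ne (Real.sinh χ.im) 0 with h | h
  · right
    have h1 : Real.cosh χ.im = 1 := by
      have := Real.cosh_sq χ.im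
      rw [h] at this
      nlinarith [Real.cosh_pos χ.im]
    rw [h1, mul_one, ← sq_lt_one_iff_abs_lt_one]
    nlinarith [Real.sin_sq_add_cos_sq χ.re]
  · left
    exact neg_ne_zero.2 (mul_ne_zero hs.ne' h)

/-- Both sides have the same square, which lies in the slit plane, so the real part of the right
side never vanishes. It is positive at π/2 and the region is connected, so the right side is the
principal root. -/
theorem ellF_root_cos (hx : x ∈ Ioo (0 : ℝ) 1) {χ : ℂ} (hχ : χ ∈ halfRegion x) :
    ((1 - cos χ ^ 2) * (1 - (x : ℂ) ^ 2 * cos χ ^ 2)) ^ (1 / 2 : ℂ) =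
      sin χ * (1 - (x : ℂ) ^ 2 * cos χ ^ 2) ^ (1 / 2 : ℂ) := by
  set R : ℂ → ℂ := fun χ => sin χ * (1 - (x : ℂ) ^ 2 * cos χ ^ 2) ^ (1 / 2 : ℂ) with hR
  have hsq : ∀ χ, R χ ^ 2 = (1 - cos χ ^ 2) * (1 - (x : ℂ) ^ 2 * cos χ ^ 2) := by
    intro χ
    rw [hR, mul_pow, sq_cpow_half, Complex.sin_sq]
  have hne : ∀ χ ∈ halfRegion x, (R χ).re ≠ 0 := by
    intro χ hχ h0
    have h1 := ellF_base_mem_slitPlane hx (cos_mem_slitDisk hχ)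
    rw [← hsq, Complex.mem_slitPlane_iff, pow_two, Complex.mul_re, Complex.mul_im, h0] at h1
    rcases h1 with h1 | h1
    · nlinarith [sq_nonneg (R χ).im]
    · exact h1 (by rw [Complex.mul_im, h0]; ring)
  have hcont : ContinuousOn (fun χ => (R χ).re) (halfRegion x) := by
    refine Complex.continuous_re.comp_continuousOn fun χ hχ => ContinuousAt.continuousWithinAt ?_
    refine Complex.continuous_sin.continuousAt.mul (ContinuousAt.cpow (by fun_prop)
      continuousAt_const (ampD_base_mem_slitPlane hx (halfRegion_subset_slitStrip hχ)))
  have hbase : 0 < (R ((Real.pi / 2 : ℝ) : ℂ)).re := by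
    simp only [hR]
    rw [← Complex.ofReal_cos, ← Complex.ofReal_sin, Real.cos_pi_div_two, Real.sin_pi_div_two]
    simp
  have hpos : ∀ χ ∈ halfRegion x, 0 < (R χ).re := by
    intro χ hχ
    by_contra hcon
    obtain ⟨ξ, hξ, h0⟩ := (isPreconnected_halfRegion hx.1).intermediate_value hχ
      (pi_div_two_mem_halfRegion hx.1) hcont ⟨not_lt.1 hcon, hbase.le⟩
    exact hne ξ hξ h0
  rw [← hsq, one_div, Complex.sq_cpow_two_inv (hpos χ hχ)]
  simp only [hR, one_div]

/-- By `ellF_root_cos` the derivatives of ellF(cos χ) and amp χ cancel, and the constant is read off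
at χ = π/2. -/
theorem ellF_cos_of_mem_halfRegion (hx : x ∈ Ioo (0 : ℝ) 1) {χ : ℂ} (hχ : χ ∈ halfRegion x) :
    ellF x (cos χ) = ellK x - amp x χ := by
  have hd : ∀ χ ∈ halfRegion x, HasDerivAt (fun χ => ellF x (cos χ) + amp x χ) 0 χ := by
    intro χ hχ
    have h1 := (hasDerivAt_ellF hx (cos_mem_slitDisk hχ)).comp χ (Complex.hasDerivAt_cos χ)
    refine (h1.add (hasDerivAt_amp hx (halfRegion_subset_slitStrip hχ))).congr_deriv ?_
    have hs : sin χ ≠ 0 := by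
      intro h
      have h2 := ellF_base_mem_slitPlane hx (cos_mem_slitDisk hχ)
      rw [← Complex.sin_sq, h] at h2
      simp at h2
    have h3 := cpow_half_ne_zero (Complex.slitPlane_ne_zero
      (ampD_base_mem_slitPlane hx (halfRegion_subset_slitStrip hχ)))
    rw [ellF_root_cos hx hχ, ampD]
    field_simp
    ring
  have h := isOpen_halfRegion.is_const_of_deriv_eq_zero (isPreconnected_halfRegion hx.1)
    (fun χ hχ => (hd χ hχ).differentiableAt.differentiableWithinAt)
    (fun χ hχ => (hd χ hχ).deriv) hχ (pi_div_two_mem_halfRegion hx.1)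
  simp only [amp_pi_div_two hx, ← Complex.ofReal_cos, Real.cos_pi_div_two] at h
  have h0 : ellF x 0 = 0 := segIntegral_zero _
  rw [Complex.ofReal_zero, h0, zero_add] at h
  exact eq_sub_of_add_eq h

/-- The values of `ellF` on the slit. -/
theorem ellF_cosh (hx : x ∈ Ioo (0 : ℝ) 1) {b : ℝ} (hb : 0 ≤ b) (hxb : x * Real.cosh b < 1) :
    ellF x (Real.cosh b) = ellK x - amp x (b * I) := by
  set F : ℂ → ℂ := fun t => 1 / ((1 - t ^ 2) * (1 - (x : ℂ) ^ 2 * t ^ 2)) ^ (1 / 2 : ℂ) with hF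
  have hC := Real.one_le_cosh b
  set C := Real.cosh b with hCdef
  have hlow : ∀ s ∈ uIcc (0 : ℝ) 1,
      ((1 / Real.sqrt ((1 - s ^ 2) * (1 - x ^ 2 * s ^ 2)) : ℝ) : ℂ) = F s := by
    intro s hs
    rw [uIcc_of_le zero_le_one] at hs
    have h1 : 0 ≤ 1 - s ^ 2 := by nlinarith [hs.1, hs.2]
    have h2 : 0 ≤ 1 - x ^ 2 * s ^ 2 := by nlinarith [hx.1, hx.2, sq_nonneg x]
    have h3 : (1 - (s : ℂ) ^ 2) * (1 - (x : ℂ) ^ 2 * s ^ 2) =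
        (((1 - s ^ 2) * (1 - x ^ 2 * s ^ 2) : ℝ) : ℂ) := by push_cast; rfl
    simp only [hF]
    rw [h3, ofReal_cpow_half (mul_nonneg h1 h2)]
    push_cast
    rfl
  -- Past s = 1 the radicand is negative with argument π, so its principal root lies on the positive
  -- imaginary axis; the reciprocal brings in the factor -I.
  have hhigh : ∀ s ∈ uIcc 1 C,
      -I * ((1 / Real.sqrt ((s ^ 2 - 1) * (1 - x ^ 2 * s ^ 2)) : ℝ) : ℂ) = F s := by
    intro s hs
    rw [uIcc_of_le hC] at hs
    have h1 : 0 ≤ s ^ 2 - 1 := by nlinarith [hs.1]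
    have h2 : 0 ≤ 1 - x ^ 2 * s ^ 2 := by
      have : x * s < 1 := lt_of_le_of_lt (mul_le_mul_of_nonneg_left hs.2 hx.1.le) hxb
      nlinarith [mul_nonneg hx.1.le (zero_le_one.trans hs.1)]
    have h3 : (1 - (s : ℂ) ^ 2) * (1 - (x : ℂ) ^ 2 * s ^ 2) =
        -(((s ^ 2 - 1) * (1 - x ^ 2 * s ^ 2) : ℝ) : ℂ) := by push_cast; ring
    simp only [hF]
    rw [h3, neg_ofReal_cpow_half (mul_nonneg h1 h2), Complex.ofReal_div, Complex.ofReal_one,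
      ← one_div_mul_one_div, one_div I, Complex.inv_I]
  have hmem : ∀ τ ∈ Icc (0 : ℝ) b, (τ : ℂ) * I ∈ slitStrip x := by
    intro τ hτ
    refine ⟨by simpa using Real.pi_pos, .inr ?_⟩
    simp only [Complex.mul_I_im, Complex.ofReal_re]
    refine lt_of_le_of_lt (mul_le_mul_of_nonneg_left ?_ hx.1.le) hxb
    exact Real.cosh_le_cosh.2 (by rw [abs_of_nonneg hτ.1, abs_of_nonneg hb]; exact hτ.2)
  have hmaps : ∀ s ∈ Icc 1 C, Real.arcosh s ∈ Icc (0 : ℝ) b := by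
    intro s hs
    refine ⟨Real.arcosh_nonneg hs.1, ?_⟩
    rw [← Real.arcosh_cosh hb]
    exact (Real.arcosh_le_arcosh (by linarith [hs.1]) (Real.cosh_pos b)).2 hs.2
  have hNd : ∀ τ ∈ Icc (0 : ℝ) b, HasDerivAt (fun τ : ℝ => (amp x (τ * I)).im)
      (1 / Real.sqrt (1 - x ^ 2 * Real.cosh τ ^ 2)) τ := by
    intro τ hτ
    have h1 : HasDerivAt (fun τ : ℝ => (τ : ℂ) * I) (1 * I) τ :=
      (hasDerivAt_id τ).ofReal_comp.mul_const I
    have h2 := (hasDerivAt_amp hx (hmem τ hτ)).comp τ h1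
    have h3 := Complex.imCLM.hasFDerivAt.comp_hasDerivAt τ h2
    refine h3.congr_deriv ?_
    have h4 : x * Real.cosh τ < 1 := by
      have := (hmem τ hτ).2
      simpa using this
    rw [ampD_mul_I τ (by nlinarith [mul_pos hx.1 (Real.cosh_pos τ)]), one_mul]
    simp [-one_div]
  obtain ⟨hi2, hint2⟩ := integral_eq_sub_of_nonneg hC
    (G := fun s => (amp x (Real.arcosh s * I)).im)
    (g := fun s => 1 / Real.sqrt ((s ^ 2 - 1) * (1 - x ^ 2 * s ^ 2)))
    (ContinuousOn.comp (g := fun τ : ℝ => (amp x (τ * I)).im)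
      (fun τ hτ => (hNd τ hτ).continuousAt.continuousWithinAt)
      (Real.continuousOn_arcosh.mono fun s hs => hs.1) hmaps)
    (fun s hs => by
      have h1 := (hNd _ (hmaps s ⟨hs.1.le, hs.2.le⟩)).comp s (Real.hasDerivAt_arcosh hs.1)
      refine h1.congr_deriv ?_
      have h2 : 0 ≤ s ^ 2 - 1 := by nlinarith [hs.1]
      rw [Real.cosh_arcosh hs.1.le, Real.sqrt_mul h2]
      field_simp)
    (fun s _ => by positivity)
  have hi1 := (ellK_eq_legJ (Ioo_subset_Ico_self hx)).1
  have hF1 : IntervalIntegrable (fun s : ℝ => F s) volume 0 1 := by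
    have h1 : IntervalIntegrable (fun s : ℝ =>
        ((1 / Real.sqrt ((1 - s ^ 2) * (1 - x ^ 2 * s ^ 2)) : ℝ) : ℂ)) volume 0 1 :=
      ⟨hi1.1.ofReal, hi1.2.ofReal⟩
    exact h1.congr fun s hs => hlow s (uIoc_subset_uIcc hs)
  have hF2 : IntervalIntegrable (fun s : ℝ => F s) volume 1 C := by
    have h1 : IntervalIntegrable (fun s : ℝ =>
        ((1 / Real.sqrt ((s ^ 2 - 1) * (1 - x ^ 2 * s ^ 2)) : ℝ) : ℂ)) volume 1 C :=
      ⟨hi2.1.ofReal, hi2.2.ofReal⟩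
    exact (h1.const_mul (-I)).congr fun s hs => hhigh s (uIoc_subset_uIcc hs)
  have hre := amp_im_mul_I hx hxb
  rw [ellF, segIntegral_ofReal]
  change ∫ s in (0 : ℝ)..C, F s = _
  rw [← intervalIntegral.integral_add_adjacent_intervals hF1 hF2,
    ← intervalIntegral.integral_congr hlow, ← intervalIntegral.integral_congr hhigh,
    intervalIntegral.integral_const_mul, intervalIntegral.integral_ofReal,
    intervalIntegral.integral_ofReal, hint2, hCdef, Real.arcosh_cosh hb]
  have h0 : amp x ((Real.arcosh 1 : ℝ) * I) = 0 := by
    rw [Real.arcosh_zero]; simp [amp, segIntegral_zero]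
  rw [h0, ← ellK, Complex.zero_im, sub_zero, sub_eq_add_neg]
  congr 1
  apply Complex.ext <;> simp [hre]

/-- With `c = π / (2 K)`, the function `v ↦ sin (c · ellF v)` is uniformized by `v = cos χ`. -/
theorem sin_ellF_cos (hx : x ∈ Ioo (0 : ℝ) 1) {χ : ℂ} (hχ : |χ.re| < Real.pi)
    (hχ2 : normSq (cos χ) < 1 / x) :
    sin ((Real.pi : ℂ) / (2 * (ellK x : ℂ)) * ellF x (cos χ)) =
      cos ((Real.pi : ℂ) / (2 * (ellK x : ℂ)) * amp x χ) := by
  have hK : (ellK x : ℂ) ≠ 0 := by exact_mod_cast (ellK_pos (Ioo_subset_Ico_self hx)).ne'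
  have key : ∀ χ : ℂ, ellF x (cos χ) = ellK x - amp x χ →
      sin ((Real.pi : ℂ) / (2 * (ellK x : ℂ)) * ellF x (cos χ)) =
      cos ((Real.pi : ℂ) / (2 * (ellK x : ℂ)) * amp x χ) := by
    intro χ h
    rw [h, mul_sub, show (Real.pi : ℂ) / (2 * (ellK x : ℂ)) * ellK x = Real.pi / 2 by
      field_simp, Complex.sin_pi_div_two_sub]
  -- Replacing χ by -χ changes neither side. Thus the identity holds for both points over a value on
  -- the slit, although `ellF` itself is not continuous there.
  have hneg : ∀ χ : ℂ, sin ((Real.pi : ℂ) / (2 * (ellK x : ℂ)) * ellF x (cos (-χ))) =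
      cos ((Real.pi : ℂ) / (2 * (ellK x : ℂ)) * amp x (-χ)) →
      sin ((Real.pi : ℂ) / (2 * (ellK x : ℂ)) * ellF x (cos χ)) =
      cos ((Real.pi : ℂ) / (2 * (ellK x : ℂ)) * amp x χ) := by
    intro χ h
    rwa [Complex.cos_neg, amp_neg, mul_neg, Complex.cos_neg] at h
  obtain ⟨h1, h2⟩ := abs_lt.1 hχ
  have hzero : ∀ χ : ℂ, χ.re = 0 → normSq (cos χ) < 1 / x → 0 ≤ χ.im →
      sin ((Real.pi : ℂ) / (2 * (ellK x : ℂ)) * ellF x (cos χ)) =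
      cos ((Real.pi : ℂ) / (2 * (ellK x : ℂ)) * amp x χ) := by
    intro χ h3 h4 h5
    have h6 : χ = (χ.im : ℂ) * I := by apply Complex.ext <;> simp [h3]
    have h7 : x * Real.cosh χ.im < 1 := by
      rw [normSq_cos, h3, Real.cos_zero, lt_div_iff₀ hx.1] at h4
      have h8 := Real.cosh_sq χ.im
      have h9 := Real.one_le_cosh χ.im
      nlinarith [mul_le_mul_of_nonneg_left h9 (mul_pos hx.1 (Real.cosh_pos χ.im)).le, hx.1]
    refine key χ ?_
    rw [h6, Complex.cos_mul_I, ← Complex.ofReal_cosh]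
    exact ellF_cosh hx h5 h7
  rcases lt_trichotomy χ.re 0 with h | h | h
  · exact hneg χ (key _ (ellF_cos_of_mem_halfRegion hx
      ⟨by rw [Complex.neg_re]; constructor <;> linarith, by rwa [Complex.cos_neg]⟩))
  · rcases le_total 0 χ.im with h3 | h3
    · exact hzero χ h hχ2 h3
    · exact hneg χ (hzero _ (by rw [Complex.neg_re, h, neg_zero]) (by rwa [Complex.cos_neg])
        (by rw [Complex.neg_im]; linarith))
  · exact key _ (ellF_cos_of_mem_halfRegion hx ⟨⟨h, h2⟩, hχ2⟩)

end AmplitudeOfCos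

/-! ### Values of `amp` on a quarter of the region. -/

section Quarter

variable {x : ℝ}

theorem hasDerivAt_complex_mk {f g : ℝ → ℝ} {f' g' t : ℝ} (hf : HasDerivAt f f' t)
    (hg : HasDerivAt g g' t) :
    HasDerivAt (fun t => (⟨f t, g t⟩ : ℂ)) (⟨f', g'⟩ : ℂ) t := by
  simp only [Complex.mk_eq_add_mul_I]
  exact hf.ofReal_comp.add (hg.ofReal_comp.mul_const I)

theorem re_cpow_half_pos {z : ℂ} (hz : z ∈ slitPlane) : 0 < (z ^ (1 / 2 : ℂ)).re := by
  have h := Complex.cpow_ofReal_re z (1 / 2)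
  push_cast at h
  rw [h]
  have h1 : 0 < ‖z‖ := norm_pos_iff.2 (Complex.slitPlane_ne_zero hz)
  have h2 := Complex.neg_pi_lt_arg z
  have h3 := Complex.arg_le_pi z
  have h4 : Complex.arg z < Real.pi := lt_of_le_of_ne h3 (Complex.slitPlane_arg_ne_pi hz)
  exact mul_pos (Real.rpow_pos_of_pos h1 _) (Real.cos_pos_of_mem_Ioo ⟨by linarith, by linarith⟩)

/-- The quarter of the region `|cos χ|² ≤ 1 / x`. -/
def quarter (x : ℝ) : Set ℂ :=
  {χ | (0 ≤ χ.re ∧ χ.re ≤ Real.pi / 2) ∧ 0 ≤ χ.im ∧ normSq (cos χ) ≤ 1 / x}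

theorem quarter_subset_slitStrip (hx : x ∈ Ioo (0 : ℝ) 1) : quarter x ⊆ slitStrip x := by
  rintro χ ⟨⟨h1, h2⟩, h3, h4⟩
  refine ⟨by rw [abs_of_nonneg h1]; linarith [Real.pi_pos], ?_⟩
  by_cases h : χ.re = 0
  · right
    rw [normSq_cos, h, Real.cos_zero, le_div_iff₀ hx.1] at h4
    have h8 := Real.cosh_sq χ.im
    have h9 := Real.cosh_pos χ.im
    have h10 : x ^ 2 * Real.cosh χ.im ^ 2 < 1 := by nlinarith [hx.1, hx.2]
    rw [← mul_pow] at h10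
    nlinarith [mul_pos hx.1 h9]
  · exact .inl h

/-- The quarter is stable under moving right and down, so two of its points can be joined by
coordinate segments inside it. -/
theorem mem_quarter_of_le {α b α' b' : ℝ}
    (h : (⟨α, b⟩ : ℂ) ∈ quarter x) (h1 : α ≤ α') (h2 : α' ≤ Real.pi / 2) (h3 : 0 ≤ b')
    (h4 : b' ≤ b) : (⟨α', b'⟩ : ℂ) ∈ quarter x := by
  obtain ⟨⟨h5, h6⟩, h7, h8⟩ := h
  simp only at h5 h6 h7
  refine ⟨⟨h5.trans h1, h2⟩, h3, le_trans ?_ h8⟩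
  rw [normSq_cos, normSq_cos]
  have h9 : Real.cos α' ≤ Real.cos α := Real.cos_le_cos_of_nonneg_of_le_pi h5
    (by linarith [Real.pi_pos]) h1
  have h10 : 0 ≤ Real.cos α' := Real.cos_nonneg_of_neg_pi_div_two_le_of_le (by linarith) h2
  have h11 : Real.sinh b' ≤ Real.sinh b := Real.sinh_le_sinh.2 h4
  have h12 : 0 ≤ Real.sinh b' := Real.sinh_nonneg_iff.2 h3
  have := pow_le_pow_left₀ h10 h9 2
  have := pow_le_pow_left₀ h12 h11 2
  simp only
  linarith

theorem ampD_re_pos (hx : x ∈ Ioo (0 : ℝ) 1) {χ : ℂ} (hχ : χ ∈ slitStrip x) :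
    0 < (ampD x χ).re := by
  have h1 := ampD_base_mem_slitPlane hx hχ
  have h2 := re_cpow_half_pos h1
  rw [ampD, one_div, Complex.inv_re]
  exact div_pos h2 (Complex.normSq_pos.2 (cpow_half_ne_zero (Complex.slitPlane_ne_zero h1)))

/-- On the quarter the radicand has nonnegative imaginary part, and so has its principal root. With
`ampD_re_pos` this puts the derivative of `amp` in the fourth quadrant, the source of all
monotonicity below. -/
theorem ampD_im_nonpos (hx : x ∈ Ioo (0 : ℝ) 1) {χ : ℂ} (hχ : χ ∈ quarter x) :
    (ampD x χ).im ≤ 0 := by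
  have h1 := ampD_base_mem_slitPlane hx (quarter_subset_slitStrip hx hχ)
  have h2 := re_cpow_half_pos h1
  have h3 := ampD_base_im (x := x) χ
  rw [← sq_cpow_half (1 - (x : ℂ) ^ 2 * cos χ ^ 2), pow_two, Complex.mul_im] at h3
  obtain ⟨⟨h4, h5⟩, h6, h7⟩ := hχ
  have h8 := Real.cos_nonneg_of_neg_pi_div_two_le_of_le (by linarith) h5
  have h9 := Real.sin_nonneg_of_nonneg_of_le_pi h4 (by linarith)
  have h10 := Real.sinh_nonneg_iff.2 h6
  have h11 := (Real.cosh_pos χ.im).le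
  have h12 : 0 ≤ x ^ 2 *
    (2 * (Real.cos χ.re * Real.cosh χ.im) * (Real.sin χ.re * Real.sinh χ.im)) := by positivity
  rw [← h3] at h12
  rw [ampD, one_div, Complex.inv_im]
  refine div_nonpos_of_nonpos_of_nonneg ?_ (Complex.normSq_nonneg _)
  nlinarith

theorem hasDerivAt_amp_mk (hx : x ∈ Ioo (0 : ℝ) 1) {f g : ℝ → ℝ} {f' g' t : ℝ}
    (hf : HasDerivAt f f' t) (hg : HasDerivAt g g' t) (h : (⟨f t, g t⟩ : ℂ) ∈ slitStrip x) :
    HasDerivAt (fun t => (amp x ⟨f t, g t⟩).re) (ampD x ⟨f t, g t⟩ * ⟨f', g'⟩).re t ∧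
      HasDerivAt (fun t => (amp x ⟨f t, g t⟩).im) (ampD x ⟨f t, g t⟩ * ⟨f', g'⟩).im t := by
  have h1 : HasDerivAt (fun t => amp x ⟨f t, g t⟩) (ampD x ⟨f t, g t⟩ * ⟨f', g'⟩) t :=
    (hasDerivAt_amp hx h).comp t (hasDerivAt_complex_mk hf hg)
  exact ⟨Complex.reCLM.hasFDerivAt.comp_hasDerivAt t h1,
    Complex.imCLM.hasFDerivAt.comp_hasDerivAt t h1⟩

theorem amp_horizontal (hx : x ∈ Ioo (0 : ℝ) 1) {α α' b : ℝ} (h : (⟨α, b⟩ : ℂ) ∈ quarter x)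
    (hα' : α' ≤ Real.pi / 2) :
    (α < α' → (amp x ⟨α, b⟩).re < (amp x ⟨α', b⟩).re) ∧
      (α ≤ α' → (amp x ⟨α', b⟩).im ≤ (amp x ⟨α, b⟩).im) := by
  have hmem : ∀ t ∈ Icc α α', (⟨t, b⟩ : ℂ) ∈ quarter x := fun t ht =>
    mem_quarter_of_le h ht.1 (ht.2.trans hα') h.2.1 le_rfl
  have hd := fun t ht => hasDerivAt_amp_mk hx (hasDerivAt_id' t) (hasDerivAt_const t b)
    (quarter_subset_slitStrip hx (hmem t ht))
  constructor
  · intro hlt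
    refine strictMonoOn_of_deriv_pos (convex_Icc α α')
      (f := fun t => (amp x ⟨t, b⟩).re)
      (fun t ht => (hd t ht).1.continuousAt.continuousWithinAt) (fun t ht => ?_)
      (left_mem_Icc.2 hlt.le) (right_mem_Icc.2 hlt.le) hlt
    have h1 := interior_subset ht
    rw [(hd t h1).1.deriv]
    simpa using ampD_re_pos hx (quarter_subset_slitStrip hx (hmem t h1))
  · intro hle
    refine antitoneOn_of_deriv_nonpos (convex_Icc α α')
      (f := fun t => (amp x ⟨t, b⟩).im)
      (fun t ht => (hd t ht).2.continuousAt.continuousWithinAt)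
      (fun t ht => (hd t (interior_subset ht)).2.differentiableAt.differentiableWithinAt)
      (fun t ht => ?_)
      (left_mem_Icc.2 hle) (right_mem_Icc.2 hle) hle
    have h1 := interior_subset ht
    rw [(hd t h1).2.deriv]
    simpa using ampD_im_nonpos hx (hmem t h1)

theorem amp_vertical (hx : x ∈ Ioo (0 : ℝ) 1) {α b b' : ℝ} (h : (⟨α, b⟩ : ℂ) ∈ quarter x)
    (hb' : 0 ≤ b') :
    (b' < b → (amp x ⟨α, b'⟩).im < (amp x ⟨α, b⟩).im) ∧
      (b' ≤ b → (amp x ⟨α, b'⟩).re ≤ (amp x ⟨α, b⟩).re) := by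
  have hmem : ∀ t ∈ Icc b' b, (⟨α, t⟩ : ℂ) ∈ quarter x := fun t ht =>
    mem_quarter_of_le h le_rfl h.1.2 (hb'.trans ht.1) ht.2
  have hd := fun t ht => hasDerivAt_amp_mk hx (hasDerivAt_const t α) (hasDerivAt_id' t)
    (quarter_subset_slitStrip hx (hmem t ht))
  constructor
  · intro hlt
    refine strictMonoOn_of_deriv_pos (convex_Icc b' b)
      (f := fun t => (amp x ⟨α, t⟩).im)
      (fun t ht => (hd t ht).2.continuousAt.continuousWithinAt) (fun t ht => ?_)
      (left_mem_Icc.2 hlt.le) (right_mem_Icc.2 hlt.le) hlt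
    have h1 := interior_subset ht
    rw [(hd t h1).2.deriv]
    simpa using ampD_re_pos hx (quarter_subset_slitStrip hx (hmem t h1))
  · intro hle
    refine monotoneOn_of_deriv_nonneg (convex_Icc b' b)
      (f := fun t => (amp x ⟨α, t⟩).re)
      (fun t ht => (hd t ht).1.continuousAt.continuousWithinAt)
      (fun t ht => (hd t (interior_subset ht)).1.differentiableAt.differentiableWithinAt)
      (fun t ht => ?_)
      (left_mem_Icc.2 hle) (right_mem_Icc.2 hle) hle
    have h1 := interior_subset ht
    rw [(hd t h1).1.deriv]
    simpa using ampD_im_nonpos hx (hmem t h1)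

/-- Of two points with different abscissas, if the right one is at least as high then Re `amp` is
strictly larger there; if it is lower, Im `amp` is strictly smaller. -/
theorem amp_injOn_quarter (hx : x ∈ Ioo (0 : ℝ) 1) : InjOn (amp x) (quarter x) := by
  have key : ∀ α₁ b₁ α₂ b₂ : ℝ, (⟨α₁, b₁⟩ : ℂ) ∈ quarter x → (⟨α₂, b₂⟩ : ℂ) ∈ quarter x →
      α₁ ≤ α₂ → amp x ⟨α₁, b₁⟩ = amp x ⟨α₂, b₂⟩ → α₁ = α₂ ∧ b₁ = b₂ := by
    intro α₁ b₁ α₂ b₂ h1 h2 hle heq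
    have hre := congrArg Complex.re heq
    have him := congrArg Complex.im heq
    have hb1 : 0 ≤ b₁ := h1.2.1
    have hb2 : 0 ≤ b₂ := h2.2.1
    have hα2 : α₂ ≤ Real.pi / 2 := h2.1.2
    rcases hle.eq_or_lt with rfl | hlt
    · refine ⟨rfl, ?_⟩
      rcases lt_trichotomy b₁ b₂ with h | h | h
      · exact absurd him ((amp_vertical hx h2 hb1).1 h).ne
      · exact h
      · exact absurd him ((amp_vertical hx h1 hb2).1 h).ne'
    · exfalso
      rcases le_or_gt b₁ b₂ with h | h
      · have h3 := (amp_horizontal hx h1 hα2).1 hlt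
        have h4 := (amp_vertical hx h2 hb1).2 h
        linarith
      · have h3 := (amp_horizontal hx h1 hα2).2 hle
        have h4 := (amp_vertical hx (mem_quarter_of_le h1 hle hα2 hb1 le_rfl) hb2).1 h
        linarith
  intro χ₁ h1 χ₂ h2 heq
  rcases le_total χ₁.re χ₂.re with h | h
  · obtain ⟨h3, h4⟩ := key _ _ _ _ h1 h2 h heq
    exact Complex.ext h3 h4
  · obtain ⟨h3, h4⟩ := key _ _ _ _ h2 h1 h heq.symm
    exact Complex.ext h3.symm h4.symm

theorem mk_zero_mem_quarter (hx : x ∈ Ioo (0 : ℝ) 1) {α : ℝ} (h0 : 0 ≤ α)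
    (h1 : α ≤ Real.pi / 2) : (⟨α, 0⟩ : ℂ) ∈ quarter x := by
  refine ⟨⟨h0, h1⟩, le_rfl, ?_⟩
  rw [normSq_cos]
  simp only [Real.sinh_zero]
  have : 1 ≤ 1 / x := (one_le_div hx.1).2 hx.2.le
  nlinarith [Real.cos_sq_le_one α]

theorem amp_mk_zero_im (hx : x ∈ Ioo (0 : ℝ) 1) {α : ℝ} (h0 : 0 ≤ α)
    (h1 : α ≤ Real.pi / 2) : (amp x ⟨α, 0⟩).im = 0 := by
  have h := amp_conj hx (quarter_subset_slitStrip hx (mk_zero_mem_quarter hx h0 h1))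
  have e : starRingEnd ℂ (⟨α, 0⟩ : ℂ) = ⟨α, 0⟩ := by apply Complex.ext <;> simp
  rw [e] at h
  have := congrArg Complex.im h
  rw [Complex.conj_im] at this
  linarith

theorem ampD_pi_div_two_add {x : ℝ} (b : ℝ) : ampD x ⟨Real.pi / 2, b⟩ =
    ((1 / Real.sqrt (1 + x ^ 2 * Real.sinh b ^ 2) : ℝ) : ℂ) := by
  have h : 1 - (x : ℂ) ^ 2 * cos (⟨Real.pi / 2, b⟩ : ℂ) ^ 2 =
      ((1 + x ^ 2 * Real.sinh b ^ 2 : ℝ) : ℂ) := by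
    apply Complex.ext
    · rw [ampD_base_re, Complex.ofReal_re]
      simp
    · rw [ampD_base_im, Complex.ofReal_im]
      simp
  rw [ampD, h, ofReal_cpow_half (by positivity)]
  push_cast
  rfl

theorem mk_pi_div_two_mem_slitStrip (b : ℝ) : (⟨Real.pi / 2, b⟩ : ℂ) ∈ slitStrip x := by
  have := Real.pi_pos
  refine ⟨?_, .inl Real.pi_div_two_pos.ne'⟩
  rw [abs_of_pos Real.pi_div_two_pos]
  exact half_lt_self this

/-- On Re χ = π/2 the derivative `ampD` is real, so the real part of `amp` is constant. The
imaginary part becomes `legE` under the substitution α = arctan(sinh b). -/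
theorem amp_pi_div_two_add (hx : x ∈ Ioo (0 : ℝ) 1) (b : ℝ) :
    (amp x ⟨Real.pi / 2, b⟩).re = ellK x ∧
      (amp x ⟨Real.pi / 2, b⟩).im = legE x (Real.arctan (Real.sinh b)) := by
  have hd := fun t => hasDerivAt_amp_mk hx (hasDerivAt_const t (Real.pi / 2)) (hasDerivAt_id' t)
    (mk_pi_div_two_mem_slitStrip (x := x) t)
  have e0 : (⟨Real.pi / 2, 0⟩ : ℂ) = ((Real.pi / 2 : ℝ) : ℂ) := rfl
  constructor
  · have h1 := is_const_of_deriv_eq_zero (fun t => (hd t).1.differentiableAt)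
      (fun t => by rw [(hd t).1.deriv, ampD_pi_div_two_add, Complex.re_ofReal_mul]; simp) b 0
    rw [h1, e0, amp_pi_div_two hx, Complex.ofReal_re]
  · have hd2 : ∀ t, HasDerivAt (fun b => (amp x ⟨Real.pi / 2, b⟩).im -
        legE x (Real.arctan (Real.sinh b))) 0 t := by
      intro t
      have h1 := (hasDerivAt_legE hx.1 (Real.arctan (Real.sinh t))).comp t
        ((Real.hasDerivAt_arctan _).comp t (Real.hasDerivAt_sinh t))
      refine ((hd t).2.sub h1).congr_deriv ?_
      have hp : 0 < 1 + Real.sinh t ^ 2 := by positivity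
      have hq : 0 < 1 + x ^ 2 * Real.sinh t ^ 2 := by positivity
      have hc := Real.cosh_pos t
      have e1 : Real.cos (Real.arctan (Real.sinh t)) ^ 2 +
          x ^ 2 * Real.sin (Real.arctan (Real.sinh t)) ^ 2 =
          (1 + x ^ 2 * Real.sinh t ^ 2) / Real.cosh t ^ 2 := by
        rw [Real.cos_sq_arctan, Real.sin_sq_arctan, Real.cosh_sq, add_comm (Real.sinh t ^ 2) 1]
        field_simp
      have hq' := (Real.sqrt_pos.2 hq).ne'
      rw [e1, Real.sqrt_div hq.le, Real.sqrt_sq hc.le, ampD_pi_div_two_add,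
        Complex.im_ofReal_mul, add_comm 1 (Real.sinh t ^ 2), ← Real.cosh_sq]
      field_simp
      ring
    have h2 := is_const_of_deriv_eq_zero (fun t => (hd2 t).differentiableAt)
      (fun t => (hd2 t).deriv) b 0
    have hz : legE x 0 = 0 := by simp [legE]
    rw [e0, amp_pi_div_two hx, Real.sinh_zero, Real.arctan_zero, hz, Complex.ofReal_im,
      sub_zero] at h2
    linarith

/-- The upper boundary of the quarter. -/
noncomputable def topIm (x α : ℝ) : ℝ := Real.arsinh (Real.sqrt (1 / x - Real.cos α ^ 2))

theorem one_div_sub_cos_sq_pos (hx : x ∈ Ioo (0 : ℝ) 1) (α : ℝ) : 0 < 1 / x - Real.cos α ^ 2 := by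
  have : 1 < 1 / x := (one_lt_div hx.1).2 hx.2
  linarith [Real.cos_sq_le_one α]

theorem sinh_topIm_sq (hx : x ∈ Ioo (0 : ℝ) 1) (α : ℝ) :
    Real.sinh (topIm x α) ^ 2 = 1 / x - Real.cos α ^ 2 := by
  rw [topIm, Real.sinh_arsinh, Real.sq_sqrt (one_div_sub_cos_sq_pos hx α).le]

theorem topIm_pos (hx : x ∈ Ioo (0 : ℝ) 1) (α : ℝ) : 0 < topIm x α :=
  Real.arsinh_pos_iff.2 (Real.sqrt_pos.2 (one_div_sub_cos_sq_pos hx α))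

theorem mk_topIm_mem_quarter (hx : x ∈ Ioo (0 : ℝ) 1) {α : ℝ} (h0 : 0 ≤ α)
    (h1 : α ≤ Real.pi / 2) : (⟨α, topIm x α⟩ : ℂ) ∈ quarter x := by
  refine ⟨⟨h0, h1⟩, (topIm_pos hx α).le, ?_⟩
  rw [normSq_cos]
  simp only
  rw [sinh_topIm_sq hx]
  linarith

theorem hasDerivAt_topIm (hx : x ∈ Ioo (0 : ℝ) 1) (α : ℝ) :
    HasDerivAt (topIm x) (Real.sin α * Real.cos α /
      (Real.sinh (topIm x α) * Real.cosh (topIm x α))) α := by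
  have hp := one_div_sub_cos_sq_pos hx α
  have h1 := (((Real.hasDerivAt_cos α).pow 2).const_sub (1 / x)).sqrt hp.ne'
  have h2 := h1.arsinh
  refine h2.congr_deriv ?_
  have e1 : Real.sinh (topIm x α) = Real.sqrt (1 / x - Real.cos α ^ 2) := by
    rw [topIm, Real.sinh_arsinh]
  have e2 : Real.cosh (topIm x α) = Real.sqrt (1 + Real.sqrt (1 / x - Real.cos α ^ 2) ^ 2) := by
    rw [topIm, Real.cosh_arsinh]
  rw [e1, e2]
  have q1 := Real.sqrt_pos.2 hp
  have q2 : 0 < Real.sqrt (1 + Real.sqrt (1 / x - Real.cos α ^ 2) ^ 2) :=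
    Real.sqrt_pos.2 (by positivity)
  simp only [smul_eq_mul, Pi.pow_apply]
  generalize Real.sqrt (1 + Real.sqrt (1 / x - Real.cos α ^ 2) ^ 2) = r at q2 ⊢
  generalize Real.sqrt (1 / x - Real.cos α ^ 2) = s at q1 ⊢
  push_cast
  field_simp

/-- On the top edge x (sinh²b + cos²α) = 1, which makes the radicand a perfect square; the root
exhibited has positive real part, hence is the principal one. -/
theorem ampD_topIm (hx : x ∈ Ioo (0 : ℝ) 1) (α : ℝ) :
    ampD x ⟨α, topIm x α⟩ = 1 / (x * (⟨Real.sinh (topIm x α) * Real.cosh (topIm x α),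
      Real.sin α * Real.cos α⟩ : ℂ)) := by
  set b := topIm x α with hb
  have hs : Real.sinh b ^ 2 = 1 / x - Real.cos α ^ 2 := sinh_topIm_sq hx α
  have hs' : x * (Real.sinh b ^ 2 + Real.cos α ^ 2) = 1 := by
    rw [hs]; field_simp [hx.1.ne']; ring
  have hbpos : 0 < b := topIm_pos hx α
  have hre : 0 < ((x : ℂ) * (⟨Real.sinh b * Real.cosh b, Real.sin α * Real.cos α⟩ : ℂ)).re := by
    rw [Complex.re_ofReal_mul]
    exact mul_pos hx.1 (mul_pos (Real.sinh_pos_iff.2 hbpos) (Real.cosh_pos b))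
  have hsq : 1 - (x : ℂ) ^ 2 * cos (⟨α, b⟩ : ℂ) ^ 2 =
      ((x : ℂ) * (⟨Real.sinh b * Real.cosh b, Real.sin α * Real.cos α⟩ : ℂ)) ^ 2 := by
    apply Complex.ext
    · rw [ampD_base_re, mul_pow, ← Complex.ofReal_pow, Complex.re_ofReal_mul, pow_two (⟨_, _⟩ : ℂ),
        Complex.mul_re]
      simp only
      have h1 := Real.sin_sq_add_cos_sq α
      have h2 := Real.cosh_sq b
      have h3 : Real.sin α ^ 2 = 1 - Real.cos α ^ 2 := by linarith
      have h4 : (x * (Real.sinh b ^ 2 + Real.cos α ^ 2)) ^ 2 = 1 := by rw [hs', one_pow]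
      have e1 : Real.sinh b * Real.cosh b * (Real.sinh b * Real.cosh b) -
          Real.sin α * Real.cos α * (Real.sin α * Real.cos α) =
          Real.sinh b ^ 2 * Real.cosh b ^ 2 - Real.sin α ^ 2 * Real.cos α ^ 2 := by ring
      rw [e1, h2, h3]
      linear_combination -h4
    · rw [ampD_base_im, mul_pow, ← Complex.ofReal_pow, Complex.im_ofReal_mul, pow_two (⟨_, _⟩ : ℂ),
        Complex.mul_im]
      simp only
      ring
  rw [ampD, hsq, one_div (2 : ℂ), Complex.sq_cpow_two_inv hre]

/-- The tangent of the top edge is a real multiple of sinh b cosh b + i sin α cos α, so `ampD` times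
the tangent is real and Im `amp` is constant. At α = π/2 it is evaluated by `legE_arctan`. -/
theorem amp_topIm (hx : x ∈ Ioo (0 : ℝ) 1) {α : ℝ} (h0 : 0 ≤ α) (h1 : α ≤ Real.pi / 2) :
    (amp x ⟨α, topIm x α⟩).im = ellK (Real.sqrt (1 - x ^ 2)) / 2 := by
  have hd : ∀ t ∈ Icc 0 (Real.pi / 2), HasDerivAt (fun t => (amp x ⟨t, topIm x t⟩).im) 0 t := by
    intro t ht
    have h := (hasDerivAt_amp_mk hx (hasDerivAt_id' t) (hasDerivAt_topIm hx t)
      (quarter_subset_slitStrip hx (mk_topIm_mem_quarter hx ht.1 ht.2))).2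
    refine h.congr_deriv ?_
    rw [ampD_topIm hx]
    have hs := Real.sinh_pos_iff.2 (topIm_pos hx t)
    have hc := Real.cosh_pos (topIm x t)
    set S := Real.sinh (topIm x t)
    set C := Real.cosh (topIm x t)
    have e : (⟨1, Real.sin t * Real.cos t / (S * C)⟩ : ℂ) =
        ((1 / (S * C) : ℝ) : ℂ) * (⟨S * C, Real.sin t * Real.cos t⟩ : ℂ) := by
      apply Complex.ext
      · rw [Complex.re_ofReal_mul]
        field_simp
      · rw [Complex.im_ofReal_mul]
        field_simp
    have hne : (⟨S * C, Real.sin t * Real.cos t⟩ : ℂ) ≠ 0 := by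
      intro h
      have := congrArg Complex.re h
      simp only [Complex.zero_re] at this
      exact (mul_pos hs hc).ne' this
    have hxc : (x : ℂ) ≠ 0 := by exact_mod_cast hx.1.ne'
    have e2 : 1 / ((x : ℂ) * (⟨S * C, Real.sin t * Real.cos t⟩ : ℂ)) *
        ⟨1, Real.sin t * Real.cos t / (S * C)⟩ = ((1 / x * (1 / (S * C)) : ℝ) : ℂ) := by
      rw [e]
      push_cast
      field_simp
    rw [e2, Complex.ofReal_im]
  have hconst : (amp x ⟨α, topIm x α⟩).im = (amp x ⟨Real.pi / 2, topIm x (Real.pi / 2)⟩).im := by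
    have h2 := constant_of_derivWithin_zero (f := fun t => (amp x ⟨t, topIm x t⟩).im)
      (a := 0) (b := Real.pi / 2)
      (fun t ht => (hd t ht).differentiableAt.differentiableWithinAt)
      (fun t ht => (hd t (Ico_subset_Icc_self ht)).hasDerivWithinAt.derivWithin
        (uniqueDiffOn_Icc Real.pi_div_two_pos t (Ico_subset_Icc_self ht)))
    rw [h2 α ⟨h0, h1⟩, h2 (Real.pi / 2) ⟨Real.pi_div_two_pos.le, le_rfl⟩]
  rw [hconst, (amp_pi_div_two_add hx _).2, topIm, Real.sinh_arsinh, Real.cos_pi_div_two,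
    zero_pow two_ne_zero, sub_zero, Real.sqrt_div zero_le_one, Real.sqrt_one, legE_arctan hx]

/-- The position of the values of `amp` on the quarter. -/
theorem amp_mem (hx : x ∈ Ioo (0 : ℝ) 1) {χ : ℂ} (hχ : χ ∈ quarter x) :
    (0 ≤ (amp x χ).re ∧ (amp x χ).re ≤ ellK x) ∧ 0 ≤ (amp x χ).im ∧
    (χ.re = 0 → (amp x χ).re = 0) ∧ (0 < χ.re → 0 < (amp x χ).re) ∧
    (χ.re = Real.pi / 2 → (amp x χ).re = ellK x) ∧
    (χ.re < Real.pi / 2 → (amp x χ).re < ellK x) ∧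
    (χ.im = 0 → (amp x χ).im = 0) ∧ (0 < χ.im → 0 < (amp x χ).im) := by
  obtain ⟨α, b⟩ := χ
  have hα0 : 0 ≤ α := hχ.1.1
  have hα1 : α ≤ Real.pi / 2 := hχ.1.2
  have hb : 0 ≤ b := hχ.2.1
  have i1 : α = 0 → (amp x ⟨α, b⟩).re = 0 := by
    rintro rfl
    have h1 : x * Real.cosh b < 1 := (quarter_subset_slitStrip hx hχ).2.resolve_left (by simp)
    have h2 : (⟨0, b⟩ : ℂ) = b * I := by apply Complex.ext <;> simp
    rw [h2]
    exact amp_im_mul_I hx h1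
  have i2 : 0 < α → 0 < (amp x ⟨α, b⟩).re := by
    intro h
    have h1 := (amp_vertical hx hχ le_rfl).2 hb
    have h2 := (amp_horizontal hx (mk_zero_mem_quarter hx le_rfl Real.pi_div_two_pos.le) hα1).1 h
    have h3 : amp x ⟨0, 0⟩ = 0 := segIntegral_zero _
    rw [h3, Complex.zero_re] at h2
    linarith
  have i3 : α = Real.pi / 2 → (amp x ⟨α, b⟩).re = ellK x := by
    rintro rfl
    exact (amp_pi_div_two_add hx b).1
  have i4 : α < Real.pi / 2 → (amp x ⟨α, b⟩).re < ellK x := by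
    intro h
    rw [← (amp_pi_div_two_add hx b).1]
    exact (amp_horizontal hx hχ le_rfl).1 h
  have i5 : b = 0 → (amp x ⟨α, b⟩).im = 0 := by
    rintro rfl
    exact amp_mk_zero_im hx hα0 hα1
  have i6 : 0 < b → 0 < (amp x ⟨α, b⟩).im := by
    intro h
    rw [← amp_mk_zero_im hx hα0 hα1]
    exact (amp_vertical hx hχ le_rfl).1 h
  refine ⟨⟨?_, ?_⟩, ?_, i1, i2, i3, i4, i5, i6⟩
  · rcases hα0.eq_or_lt with h | h
    · exact (i1 h.symm).ge
    · exact (i2 h).le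
  · rcases hα1.eq_or_lt with h | h
    · exact (i3 h).le
    · exact (i4 h).le
  · rcases hb.eq_or_lt with h | h
    · exact (i5 h.symm).ge
    · exact (i6 h).le

theorem amp_im_lt (hx : x ∈ Ioo (0 : ℝ) 1) {χ : ℂ} (hχ : χ ∈ quarter x)
    (hlt : normSq (cos χ) < 1 / x) : (amp x χ).im < ellK (Real.sqrt (1 - x ^ 2)) / 2 := by
  obtain ⟨α, b⟩ := χ
  have hα0 : 0 ≤ α := hχ.1.1
  have hα1 : α ≤ Real.pi / 2 := hχ.1.2
  have hb : 0 ≤ b := hχ.2.1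
  rw [← amp_topIm hx hα0 hα1]
  refine (amp_vertical hx (mk_topIm_mem_quarter hx hα0 hα1) hb).1 ?_
  rw [normSq_cos] at hlt
  have h1 : Real.sinh b ^ 2 < Real.sinh (topIm x α) ^ 2 := by
    rw [sinh_topIm_sq hx]
    simp only at hlt
    linarith
  exact Real.sinh_lt_sinh.1 (lt_of_pow_lt_pow_left₀ 2
    (Real.sinh_nonneg_iff.2 (topIm_pos hx α).le) h1)

theorem amp_im_eq (hx : x ∈ Ioo (0 : ℝ) 1) {χ : ℂ} (hχ : χ ∈ quarter x)
    (heq : normSq (cos χ) = 1 / x) : (amp x χ).im = ellK (Real.sqrt (1 - x ^ 2)) / 2 := by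
  obtain ⟨α, b⟩ := χ
  have hb : 0 ≤ b := hχ.2.1
  rw [← amp_topIm hx hχ.1.1 hχ.1.2]
  rw [normSq_cos] at heq
  have h1 : Real.sinh b ^ 2 = Real.sinh (topIm x α) ^ 2 := by
    rw [sinh_topIm_sq hx]
    simp only at heq
    linarith
  have h2 := (pow_left_inj₀ (Real.sinh_nonneg_iff.2 hb)
    (Real.sinh_nonneg_iff.2 (topIm_pos hx α).le) two_ne_zero).1 h1
  rw [Real.sinh_injective h2]

end Quarter

/-! ### The function `sinF` on the disk |v|² < 1/x. -/

section SineOfEllF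

variable {x : ℝ}

/-- Reflection in the coordinate axes. -/
def refl (ε δ : ℝ) (y : ℂ) : ℂ := ⟨ε * y.re, δ * y.im⟩

theorem refl_cases {ε δ : ℝ} (hε : ε = 1 ∨ ε = -1) (hδ : δ = 1 ∨ δ = -1) :
    refl ε δ = id ∨ refl ε δ = starRingEnd ℂ ∨ (refl ε δ = fun y => -y) ∨
      refl ε δ = fun y => -starRingEnd ℂ y := by
  rcases hε with rfl | rfl <;> rcases hδ with rfl | rfl
  · left; funext y; apply Complex.ext <;> simp [refl]
  · right; left; funext y; apply Complex.ext <;> simp [refl]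
  · right; right; right; funext y; apply Complex.ext <;> simp [refl]
  · right; right; left; funext y; apply Complex.ext <;> simp [refl]

theorem normSq_refl {ε δ : ℝ} (hε : ε = 1 ∨ ε = -1) (hδ : δ = 1 ∨ δ = -1) (y : ℂ) :
    normSq (refl ε δ y) = normSq y := by
  rcases refl_cases hε hδ with h | h | h | h <;> simp [h]

theorem continuous_refl (ε δ : ℝ) : Continuous (refl ε δ) := by
  have : refl ε δ = fun y : ℂ => ((ε * y.re : ℝ) : ℂ) + ((δ * y.im : ℝ) : ℂ) * I := by
    funext y; exact Complex.mk_eq_add_mul_I _ _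
  rw [this]
  fun_prop

/-- Points are folded into the closed fourth quadrant because that is where cos sends the quarter.
-/
theorem exists_refl (v : ℂ) : ∃ ε δ : ℝ, (ε = 1 ∨ ε = -1) ∧ (δ = 1 ∨ δ = -1) ∧
    ∃ q : ℂ, 0 ≤ q.re ∧ q.im ≤ 0 ∧ v = refl ε δ q := by
  have h1 : ∃ ε : ℝ, (ε = 1 ∨ ε = -1) ∧ ∃ a, 0 ≤ a ∧ v.re = ε * a := by
    rcases le_total 0 v.re with h | h
    · exact ⟨1, .inl rfl, v.re, h, by ring⟩
    · exact ⟨-1, .inr rfl, -v.re, by linarith, by ring⟩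
  have h2 : ∃ δ : ℝ, (δ = 1 ∨ δ = -1) ∧ ∃ b, b ≤ 0 ∧ v.im = δ * b := by
    rcases le_total v.im 0 with h | h
    · exact ⟨1, .inl rfl, v.im, h, by ring⟩
    · exact ⟨-1, .inr rfl, -v.im, by linarith, by ring⟩
  obtain ⟨ε, hε, a, ha, hva⟩ := h1
  obtain ⟨δ, hδ, b, hb, hvb⟩ := h2
  exact ⟨ε, δ, hε, hδ, ⟨a, b⟩, ha, hb, Complex.ext hva hvb⟩

theorem exists_mem_quarter {q : ℂ} (h1 : 0 ≤ q.re) (h2 : q.im ≤ 0) (h3 : normSq q ≤ 1 / x) :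
    ∃ χ ∈ quarter x, cos χ = q := by
  have hpi := Real.pi_pos
  have step1 : ∃ χ : ℂ, cos χ = q ∧ |χ.re| ≤ Real.pi := by
    obtain ⟨η, hη⟩ := Complex.cos_surjective q
    have hmem := sub_toIocDiv_zsmul_mem_Ioc Real.two_pi_pos (-Real.pi) η.re
    set m := toIocDiv Real.two_pi_pos (-Real.pi) η.re
    refine ⟨η - m * (2 * Real.pi), by rw [Complex.cos_sub_int_mul_two_pi, hη], ?_⟩
    have : (η - m * (2 * Real.pi)).re = η.re - m • (2 * Real.pi) := by simp
    rw [this, abs_le]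
    exact ⟨hmem.1.le, by linarith [hmem.2]⟩
  have step2 : ∃ χ : ℂ, cos χ = q ∧ 0 ≤ χ.re ∧ χ.re ≤ Real.pi := by
    obtain ⟨χ, hχ, hle⟩ := step1
    obtain ⟨h4, h5⟩ := abs_le.1 hle
    rcases le_total 0 χ.re with h | h
    · exact ⟨χ, hχ, h, h5⟩
    · exact ⟨-χ, by rw [Complex.cos_neg, hχ], by rw [Complex.neg_re]; linarith,
        by rw [Complex.neg_re]; linarith⟩
  obtain ⟨χ, rfl, h4, h5⟩ := step2
  rw [cos_re] at h1
  rw [cos_im] at h2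
  have h6 : χ.re ≤ Real.pi / 2 := by
    by_contra! h
    have h7 := Real.cos_neg_of_pi_div_two_lt_of_lt h (by linarith)
    nlinarith [Real.cosh_pos χ.im]
  rcases h4.eq_or_lt with h | h
  · rcases le_total 0 χ.im with h7 | h7
    · exact ⟨χ, ⟨⟨h4, h6⟩, h7, h3⟩, rfl⟩
    · refine ⟨-χ, ⟨⟨?_, ?_⟩, ?_, ?_⟩, Complex.cos_neg χ⟩
      · rw [Complex.neg_re, ← h, neg_zero]
      · rw [Complex.neg_re, ← h, neg_zero]; linarith
      · rw [Complex.neg_im]; linarith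
      · rwa [Complex.cos_neg]
  · refine ⟨χ, ⟨⟨h4, h6⟩, ?_, h3⟩, rfl⟩
    have h7 := Real.sin_pos_of_pos_of_lt_pi h (by linarith)
    by_contra! h8
    have h9 := Real.sinh_neg_iff.2 h8
    nlinarith [mul_neg_of_pos_of_neg h7 h9]

/-- `sin (π / (2 K) · ellF v)`. -/
noncomputable def sinF (x : ℝ) (v : ℂ) : ℂ :=
  sin ((Real.pi : ℂ) / (2 * (ellK x : ℂ)) * ellF x v)

/-- The rescaled elliptic integral. -/
noncomputable def ampS (x : ℝ) (χ : ℂ) : ℂ := (Real.pi : ℂ) / (2 * (ellK x : ℂ)) * amp x χ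

theorem ampS_eq (χ : ℂ) : ampS x χ = ((Real.pi / (2 * ellK x) : ℝ) : ℂ) * amp x χ := by
  rw [ampS]; push_cast; rfl

theorem sinF_neg (v : ℂ) : sinF x (-v) = -sinF x v := by
  have : ellF x (-v) = -ellF x v := by
    simp only [ellF, segIntegral, mul_neg, neg_sq, intervalIntegral.integral_neg]
  rw [sinF, this, mul_neg, Complex.sin_neg, sinF]

theorem sinF_cos (hx : x ∈ Ioo (0 : ℝ) 1) {χ : ℂ} (hχ : χ ∈ slitStrip x)
    (hlt : normSq (cos χ) < 1 / x) : sinF x (cos χ) = cos (ampS x χ) :=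
  sin_ellF_cos hx hχ.1 hlt

/-- `sinF` is odd, and conjugation reduces to `amp_conj`: the conjugate of χ may leave the quarter
but stays in the slit strip. -/
theorem sinF_refl_cos (hx : x ∈ Ioo (0 : ℝ) 1) {ε δ : ℝ} (hε : ε = 1 ∨ ε = -1)
    (hδ : δ = 1 ∨ δ = -1) {χ : ℂ} (hχ : χ ∈ quarter x) (hlt : normSq (cos χ) < 1 / x) :
    sinF x (refl ε δ (cos χ)) = refl ε δ (cos (ampS x χ)) := by
  have hs := quarter_subset_slitStrip hx hχ
  have h1 := sinF_cos hx hs hlt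
  have hconj : sinF x (starRingEnd ℂ (cos χ)) = starRingEnd ℂ (cos (ampS x χ)) := by
    rw [← Complex.cos_conj, sinF_cos hx (by simpa [slitStrip] using hs)
      (by rwa [Complex.cos_conj, Complex.normSq_conj]), ← Complex.cos_conj, ampS_eq, ampS_eq,
      map_mul, Complex.conj_ofReal, amp_conj hx hs]
  rcases refl_cases hε hδ with h | h | h | h <;> simp only [h, id, sinF_neg, h1, hconj]

theorem ampS_mem (hx : x ∈ Ioo (0 : ℝ) 1) {χ : ℂ} (hχ : χ ∈ quarter x) :
    (0 ≤ (ampS x χ).re ∧ (ampS x χ).re ≤ Real.pi / 2) ∧ 0 ≤ (ampS x χ).im ∧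
    (χ.re = 0 → (ampS x χ).re = 0) ∧ (0 < χ.re → 0 < (ampS x χ).re) ∧
    (χ.re = Real.pi / 2 → (ampS x χ).re = Real.pi / 2) ∧
    (χ.re < Real.pi / 2 → (ampS x χ).re < Real.pi / 2) ∧
    (χ.im = 0 → (ampS x χ).im = 0) ∧ (0 < χ.im → 0 < (ampS x χ).im) := by
  have hK := ellK_pos (Ioo_subset_Ico_self hx)
  have hc : 0 < Real.pi / (2 * ellK x) := by positivity
  have hcK : Real.pi / (2 * ellK x) * ellK x = Real.pi / 2 := by field_simp
  obtain ⟨⟨h1, h2⟩, h3, h4, h5, h6, h7, h8, h9⟩ := amp_mem hx hχ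
  rw [ampS_eq, Complex.re_ofReal_mul, Complex.im_ofReal_mul, ← hcK]
  refine ⟨⟨mul_nonneg hc.le h1, mul_le_mul_of_nonneg_left h2 hc.le⟩, mul_nonneg hc.le h3,
    fun h => ?_, fun h => mul_pos hc (h5 h), fun h => ?_, fun h => ?_, fun h => ?_,
    fun h => mul_pos hc (h9 h)⟩
  · rw [h4 h, mul_zero]
  · rw [h6 (by rw [h, hcK])]
  · rw [hcK] at h; exact mul_lt_mul_of_pos_left (h7 h) hc
  · rw [h8 h, mul_zero]

theorem ampS_im_lt_iff (hx : x ∈ Ioo (0 : ℝ) 1) {χ : ℂ} (hχ : χ ∈ quarter x) :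
    (ampS x χ).im < Real.pi * ellK (Real.sqrt (1 - x ^ 2)) / (4 * ellK x) ↔
      normSq (cos χ) < 1 / x := by
  have hK := ellK_pos (Ioo_subset_Ico_self hx)
  have hc : 0 < Real.pi / (2 * ellK x) := by positivity
  have e : Real.pi * ellK (Real.sqrt (1 - x ^ 2)) / (4 * ellK x) =
      Real.pi / (2 * ellK x) * (ellK (Real.sqrt (1 - x ^ 2)) / 2) := by field_simp; ring
  rw [ampS_eq, Complex.im_ofReal_mul, e, mul_lt_mul_iff_right₀ hc]
  refine ⟨fun h => lt_of_le_of_ne hχ.2.2 fun heq => ?_, amp_im_lt hx hχ⟩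
  exact h.ne (amp_im_eq hx hχ heq)

theorem cos_injOn_quarterStrip : InjOn cos {η : ℂ | (0 ≤ η.re ∧ η.re ≤ Real.pi / 2) ∧ 0 ≤ η.im} := by
  rintro η ⟨⟨h1, h2⟩, h3⟩ ξ ⟨⟨h4, h5⟩, h6⟩ h
  have hpi := Real.pi_pos
  rw [Complex.cos_eq_cos_iff] at h
  obtain ⟨n, hn⟩ := h
  have e : ((2 : ℂ) * n * Real.pi) = ((2 * n * Real.pi : ℝ) : ℂ) := by push_cast; ring
  rw [e] at hn
  have hn0 : n = 0 := by
    have h4 : |(n : ℝ)| < 1 := by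
      rcases hn with hn | hn <;> have h5 := congrArg Complex.re hn <;>
        simp only [Complex.add_re, Complex.sub_re, Complex.ofReal_re] at h5 <;>
        rw [abs_lt] <;> constructor <;> nlinarith
    have h5 : |n| < 1 := by exact_mod_cast h4
    exact Int.abs_lt_one_iff.1 h5
  subst hn0
  rcases hn with hn | hn
  · simpa using hn.symm
  · have hre := congrArg Complex.re hn
    have him := congrArg Complex.im hn
    simp at hre him
    exact Complex.ext (by linarith) (by linarith)

theorem refl_cancel {ε δ ε' δ' : ℝ} (hε : ε = 1 ∨ ε = -1) (hδ : δ = 1 ∨ δ = -1)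
    (hε' : ε' = 1 ∨ ε' = -1) (hδ' : δ' = 1 ∨ δ' = -1) {y y' : ℂ} (h1 : 0 ≤ y.re) (h2 : y.im ≤ 0)
    (h1' : 0 ≤ y'.re) (h2' : y'.im ≤ 0) (h : refl ε δ y = refl ε' δ' y') : y = y' := by
  have hre : ε * y.re = ε' * y'.re := congrArg Complex.re h
  have him : δ * y.im = δ' * y'.im := congrArg Complex.im h
  apply Complex.ext
  · rcases hε with rfl | rfl <;> rcases hε' with rfl | rfl <;> linarith
  · rcases hδ with rfl | rfl <;> rcases hδ' with rfl | rfl <;> linarith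

theorem cos_quadrant {η : ℂ} (h1 : 0 ≤ η.re) (h2 : η.re ≤ Real.pi / 2) (h3 : 0 ≤ η.im) :
    0 ≤ (cos η).re ∧ (cos η).im ≤ 0 := by
  rw [cos_re, cos_im]
  have h4 := Real.cos_nonneg_of_neg_pi_div_two_le_of_le (by linarith [Real.pi_pos]) h2
  have h5 := Real.sin_nonneg_of_nonneg_of_le_pi h1 (by linarith [Real.pi_pos])
  exact ⟨mul_nonneg h4 (Real.cosh_pos _).le,
    neg_nonpos.2 (mul_nonneg h5 (Real.sinh_nonneg_iff.2 h3))⟩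

/-- After folding, the injectivity of cos on a quarter strip and of `amp` on the quarter identify χ
and χ'. -/
theorem sinF_injOn (hx : x ∈ Ioo (0 : ℝ) 1) : InjOn (sinF x) {v | normSq v < 1 / x} := by
  intro v hv w hw heq
  obtain ⟨ε, δ, hε, hδ, q, hq1, hq2, rfl⟩ := exists_refl v
  obtain ⟨ε', δ', hε', hδ', q', hq1', hq2', rfl⟩ := exists_refl w
  rw [mem_ofPred_eq, normSq_refl hε hδ] at hv
  rw [mem_ofPred_eq, normSq_refl hε' hδ'] at hw
  obtain ⟨χ, hχ, rfl⟩ := exists_mem_quarter hq1 hq2 hv.le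
  obtain ⟨χ', hχ', rfl⟩ := exists_mem_quarter hq1' hq2' hw.le
  rw [sinF_refl_cos hx hε hδ hχ hv, sinF_refl_cos hx hε' hδ' hχ' hw] at heq
  obtain ⟨⟨m1, m2⟩, m3, -, m5, -, m7, -, m9⟩ := ampS_mem hx hχ
  obtain ⟨⟨m1', m2'⟩, m3', -⟩ := ampS_mem hx hχ'
  have hc := cos_quadrant m1 m2 m3
  have hc' := cos_quadrant m1' m2' m3'
  have h1 := refl_cancel hε hδ hε' hδ' hc.1 hc.2 hc'.1 hc'.2 heq
  have h2 := cos_injOn_quarterStrip ⟨⟨m1, m2⟩, m3⟩ ⟨⟨m1', m2'⟩, m3'⟩ h1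
  have hK := ellK_pos (Ioo_subset_Ico_self hx)
  have hcne : (Real.pi : ℂ) / (2 * (ellK x : ℂ)) ≠ 0 := by
    have : Real.pi / (2 * ellK x) ≠ 0 := by positivity
    exact_mod_cast this
  have h3 : χ = χ' := amp_injOn_quarter hx hχ hχ' (mul_left_cancel₀ hcne h2)
  subst h3
  have hre : ε * (cos (ampS x χ)).re = ε' * (cos (ampS x χ)).re := congrArg Complex.re heq
  have him : δ * (cos (ampS x χ)).im = δ' * (cos (ampS x χ)).im := congrArg Complex.im heq
  -- The reflections may differ only where they have no effect: ε matters only if Re cos χ ≠ 0, δ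
  -- only if Im cos χ ≠ 0, and then the matching part of cos(`ampS` χ) is nonzero and fixes the
  -- sign.
  apply Complex.ext
  · change ε * (cos χ).re = ε' * (cos χ).re
    rcases hχ.1.2.eq_or_lt with h | h
    · rw [cos_re, h, Real.cos_pi_div_two]; ring
    · have : 0 < (cos (ampS x χ)).re := by
        rw [cos_re]
        exact mul_pos (Real.cos_pos_of_mem_Ioo ⟨by linarith [Real.pi_pos], m7 h⟩)
          (Real.cosh_pos _)
      rw [mul_right_cancel₀ this.ne' hre]
  · change δ * (cos χ).im = δ' * (cos χ).im
    rcases hχ.1.1.eq_or_lt with h | h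
    · rw [cos_im, ← h, Real.sin_zero]; ring
    rcases hχ.2.1.eq_or_lt with h' | h'
    · rw [cos_im, ← h', Real.sinh_zero]; ring
    · have : (cos (ampS x χ)).im < 0 := by
        rw [cos_im]
        exact neg_neg_of_pos (mul_pos (Real.sin_pos_of_pos_of_lt_pi (m5 h)
          (by linarith [Real.pi_pos])) (Real.sinh_pos_iff.2 (m9 h')))
      rw [mul_right_cancel₀ this.ne him]

theorem hasDerivAt_ampS (hx : x ∈ Ioo (0 : ℝ) 1) {χ : ℂ} (hχ : χ ∈ slitStrip x) :
    HasDerivAt (ampS x) ((Real.pi : ℂ) / (2 * (ellK x : ℂ)) * ampD x χ) χ :=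
  (hasDerivAt_amp hx hχ).const_mul _

theorem eventually_sinF_cos (hx : x ∈ Ioo (0 : ℝ) 1) {χ : ℂ} (hχ : χ ∈ slitStrip x)
    (hlt : normSq (cos χ) < 1 / x) :
    ∀ᶠ s in 𝓝 χ, s ∈ slitStrip x ∧ sinF x (cos s) = cos (ampS x s) := by
  have h1 : ∀ᶠ s in 𝓝 χ, normSq (cos s) < 1 / x :=
    (isOpen_lt (Complex.continuous_normSq.comp Complex.continuous_cos) continuous_const).mem_nhds hlt
  filter_upwards [isOpen_slitStrip.mem_nhds hχ, h1] with s hs hs1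
  exact ⟨hs, sinF_cos hx hs hs1⟩

theorem not_eventually_cos_eq (c : ℂ) : ¬ ∀ᶠ s in 𝓝 c, cos s = cos c := by
  intro h
  have h1 : (fun s => -sin s) =ᶠ[𝓝 c] fun _ => 0 := by
    filter_upwards [h.eventually_nhds] with s hs
    exact (Complex.hasDerivAt_cos s).unique ((hasDerivAt_const s (cos c)).congr_of_eventuallyEq hs)
  have h2 : -cos c = 0 := (Complex.hasDerivAt_sin c).neg.unique
    ((hasDerivAt_const c (0 : ℂ)).congr_of_eventuallyEq h1)
  have h3 : -sin c = 0 := h1.self_of_nhds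
  have h4 := Complex.sin_sq_add_cos_sq c
  rw [neg_eq_zero.1 h2, neg_eq_zero.1 h3] at h4
  norm_num at h4

/-- `sinF` ∘ cos is the analytic function cos ∘ `ampS`, so `analyticAt_of_comp` gives analyticity
even across the slits of `ellF`. -/
theorem analyticAt_sinF (hx : x ∈ Ioo (0 : ℝ) 1) {v : ℂ} (hv : normSq v < 1 / x) :
    AnalyticAt ℂ (sinF x) v := by
  have key : ∀ χ : ℂ, χ ∈ slitStrip x → normSq (cos χ) < 1 / x →
      AnalyticAt ℂ (sinF x) (cos χ) := by
    intro χ hχ hlt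
    refine analyticAt_of_comp (p := cos) (by fun_prop) (not_eventually_cos_eq χ) ?_
    have h1 : AnalyticAt ℂ (fun s => cos (ampS x s)) χ := by
      have : DifferentiableOn ℂ (fun s => cos (ampS x s)) (slitStrip x) := fun s hs =>
        (hasDerivAt_ampS hx hs).differentiableAt.ccos.differentiableWithinAt
      exact this.analyticAt (isOpen_slitStrip.mem_nhds hχ)
    exact h1.congr ((eventually_sinF_cos hx hχ hlt).mono fun s hs => hs.2.symm)
  have hneg : ∀ w : ℂ, AnalyticAt ℂ (sinF x) w → AnalyticAt ℂ (sinF x) (-w) := by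
    intro w hw
    have h1 : AnalyticAt ℂ (fun z => -sinF x (-z)) (-w) := by
      have h2 : AnalyticAt ℂ (sinF x) (-(-w)) := by rwa [neg_neg]
      exact (h2.comp (f := fun z => -z) (by fun_prop)).neg
    exact h1.congr (.of_forall fun z => by simp only [sinF_neg, neg_neg])
  obtain ⟨ε, δ, hε, hδ, q, hq1, hq2, rfl⟩ := exists_refl v
  rw [normSq_refl hε hδ] at hv
  obtain ⟨χ, hχ, rfl⟩ := exists_mem_quarter hq1 hq2 hv.le
  have hs := quarter_subset_slitStrip hx hχ
  have h1 := key χ hs hv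
  have h2 : AnalyticAt ℂ (sinF x) (starRingEnd ℂ (cos χ)) := by
    rw [← Complex.cos_conj]
    exact key _ (by simpa [slitStrip] using hs) (by rwa [Complex.cos_conj, Complex.normSq_conj])
  rcases refl_cases hε hδ with h | h | h | h <;> rw [h]
  · exact h1
  · exact h2
  · exact hneg _ h1
  · exact hneg _ h2

/-- v = 1 is the critical value of cos at χ = 0, so the derivative comes from `deriv_eq_of_comp`.
Oddness carries it to v = -1, the image of z = 0. -/
theorem sinF_one (hx : x ∈ Ioo (0 : ℝ) 1) : sinF x 1 = 1 ∧
    deriv (sinF x) 1 = ((Real.pi : ℂ) / (2 * (ellK x : ℂ))) ^ 2 / (1 - (x : ℂ) ^ 2) := by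
  have h0 : (0 : ℂ) ∈ slitStrip x := ⟨by simpa using Real.pi_pos, .inr (by simpa using hx.2)⟩
  have h0lt : normSq (cos 0) < 1 / x := by simpa using (one_lt_div hx.1).2 hx.2
  have ha0 : ampS x 0 = 0 := by rw [ampS, amp, segIntegral_zero, mul_zero]
  have hev := eventually_sinF_cos hx h0 h0lt
  have h1 := hev.self_of_nhds.2
  rw [ha0, Complex.cos_zero] at h1
  refine ⟨h1, ?_⟩
  have hD : DifferentiableAt ℂ (ampD x) 0 := differentiableAt_inv_cpow_half
    (f := fun χ => 1 - (x : ℂ) ^ 2 * cos χ ^ 2) (by fun_prop) (ampD_base_mem_slitPlane hx h0)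
  have han : AnalyticAt ℂ (sinF x) (cos 0) := analyticAt_sinF hx h0lt
  have key := deriv_eq_of_comp (P := sinF x) (p := cos) (e := fun s => cos (ampS x s)) (c := 0)
    (p' := fun s => -sin s) (p₂ := -1)
    (e' := fun s => -sin (ampS x s) * ((Real.pi : ℂ) / (2 * (ellK x : ℂ)) * ampD x s))
    (e₂ := -((Real.pi : ℂ) / (2 * (ellK x : ℂ)) * ampD x 0) ^ 2) han
    (.of_forall Complex.hasDerivAt_cos)
    (hev.mono fun s hs => (hasDerivAt_ampS hx hs.1).ccos) (hev.mono fun s hs => hs.2)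
    ((Complex.hasDerivAt_sin 0).neg.congr_deriv (by simp))
    (((hasDerivAt_ampS hx h0).csin.neg.mul (hD.hasDerivAt.const_mul _)).congr_deriv (by
      simp [ha0]; ring)) (by simp) (by norm_num)
  have hsq : ampD x 0 ^ 2 = 1 / (1 - (x : ℂ) ^ 2) := by
    rw [ampD, div_pow, sq_cpow_half]
    simp
  rw [Complex.cos_zero] at key
  rw [key, mul_pow, hsq]
  ring

end SineOfEllF

/-! ### The map `P` for k > 1. -/

section ConformalEllipse

variable {x : ℝ}

/-- `norm_one_sub_cos` at η + π factors the inequality as (k - cos Re η)(k - cosh Im η) > 0, and the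
first factor is positive since k > 1. -/
theorem mem_Omega_iff_abs_im_lt {k M : ℝ} (hk : 1 < k) (hM : 0 ≤ M) (hkM : k = Real.cosh M)
    (η : ℂ) : 1 / ((k : ℂ) ^ 2 - 1) * cos η + (k : ℂ) ^ 2 / ((k : ℂ) ^ 2 - 1) ∈ Omega k ↔
      |η.im| < M := by
  have hk2 : 0 < k ^ 2 - 1 := by nlinarith
  have hk2c : (k : ℂ) ^ 2 - 1 ≠ 0 := by exact_mod_cast hk2.ne'
  have h1 : 1 / ((k : ℂ) ^ 2 - 1) * cos η + (k : ℂ) ^ 2 / ((k : ℂ) ^ 2 - 1) - 1 =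
      ((k ^ 2 - 1 : ℝ) : ℂ)⁻¹ * (1 - cos (η + Real.pi)) := by
    rw [Complex.cos_add_pi]; push_cast; field_simp; ring
  have h2 : (1 / ((k : ℂ) ^ 2 - 1) * cos η + (k : ℂ) ^ 2 / ((k : ℂ) ^ 2 - 1)).re =
      (k ^ 2 - 1)⁻¹ * (Real.cos η.re * Real.cosh η.im + k ^ 2) := by
    have : 1 / ((k : ℂ) ^ 2 - 1) * cos η + (k : ℂ) ^ 2 / ((k : ℂ) ^ 2 - 1) =
        (((k ^ 2 - 1)⁻¹ : ℝ) : ℂ) * (cos η + ((k ^ 2 : ℝ) : ℂ)) := by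
      push_cast; field_simp
    rw [this, Complex.re_ofReal_mul, Complex.add_re, cos_re, Complex.ofReal_re]
  have h3 : (k * ‖1 / ((k : ℂ) ^ 2 - 1) * cos η + (k : ℂ) ^ 2 / ((k : ℂ) ^ 2 - 1) - 1‖ <
      (1 / ((k : ℂ) ^ 2 - 1) * cos η + (k : ℂ) ^ 2 / ((k : ℂ) ^ 2 - 1)).re) ↔
      0 < (k - Real.cos η.re) * (k - Real.cosh η.im) := by
    rw [h1, h2, norm_mul, norm_one_sub_cos, norm_inv, Complex.norm_real,
      Real.norm_of_nonneg hk2.le, mul_left_comm, mul_lt_mul_iff_right₀ (inv_pos.2 hk2), ← sub_pos]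
    simp only [Complex.add_re, Complex.add_im, Complex.ofReal_re, Complex.ofReal_im,
      Real.cos_add_pi, add_zero]
    constructor <;> intro h <;> linarith
  have h4 : 0 < k - Real.cos η.re := by linarith [Real.cos_le_one η.re]
  refine h3.trans ((mul_pos_iff_of_pos_left h4).trans ?_)
  rw [sub_pos]
  conv_lhs => rw [hkM]
  rw [Real.cosh_lt_cosh, abs_of_nonneg hM]

theorem exists_cos_eq_refl {ε δ : ℝ} (hε : ε = 1 ∨ ε = -1) (hδ : δ = 1 ∨ δ = -1) (η : ℂ) :
    ∃ ξ : ℂ, refl ε δ (cos η) = cos ξ ∧ |ξ.im| = |η.im| := by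
  rcases refl_cases hε hδ with h | h | h | h <;> rw [h]
  · exact ⟨η, rfl, rfl⟩
  · exact ⟨starRingEnd ℂ η, (Complex.cos_conj η).symm, by simp⟩
  · exact ⟨η + Real.pi, (Complex.cos_add_pi η).symm, by simp⟩
  · refine ⟨starRingEnd ℂ η + Real.pi, ?_, by simp⟩
    rw [Complex.cos_add_pi, Complex.cos_conj]

theorem isCompact_quarter : IsCompact (quarter x) := by
  have hcl : IsClosed (quarter x) := by
    refine IsClosed.inter (IsClosed.inter (isClosed_le continuous_const Complex.continuous_re)
      (isClosed_le Complex.continuous_re continuous_const)) (IsClosed.inter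
      (isClosed_le continuous_const Complex.continuous_im) ?_)
    exact isClosed_le (Complex.continuous_normSq.comp Complex.continuous_cos) continuous_const
  have hK : IsCompact (Icc (0 : ℝ) (Real.pi / 2) ×ℂ
      Icc (0 : ℝ) (Real.arsinh (Real.sqrt (1 / x)))) := isCompact_Icc.reProdIm isCompact_Icc
  refine hK.of_isClosed_subset hcl fun χ hχ => ?_
  obtain ⟨h1, h2, h3⟩ := hχ
  refine ⟨h1, h2, ?_⟩
  rw [normSq_cos] at h3
  have h4 : Real.sinh χ.im ^ 2 ≤ 1 / x := by nlinarith [sq_nonneg (Real.cos χ.re)]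
  rw [← Real.sinh_le_sinh, Real.sinh_arsinh]
  exact Real.le_sqrt_of_sq_le h4

/-- The argument of `sinF` in the definition of `P`. -/
noncomputable def uScaled (x : ℝ) (z : ℂ) : ℂ := u x z / (Real.sqrt x : ℂ)

theorem u_eq_mob (z : ℂ) : u x z = mob (-(Real.sqrt x : ℂ)) z := by
  rw [u, mob, map_neg, Complex.conj_ofReal, neg_mul, ← sub_eq_add_neg, ← sub_eq_add_neg]

theorem norm_neg_sqrt_lt_one (hx : x ∈ Ioo (0 : ℝ) 1) : ‖-(Real.sqrt x : ℂ)‖ < 1 := by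
  rw [norm_neg, Complex.norm_real, Real.norm_of_nonneg (Real.sqrt_nonneg x)]
  rw [Real.sqrt_lt' one_pos]
  simpa using hx.2

theorem mul_mem_disk_iff (hx : x ∈ Ioo (0 : ℝ) 1) (v : ℂ) :
    (Real.sqrt x : ℂ) * v ∈ disk ↔ normSq v < 1 / x := by
  rw [mem_ball_zero_iff, ← sq_lt_one_iff₀ (norm_nonneg _), Complex.sq_norm, map_mul,
    Complex.normSq_ofReal, Real.mul_self_sqrt hx.1.le, lt_div_iff₀ hx.1, mul_comm]

theorem bijOn_uScaled (hx : x ∈ Ioo (0 : ℝ) 1) :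
    BijOn (uScaled x) disk {v | normSq v < 1 / x} := by
  have hb := bijOn_mob (norm_neg_sqrt_lt_one hx)
  have hs : (Real.sqrt x : ℂ) ≠ 0 := by exact_mod_cast (Real.sqrt_pos.2 hx.1).ne'
  refine ⟨fun z hz => ?_, fun z hz w hw h => ?_, fun v hv => ?_⟩
  · rw [mem_ofPred_eq, ← mul_mem_disk_iff hx, uScaled, mul_div_cancel₀ _ hs, u_eq_mob]
    exact hb.mapsTo hz
  · refine hb.injOn hz hw ?_
    simp only [uScaled] at h
    rw [← u_eq_mob, ← u_eq_mob]
    exact (div_left_inj' hs).1 h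
  · obtain ⟨z, hz, hzv⟩ := hb.surjOn ((mul_mem_disk_iff hx v).2 hv)
    refine ⟨z, hz, ?_⟩
    rw [uScaled, u_eq_mob, hzv, mul_div_cancel_left₀ _ hs]

theorem hasDerivAt_uScaled (hx : x ∈ Ioo (0 : ℝ) 1) {z : ℂ} (hz : z ∈ disk) :
    HasDerivAt (uScaled x) ((1 - (x : ℂ)) / (1 - (Real.sqrt x : ℂ) * z) ^ 2 / (Real.sqrt x : ℂ))
      z := by
  have h := (hasDerivAt_mob (one_add_ne_zero (norm_neg_sqrt_lt_one hx)
    (mem_ball_zero_iff.1 hz).le)).div_const (Real.sqrt x : ℂ)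
  have e : uScaled x = fun z => mob (-(Real.sqrt x : ℂ)) z / (Real.sqrt x : ℂ) := by
    funext z; rw [uScaled, u_eq_mob]
  rw [e]
  refine h.congr_deriv ?_
  rw [map_neg, Complex.conj_ofReal, neg_mul_neg, ← Complex.ofReal_mul, Real.mul_self_sqrt hx.1.le,
    neg_mul, ← sub_eq_add_neg]

theorem uScaled_zero (hx : x ∈ Ioo (0 : ℝ) 1) : uScaled x 0 = -1 := by
  have hs : (Real.sqrt x : ℂ) ≠ 0 := by exact_mod_cast (Real.sqrt_pos.2 hx.1).ne'
  rw [uScaled, u]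
  field_simp
  simp

/-- Injectivity comes from `sinF_injOn`. Surjectivity is topological: the image of the disk is open,
and closed relative to the connected set Ω_k because boundary points of the quarter land outside
Ω_k. -/
theorem conformal_gt_one {k : ℝ} (hk : 1 < k) (hkx : IsModulus k x) :
    IsConvexMap (P k x) (Omega k) ∧ P k x 0 = 1 ∧
    deriv (P k x) 0 = (alpha k x : ℂ) ∧ 0 < alpha k x := by
  have hx : x ∈ Ioo (0 : ℝ) 1 := ⟨hkx.1, hkx.2.1⟩
  have hxI := Ioo_subset_Ico_self hx
  have hK := ellK_pos hxI
  have hK' := ellK_pos (Ioo_subset_Ico_self (sqrt_one_sub_sq_mem hx))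
  set M := Real.pi * ellK (Real.sqrt (1 - x ^ 2)) / (4 * ellK x) with hMdef
  have hM : 0 ≤ M := by positivity
  have hkM : k = Real.cosh M := hkx.2.2
  have hk2 : 0 < k ^ 2 - 1 := by nlinarith
  have hk2c : (k : ℂ) ^ 2 - 1 ≠ 0 := by exact_mod_cast hk2.ne'
  have hsx := Real.sqrt_pos.2 hx.1
  set T : ℂ → ℂ := fun y => 1 / ((k : ℂ) ^ 2 - 1) * y + (k : ℂ) ^ 2 / ((k : ℂ) ^ 2 - 1) with hT
  have hP : P k x = fun z => T (sinF x (uScaled x z)) := by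
    funext z
    simp [P, hk.not_gt, hk.ne', hT, sinF, uScaled]
  have hTinj : Function.Injective T := by
    intro y y' h
    simp only [hT] at h
    have hne : 1 / ((k : ℂ) ^ 2 - 1) ≠ 0 := by simp [hk2c]
    exact mul_left_cancel₀ hne (add_right_cancel h)
  have hmem : ∀ ε δ : ℝ, (ε = 1 ∨ ε = -1) → (δ = 1 ∨ δ = -1) → ∀ χ ∈ quarter x,
      (T (refl ε δ (cos (ampS x χ))) ∈ Omega k ↔ normSq (cos χ) < 1 / x) := by
    intro ε δ hε hδ χ hχ
    obtain ⟨ξ, hξ, hξi⟩ := exists_cos_eq_refl hε hδ (ampS x χ)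
    rw [hξ, ← ampS_im_lt_iff hx hχ, mem_Omega_iff_abs_im_lt hk hM hkM, hξi,
      abs_of_nonneg (ampS_mem hx hχ).2.1]
  have hrep : ∀ v : ℂ, normSq v < 1 / x → ∃ ε δ : ℝ, (ε = 1 ∨ ε = -1) ∧ (δ = 1 ∨ δ = -1) ∧
      ∃ χ ∈ quarter x, normSq (cos χ) < 1 / x ∧ sinF x v = refl ε δ (cos (ampS x χ)) := by
    intro v hv
    obtain ⟨ε, δ, hε, hδ, q, hq1, hq2, rfl⟩ := exists_refl v
    rw [normSq_refl hε hδ] at hv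
    obtain ⟨χ, hχ, rfl⟩ := exists_mem_quarter hq1 hq2 hv.le
    exact ⟨ε, δ, hε, hδ, χ, hχ, hv, sinF_refl_cos hx hε hδ hχ hv⟩
  have hb := bijOn_uScaled hx
  have hder : ∀ z ∈ disk, HasDerivAt (P k x) (1 / ((k : ℂ) ^ 2 - 1) *
      (deriv (sinF x) (uScaled x z) *
        ((1 - (x : ℂ)) / (1 - (Real.sqrt x : ℂ) * z) ^ 2 / (Real.sqrt x : ℂ)))) z := by
    intro z hz
    rw [hP]
    have h1 := (analyticAt_sinF hx (hb.mapsTo hz)).differentiableAt.hasDerivAt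
    exact ((h1.comp z (hasDerivAt_uScaled hx hz)).const_mul _).add_const _
  have hdiff : DifferentiableOn ℂ (P k x) disk := fun z hz =>
    (hder z hz).differentiableAt.differentiableWithinAt
  have hmaps : MapsTo (P k x) disk (Omega k) := by
    intro z hz
    obtain ⟨ε, δ, hε, hδ, χ, hχ, hlt, h⟩ := hrep _ (hb.mapsTo hz)
    rw [hP]
    simp only
    rw [h]
    exact (hmem ε δ hε hδ χ hχ).2 hlt
  have hinj : InjOn (P k x) disk := by
    rw [hP]
    exact hTinj.injOn.comp ((sinF_injOn hx).comp hb.injOn hb.mapsTo) (mapsTo_univ _ _)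
  have h0d : (0 : ℂ) ∈ disk := mem_ball_self one_pos
  have hS1 := sinF_one hx
  have hP0 : P k x 0 = 1 := by
    rw [hP]
    simp only [hT]
    rw [uScaled_zero hx, sinF_neg, hS1.1]
    field_simp
    ring
  have hopen : IsOpen (P k x '' disk) := by
    rcases (hdiff.analyticOnNhd isOpen_ball).is_constant_or_isOpen
      (convex_ball (0 : ℂ) 1).isPreconnected with ⟨w, hw⟩ | h
    · exfalso
      have h2 : (1 / 2 : ℂ) ∈ disk := by rw [mem_ball_zero_iff]; norm_num
      have := hinj h0d h2 ((hw _ h0d).trans (hw _ h2).symm)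
      norm_num at this
    · exact h _ subset_rfl isOpen_ball
  have hcompact : ∀ ε δ : ℝ, IsCompact ((fun χ => T (refl ε δ (cos (ampS x χ)))) '' quarter x) := by
    intro ε δ
    refine isCompact_quarter.image_of_continuousOn ?_
    have h1 : ContinuousOn (ampS x) (quarter x) := fun χ hχ =>
      (hasDerivAt_ampS hx (quarter_subset_slitStrip hx hχ)).continuousAt.continuousWithinAt
    have h2 : Continuous fun y => T (refl ε δ (cos y)) := by
      have h3 : Continuous T := by fun_prop
      exact h3.comp ((continuous_refl ε δ).comp Complex.continuous_cos)
    exact h2.comp_continuousOn h1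
  set S : Set ℝ := {1, -1} with hS
  have hSmem : ∀ ε : ℝ, ε ∈ S ↔ ε = 1 ∨ ε = -1 := fun ε => by simp [hS]
  -- C is the compact union of the four reflected images of the closed quarter. It contains P(disk),
  -- and its points in Ω_k come from the disk by `hmem`, so P(disk) and the complement of C are
  -- disjoint open sets covering Ω_k.
  set C : Set ℂ := ⋃ ε ∈ S, ⋃ δ ∈ S, (fun χ => T (refl ε δ (cos (ampS x χ)))) '' quarter x with hC
  have hCclosed : IsClosed C :=
    ((Set.toFinite S).isCompact_biUnion fun ε _ =>
      (Set.toFinite S).isCompact_biUnion fun δ _ => hcompact ε δ).isClosed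
  have hsub : P k x '' disk ⊆ C := by
    rintro _ ⟨z, hz, rfl⟩
    obtain ⟨ε, δ, hε, hδ, χ, hχ, hlt, h⟩ := hrep _ (hb.mapsTo hz)
    simp only [hC, mem_iUnion]
    refine ⟨ε, (hSmem ε).2 hε, δ, (hSmem δ).2 hδ, χ, hχ, ?_⟩
    rw [hP]
    simp only
    rw [h]
  have hcover : Omega k ⊆ P k x '' disk ∪ Cᶜ := by
    intro w hw
    by_cases hwC : w ∈ C
    · left
      simp only [hC, mem_iUnion] at hwC
      obtain ⟨ε, hε, δ, hδ, χ, hχ, rfl⟩ := hwC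
      rw [hSmem] at hε hδ
      have hlt := (hmem ε δ hε hδ χ hχ).1 hw
      obtain ⟨z, hz, hzv⟩ := hb.surjOn (a := refl ε δ (cos χ))
        (by rw [mem_ofPred_eq, normSq_refl hε hδ]; exact hlt)
      refine ⟨z, hz, ?_⟩
      rw [hP]
      simp only
      rw [hzv, sinF_refl_cos hx hε hδ hχ hlt]
    · exact .inr hwC
  have hsurj : Omega k ⊆ P k x '' disk :=
    (convex_Omega (by linarith)).isPreconnected.subset_left_of_subset_union hopen
      hCclosed.isOpen_compl (disjoint_compl_right_iff_subset.2 hsub) hcover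
      ⟨P k x 0, hmaps h0d, mem_image_of_mem _ h0d⟩
  have hα : alpha k x =
      Real.pi ^ 2 / (4 * (k ^ 2 - 1) * ellK x ^ 2 * (1 + x) * Real.sqrt x) := by
    simp [alpha, hk.not_gt, hk.ne']
  refine ⟨⟨hdiff, ⟨hmaps, hinj, hsurj⟩, convex_Omega (by linarith)⟩, hP0, ?_, ?_⟩
  · have hodd : deriv (sinF x) (-1) = deriv (sinF x) 1 := by
      have h1 : HasDerivAt (sinF x) (deriv (sinF x) (-1)) (-1) :=
        (analyticAt_sinF hx (by simpa using (one_lt_div hx.1).2 hx.2)).differentiableAt.hasDerivAt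
      have h2 : HasDerivAt (fun v => -sinF x (-v)) (-(deriv (sinF x) (-1) * -1)) 1 :=
        (h1.comp (1 : ℂ) (hasDerivAt_neg 1)).neg
      have h3 : (fun v => -sinF x (-v)) = sinF x := by
        funext v; rw [sinF_neg, neg_neg]
      rw [h3] at h2
      rw [h2.deriv]
      ring
    rw [(hder 0 h0d).deriv, uScaled_zero hx, hodd, hS1.2, hα]
    have hKc : (ellK x : ℂ) ≠ 0 := by exact_mod_cast hK.ne'
    have hsc : (Real.sqrt x : ℂ) ≠ 0 := by exact_mod_cast hsx.ne'
    have h1x : (1 : ℂ) - x ≠ 0 := by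
      have : (1 : ℝ) - x ≠ 0 := by linarith [hx.2]
      exact_mod_cast this
    have h2x : (1 : ℂ) + x ≠ 0 := by
      have : (1 : ℝ) + x ≠ 0 := by linarith [hx.1]
      exact_mod_cast this
    rw [show (1 : ℂ) - (x : ℂ) ^ 2 = (1 - x) * (1 + x) by ring]
    push_cast
    field_simp
    norm_num
  · rw [hα]
    have := hx.1
    positivity

end ConformalEllipse

end KUCV

/-! ### The corollary. -/

theorem mainTheorem6 (k : ℝ) (hk : 0 ≤ k) :
    (1 < k → ∃! x : ℝ, KUCV.IsModulus k x) ∧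
    ∀ x : ℝ, (1 < k → KUCV.IsModulus k x) →
      -- `P_k` is a conformal map of the disk onto `Ω_k`, and `P_k(z) = 1 + α_{k1} z + ⋯`
      (DifferentiableOn ℂ (KUCV.P k x) KUCV.disk ∧
        Set.BijOn (KUCV.P k x) KUCV.disk (KUCV.Omega k) ∧
        KUCV.P k x 0 = 1 ∧
        deriv (KUCV.P k x) 0 = (KUCV.alpha k x : ℂ) ∧
        0 < KUCV.alpha k x) ∧
      ∀ z₀ ∈ KUCV.disk, z₀ ≠ 0 →
      ∀ l : ℂ, ‖l‖ ≤ KUCV.alpha k x / 2 →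
      ∀ γ : ℂ, γ = 2 * l / (KUCV.alpha k x : ℂ) →
        (‖γ‖ = 1 →
          KUCV.V k z₀ l =
            {KUCV.segIntegral (fun ζ => ζ⁻¹ * (KUCV.P k x (γ * ζ) - 1)) z₀}) ∧
        (‖γ‖ < 1 →
          KUCV.V k z₀ l = KUCV.Q k x γ z₀ '' KUCV.closedDisk ∧
          AnalyticOnNhd ℂ (KUCV.Q k x γ z₀) KUCV.closedDisk ∧
          Set.InjOn (KUCV.Q k x γ z₀) KUCV.closedDisk ∧
          Convex ℝ (KUCV.Q k x γ z₀ '' KUCV.disk) ∧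
          Convex ℝ (KUCV.Q k x γ z₀ '' KUCV.closedDisk) ∧
          ∀ ε ∈ KUCV.circle, ∀ f : ℂ → ℂ,
            (f ∈ KUCV.UCV k ∧ KUCV.coeff 2 f = l ∧
                ∃ L, KUCV.IsLogDeriv f L ∧ L z₀ = KUCV.Q k x γ z₀ ε) ↔
              ∀ z ∈ KUCV.disk,
                f z = KUCV.segIntegral (fun ζ => Complex.exp (KUCV.Q k x γ ζ ε)) z) := by
  refine ⟨KUCV.existsUnique_modulus, fun x hx => ?_⟩
  obtain ⟨h, h0, hd, hα⟩ : KUCV.IsConvexMap (KUCV.P k x) (KUCV.Omega k) ∧ KUCV.P k x 0 = 1 ∧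
      deriv (KUCV.P k x) 0 = (KUCV.alpha k x : ℂ) ∧ 0 < KUCV.alpha k x := by
    rcases lt_trichotomy k 1 with h1 | rfl | h1
    · exact KUCV.conformal_lt_one hk h1 x
    · exact KUCV.conformal_one x
    · exact KUCV.conformal_gt_one h1 (hx h1)
  refine ⟨⟨h.diff, h.bij, h0, hd, hα⟩, fun z₀ hz hz0 l _ γ hγ => ?_⟩
  have hQ : ∀ z, KUCV.Q k x γ z =
      fun ε => KUCV.logInt (KUCV.P k x) (fun ζ => KUCV.mob γ (ζ * ε)) z := fun z =>
    funext fun ε => KUCV.Q_eq_logInt k x γ z ε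
  simp only [hQ]
  exact h.variability h0 hα hd hz hz0 hγ
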